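/- **Conventions.** A set $V\subset\mathbb R^N$ is *$\mathbb Q$-algebraic* if it is the real zero set of a set of polynomials in $\mathbb Q[x]=\mathbb Q[x_1,\dots,x_N]$; $\mathcal I_K(V)\subset K[x]$ (for $K=\mathbb Q,\mathbb R$) is the ideal of polynomials over $K$ vanishing on $V$, and $\dim V$ is the Krull dimension of $\mathbb R[x]/\mathcal I_{\mathbb R}(V)$. A $\mathbb Q$-algebraic set $V$ is *$\mathbb Q$-nonsingular* if, for every $a\in V$ and for both $K=\mathbb R$ and $K=\mathbb Q$, the ring $\mathbb R[x]_{\mathfrak n_a}/\mathcal I_K(V)\mathbb R[x]_{\mathfrak n_a}$ is a regular local ring of dimension $\dim V$, where $\mathfrak n_a$ is the maximal ideal of $a$ (for $K=\mathbb R$ alone, $V$ is *nonsingular*). It is *projectively $\mathbb Q$-closed* if $V$ is the real zero set of a single $p\in\mathbb Q[x]$ whose homogeneous component of top degree has real zero set $\varnothing$ or $\{0\}$. A *$\mathbb Q$-desingularization* of a $\mathbb Q$-algebraic set $V\subset\mathbb R^N$ is a projectively $\mathbb Q$-closed $\mathbb Q$-nonsingular $\mathbb Q$-algebraic set $V'\subset\mathbb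 R^N\times\mathbb R^p$, for some $p\in\mathbb N$, with $\dim V'=\dim V$, such that the projection $\pi:\mathbb R^N\times\mathbb R^p\to\mathbb R^N$ maps $V'$ into $V$ and $\pi|_{V'}:V'\to V$ is birational, i.e. it restricts to a biregular isomorphism between Zariski open dense subsets of $V'$ and of $V$. Let $m,n\in\mathbb N$. Identify $\mathbb R^{(m+n)^2}$ with the real $(m+n)\times(m+n)$ matrices, and for $0\le r\le m+n$ let $$\mathbb G_{r,m+n-r}=\{X : X^T=X,\ X^2=X,\ \operatorname{tr}X=r\}$$ be the embedded Grassmannian, where $X$ represents the $r$-dimensional subspace $W_X=\operatorname{im}X$. For $0\le\ell\le m+n$ let $\mathbb R^\ell\subset\mathbb R^{m+n}$ be the span of the first $\ell$ canonical basis vectors, and $D_\ell$ the matrix of the orthogonal projection onto it. For a partition $n\ge\lambda_1\ge\dots\ge\lambda_m\ge0$, the Schubert variety of $\mathbb G_{m,n}$ with respect to the canonical complete flag is $$\sigma_\lambda=\{X\in\mathbb G_{m,n} : \dim(W_X\cap\mathbb R^{\,n+k-\lambda_k})\ge k\ \text{ for } k=1,\dots,m\}.$$ **Theorem.** Every Schubert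 variety $\sigma_\lambda\subset\mathbb R^{(m+n)^2}$ admits a $\mathbb Q$-desingularization. More explicitly, there are integers $c\ge1$, $a_1,\dots,a_{c-1}\ge1$, $a_c\ge0$, $b_0\ge0$, $b_1,\dots,b_{c-1}\ge1$ with $a_1+\dots+a_c=m$, $b_0+\dots+b_{c-1}=n$ and $\lambda_j=\sum_{k=i}^{c-1}b_k$ whenever $1\le i\le c$ and $a_1+\dots+a_{i-1}<j\le a_1+\dots+a_i$. For any such integers put $m_k=\sum_{i=1}^ka_i$, $n_k=m+n-m_k$ and $d_k=m_k+\sum_{i=0}^{k-1}b_i$. Then the embedded Bott–Samelson variety $$Z_\lambda=\{(X,Y_{c-1},\dots,Y_1)\in\mathbb G_{m,n}\times\mathbb G_{m_{c-1},n_{c-1}}\times\dots\times\mathbb G_{m_1,n_1} : Y_iD_{d_i}=Y_i\ (1\le i\le c-1),\ Y_{i+1}Y_i=Y_i\ (1\le i\le c-2),\ XY_{c-1}=Y_{c-1}\}$$ (the last condition being empty if $c=1$) is a $\mathbb Q$-desingularization of $\sigma_\lambda$, and the projection $(X,Y_{c-1},\dots,Y_1)\mapsto X$ maps $Z_\lambda$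 onto $\sigma_\lambda$. -/

import Mathlib

noncomputable section

namespace RealQAlg

open MvPolynomial

/-! ### Algebraic subsets of real affine space, over a subfield `K` of `ℝ`

Real affine space is `ι → ℝ` with `ι` a finite index type of coordinates. The field `K` is used
with `K = ℚ` and `K = ℝ`. -/

section Affine

variable {ι : Type*}

/-- `V ⊆ ℝ^ι` is a `K`-algebraic set: the real zero set of some set of polynomials over `K`. -/
def IsAlgebraicOver (K : Type) [Field K] [Algebra K ℝ] (V : Set (ι → ℝ)) : Prop :=
  ∃ F : Set (MvPolynomial ι K), V = {x | ∀ p ∈ F, aeval x p = 0}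

/-- The dimension of `V`: the Krull dimension of `ℝ[x] / I_ℝ(V)`. -/
def algDim (V : Set (ι → ℝ)) : WithBot ℕ∞ :=
  ringKrullDim (MvPolynomial ι ℝ ⧸ vanishingIdeal ℝ V)

/-- The localization of `ℝ[x]` at the maximal ideal of the polynomials vanishing at `a`. -/
abbrev LocalPolyRing (a : ι → ℝ) : Type _ :=
  Localization.AtPrime (vanishingIdeal ℝ ({a} : Set (ι → ℝ)))

/-- The `ℝ|K`-local ring of `V` at `a`, that is `ℝ[x]_{𝔫_a} / I_K(V) ℝ[x]_{𝔫_a}`. For `K = ℝ` it is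
the usual local ring of `V` at `a`. -/
abbrev RelLocalRing (K : Type) [Field K] [Algebra K ℝ] (V : Set (ι → ℝ)) (a : ι → ℝ) : Type _ :=
  LocalPolyRing a ⧸
    (((vanishingIdeal K V).map (MvPolynomial.map (algebraMap K ℝ))).map
      (algebraMap (MvPolynomial ι ℝ) (LocalPolyRing a)))

/-- The `ℝ|K`-regular points of `V`. For `K = ℝ` these are the usual nonsingular points `Reg(V)`;
for `K = ℚ` they are the points of `Reg^{ℝ|ℚ}(V)`. -/
def regPoints (K : Type) [Field K] [Algebra K ℝ] (V : Set (ι → ℝ)) : Set (ι → ℝ) :=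
  {a | a ∈ V ∧ IsRegularLocalRing (RelLocalRing K V a) ∧
    ringKrullDim (RelLocalRing K V a) = algDim V}

/-- `V` is a nonsingular algebraic set. -/
def IsNonsingularAlgebraic (V : Set (ι → ℝ)) : Prop :=
  IsAlgebraicOver ℝ V ∧ regPoints ℝ V = V

/-- `V` is a `ℚ`-nonsingular `ℚ`-algebraic set: `V = Reg(V) = Reg^{ℝ|ℚ}(V)`. -/
def IsQNonsingularQAlgebraic (V : Set (ι → ℝ)) : Prop :=
  IsAlgebraicOver ℚ V ∧ regPoints ℝ V = V ∧ regPoints ℚ V = V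

/-- A rational polynomial is overt if the real zero set of its homogeneous component of top degree
is either empty or the origin alone (the zero polynomial has degree `0`). -/
def IsOvert (p : MvPolynomial ι ℚ) : Prop :=
  {x : ι → ℝ | aeval x (homogeneousComponent p.totalDegree p) = 0} = ∅ ∨
    {x : ι → ℝ | aeval x (homogeneousComponent p.totalDegree p) = 0} = {0}

/-- `V` is projectively `ℚ`-closed: the real zero set of one overt rational polynomial. -/
def IsProjectivelyQClosed (V : Set (ι → ℝ)) : Prop :=
  ∃ p : MvPolynomial ι ℚ, IsOvert p ∧ V = {x | aeval x p = 0}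

/-- `U` is a Zariski open and Zariski dense subset of `V`. -/
def IsZariskiOpenDenseIn (U V : Set (ι → ℝ)) : Prop :=
  (∃ C : Set (ι → ℝ), IsAlgebraicOver ℝ C ∧ U = V \ C) ∧
    ∀ C : Set (ι → ℝ), IsAlgebraicOver ℝ C → U ⊆ C → V ⊆ C

/-- `f` is a (real) regular map on `S`: each of its coordinates is a quotient of polynomials whose
denominator has no zero on `S`. -/
def IsRegularMapOn {κ : Type*} (S : Set (ι → ℝ)) (f : (ι → ℝ) → (κ → ℝ)) : Prop :=
  ∀ j : κ, ∃ p q : MvPolynomial ι ℝ, ∀ x ∈ S, eval x q ≠ 0 ∧ f x j = eval x p / eval x q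

/-- The restriction `f : V' → V` is a birational (regular) map: it is regular, and it restricts to a
biregular isomorphism, with inverse `g`, between Zariski open dense subsets of `V'` and `V`. -/
def IsBirationalMap {κ : Type*} (V' : Set (ι → ℝ)) (V : Set (κ → ℝ))
    (f : (ι → ℝ) → (κ → ℝ)) : Prop :=
  Set.MapsTo f V' V ∧ IsRegularMapOn V' f ∧
    ∃ (U' : Set (ι → ℝ)) (U : Set (κ → ℝ)) (g : (κ → ℝ) → (ι → ℝ)),
      IsZariskiOpenDenseIn U' V' ∧ IsZariskiOpenDenseIn U V ∧
      Set.MapsTo f U' U ∧ Set.MapsTo g U U' ∧ Set.InvOn g f U' U ∧ IsRegularMapOn U g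

/-- The projection `ℝ^ι × ℝ^κ → ℝ^ι` onto the first factor. -/
def projFst {κ : Type*} (z : ι ⊕ κ → ℝ) : ι → ℝ := fun i => z (Sum.inl i)

/-- `V' ⊆ ℝ^ι × ℝ^κ` is a desingularization of `V ⊆ ℝ^ι`. -/
def IsDesingularization {κ : Type*} (V : Set (ι → ℝ)) (V' : Set (ι ⊕ κ → ℝ)) : Prop :=
  IsNonsingularAlgebraic V' ∧ algDim V' = algDim V ∧ IsBirationalMap V' V projFst

/-- `V' ⊆ ℝ^ι × ℝ^κ` is a `ℚ`-desingularization of the `ℚ`-algebraic set `V ⊆ ℝ^ι`. -/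
def IsQDesingularization {κ : Type*} (V : Set (ι → ℝ)) (V' : Set (ι ⊕ κ → ℝ)) : Prop :=
  IsAlgebraicOver ℚ V ∧ IsDesingularization V V' ∧
    IsQNonsingularQAlgebraic V' ∧ IsProjectivelyQClosed V'

/-- `V` admits a `ℚ`-desingularization `V' ⊆ ℝ^ι × ℝ^κ` for some finite set `κ` of additional
coordinates. -/
def AdmitsQDesingularization (V : Set (ι → ℝ)) : Prop :=
  ∃ (κ : Type) (_ : Finite κ) (V' : Set (ι ⊕ κ → ℝ)), IsQDesingularization V V'

end Affine

/-! ### Embedded Grassmannians, Schubert varieties and Bott–Samelson varieties -/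

/-- Points of `ℝ^{N²}` as `N × N` real matrices. -/
def toMat {N : ℕ} (x : Fin N × Fin N → ℝ) : Matrix (Fin N) (Fin N) ℝ :=
  Matrix.of fun i j => x (i, j)

/-- The embedded Grassmannian of `r`-dimensional subspaces of `ℝ^N`, as orthogonal projection
matrices of trace `r`; `𝔾_{m,n}` is `grassmannian (m + n) m`. -/
def grassmannian (N r : ℕ) : Set (Matrix (Fin N) (Fin N) ℝ) :=
  {X | X.transpose = X ∧ X * X = X ∧ X.trace = (r : ℝ)}

/-- The `ℓ`-th member `ℝ^ℓ` of the canonical complete flag of `ℝ^N`: the span of the first `ℓ`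
vectors of the canonical basis. -/
def canonicalFlag (N ℓ : ℕ) : Submodule ℝ (Fin N → ℝ) :=
  Submodule.span ℝ {v | ∃ i : Fin N, i.val < ℓ ∧ v = Pi.single i 1}

/-- The diagonal matrix `D_ℓ` of the orthogonal projection of `ℝ^N` onto `ℝ^ℓ`. -/
def flagProj (N ℓ : ℕ) : Matrix (Fin N) (Fin N) ℝ :=
  Matrix.diagonal fun i => if i.val < ℓ then 1 else 0

/-- The Schubert variety `σ_λ` of `𝔾_{m,n} ⊆ ℝ^{(m+n)²}` with respect to the canonical complete
flag: the projections `X` whose image `W_X` satisfies `dim (W_X ∩ ℝ^{n+k-λ_k}) ≥ k` for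
`k = 1, …, m`. The part `λ_k` is `lam j` with `k = j + 1`. -/
def schubertVariety {m : ℕ} (n : ℕ) (lam : Fin m → ℕ) :
    Set (Fin (m + n) × Fin (m + n) → ℝ) :=
  {x | toMat x ∈ grassmannian (m + n) m ∧
    ∀ j : Fin m, j.val + 1 ≤
      Module.finrank ℝ ↥(LinearMap.range (toMat x).mulVecLin ⊓
        canonicalFlag (m + n) (n + (j.val + 1) - lam j))}

/-- The integers `c`, `a_1, …, a_c` and `b_0, …, b_{c-1}` describe the boundary staircase of the
Young diagram of `λ` in the `m × n` rectangle: `a_1, …, a_{c-1}` and `b_1, …, b_{c-1}` are positive,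
`a_1 + ⋯ + a_c = m`, `b_0 + ⋯ + b_{c-1} = n`, and `λ_j = b_i + ⋯ + b_{c-1}` whenever
`a_1 + ⋯ + a_{i-1} < j ≤ a_1 + ⋯ + a_i` (below, `j` is shifted by one). -/
def IsStaircase {m : ℕ} (n : ℕ) (lam : Fin m → ℕ) (c : ℕ) (a b : ℕ → ℕ) : Prop :=
  1 ≤ c ∧ (∀ i ∈ Finset.Ico 1 c, 0 < a i ∧ 0 < b i) ∧
    ∑ i ∈ Finset.Icc 1 c, a i = m ∧ ∑ i ∈ Finset.range c, b i = n ∧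
    ∀ i ∈ Finset.Icc 1 c, ∀ j : Fin m,
      ∑ l ∈ Finset.Ico 1 i, a l ≤ j.val → j.val < ∑ l ∈ Finset.Icc 1 i, a l →
        lam j = ∑ l ∈ Finset.Ico i c, b l

/-- `m_k = a_1 + ⋯ + a_k`. -/
def stepDim (a : ℕ → ℕ) (k : ℕ) : ℕ := ∑ i ∈ Finset.Icc 1 k, a i

/-- `d_k = m_k + b_0 + ⋯ + b_{k-1}`. -/
def stepFlag (a b : ℕ → ℕ) (k : ℕ) : ℕ := stepDim a k + ∑ i ∈ Finset.range k, b i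

/-- The matrix `Y_{i+1}` among the coordinates `(X, Y_1, …, Y_{c-1})`. -/
def matY {N c : ℕ} (z : (Fin N × Fin N) ⊕ (Fin (c - 1) × (Fin N × Fin N)) → ℝ) (i : Fin (c - 1)) :
    Matrix (Fin N) (Fin N) ℝ :=
  toMat fun p => z (Sum.inr (i, p))

/-- The embedded Bott–Samelson variety in `ℝ^{N²} × (ℝ^{N²})^{c-1}`, `N = m + n`: the tuples
`(X, Y_1, …, Y_{c-1})` with `X ∈ 𝔾_{m,n}`, `Y_k ∈ 𝔾_{m_k,N-m_k}`, `Y_k D_{d_k} = Y_k`,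
`Y_{k+1} Y_k = Y_k` and `X Y_{c-1} = Y_{c-1}`. The index `i : Fin (c - 1)` stands for
`k = i + 1`. -/
def bottSamelson (m n c : ℕ) (a b : ℕ → ℕ) :
    Set ((Fin (m + n) × Fin (m + n)) ⊕ (Fin (c - 1) × (Fin (m + n) × Fin (m + n))) → ℝ) :=
  {z | toMat (projFst z) ∈ grassmannian (m + n) m ∧
    (∀ i : Fin (c - 1), matY z i ∈ grassmannian (m + n) (stepDim a (i.val + 1))) ∧
    (∀ i : Fin (c - 1), matY z i * flagProj (m + n) (stepFlag a b (i.val + 1)) = matY z i) ∧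
    (∀ i j : Fin (c - 1), j.val = i.val + 1 → matY z j * matY z i = matY z i) ∧
    ∀ i : Fin (c - 1), i.val + 2 = c → toMat (projFst z) * matY z i = matY z i}

end RealQAlg

end

/-! Setting `Y c = X`, the variety `Z_λ` becomes a variety of nested subspaces, of dimensions `md 1
≤ ⋯ ≤ md c`, the `k`-th one contained in `ℝ^(dd k)`; this is `flagVariety`. Everything is proved for
it and translated back by `bottSamelson_eq` and `projFst_image`.

Irreducibility and rationality: each flag is spanned by the columns of a matrix `M` with prescribed
zero entries, and projections onto spans of columns are rational functions of `M` over `ℚ`. So the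
variety is the image of a nonempty open subset of affine space under a rational map over `ℚ`
(`exists_flagParam_image`). Hence its real ideal is prime, and density of rational points shows that
it is generated by rational polynomials (`vanishingIdeal_real_eq_map`). The two notions of
regularity therefore coincide.

Nonsingularity: through an orthonormal frame `M₀` there is a linear slice of frames `M₀ + T`, with
`T` orthogonal to the relevant columns of `M₀`. It parametrizes a neighbourhood of the flag by a
whole affine space, with a rational inverse (`sliceFrame`), so the local ring is that of an affine
space (`regular_of_chart`).

Projective closedness: all equations have the form quadratic plus affine, and the equation `YᵀY = Y`
makes the quadratic parts vanish only at the origin. The sum of the squares is then overt.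

Birationality: for generic `X` the member `Y k` is the projection onto `im X ∩ ℝ^(dd k)`, the kernel
of the symmetric matrix `incidence X (dd k)`. The projection onto the kernel of a symmetric matrix
of fixed nullity is a rational function of its entries, by Cayley–Hamilton (`smul_kernelProj_eq`). A
flag of coordinate subspaces supplies a generic point. Equality of dimensions follows from
birationality by comparing transcendence degrees.

The image is the Schubert variety by a dimension count in one direction and an orthonormal frame
adapted to the incidence conditions in the other (`projFst_image_flagVariety`). The staircase data
come from induction on `m`. -/

noncomputable section

namespace RealQAlg
open MvPolynomial

/-! ### Krull dimension and transcendence degree -/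

section Dimension

/-- Incomparability makes contraction of primes strictly monotone; conversely chains lift by lying
over and going up. -/
theorem ringKrullDim_eq_of_isIntegral (R S : Type*) [CommRing R] [CommRing S] [Algebra R S]
    [Algebra.IsIntegral R S] [FaithfulSMul R S] : ringKrullDim S = ringKrullDim R := by
  apply le_antisymm
  · refine Order.krullDim_le_of_strictMono (PrimeSpectrum.comap (algebraMap R S)) ?_
    intro p q hpq
    obtain ⟨hle, x, hx, hx'⟩ := SetLike.lt_iff_le_and_exists.mp
      (show p.asIdeal < q.asIdeal from hpq)
    exact Ideal.comap_lt_comap_of_integral_mem_sdiff hle ⟨hx, hx'⟩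
      (Algebra.IsIntegral.isIntegral x)
  · refine iSup_le fun l => ?_
    obtain ⟨P, hP, hPl⟩ := Ideal.exists_ideal_over_prime_of_isIntegral (S := S) l.head.asIdeal ⊥
      (by rw [Ideal.comap_bot_of_injective _ (FaithfulSMul.algebraMap_injective R S)]
          exact bot_le)
    have : P.IsPrime := hPl.1
    have : P.LiesOver l.head.asIdeal := ⟨hPl.2.symm⟩
    obtain ⟨L, hL, -⟩ := Ideal.exists_ltSeries_of_hasGoingUp l P
    exact le_iSup_of_le L (by rw [hL])

/-- An element `b` with `y b = x` is a root of `yX - x`, so `B` is algebraic over `A` and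
contributes nothing in the tower formula. -/
theorem trdeg_eq_of_fractions {k A B : Type} [Field k] [CommRing A] [IsDomain A] [CommRing B]
    [IsDomain B] [Algebra k A] [Algebra k B] (f : A →ₐ[k] B) (hf : Function.Injective f)
    (h : ∀ b, ∃ x y, f y ≠ 0 ∧ f y * b = f x) : Algebra.trdeg k A = Algebra.trdeg k B := by
  let := f.toRingHom.toAlgebra
  have : IsScalarTower k A B := IsScalarTower.of_algebraMap_eq fun x => (f.commutes x).symm
  have : FaithfulSMul A B := (faithfulSMul_iff_algebraMap_injective A B).mpr hf
  have : Algebra.IsAlgebraic A B := ⟨fun b => by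
    obtain ⟨x, y, hy, hxy⟩ := h b
    refine ⟨Polynomial.C y * Polynomial.X - Polynomial.C x, fun h0 => hy ?_, ?_⟩
    · have := congrArg (fun p => Polynomial.coeff p 1) h0
      simp [Polynomial.coeff_C] at this
      simp [this]
    · simp only [map_sub, map_mul, Polynomial.aeval_C, Polynomial.aeval_X]
      exact sub_eq_zero.mpr hxy⟩
  rw [← trdeg_add_eq k A (A := B), trdeg_eq_zero (R := A), add_zero]

/-- By Noether normalization `A` is integral over a polynomial ring, whose number of variables is
both invariants. -/
theorem ringKrullDim_eq_of_trdeg_eq {k A : Type} [Field k] [CommRing A] [IsDomain A] [Algebra k A]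
    [Algebra.FiniteType k A] {d : ℕ} (hd : Algebra.trdeg k A = d) : ringKrullDim A = d := by
  obtain ⟨s, g, hg, hint⟩ := exists_integral_inj_algHom_of_fg k A
  let := g.toRingHom.toAlgebra
  have : IsScalarTower k (MvPolynomial (Fin s) k) A :=
    IsScalarTower.of_algebraMap_eq fun x => (g.commutes x).symm
  have : FaithfulSMul (MvPolynomial (Fin s) k) A :=
    (faithfulSMul_iff_algebraMap_injective _ A).mpr hg
  have : Algebra.IsIntegral (MvPolynomial (Fin s) k) A := ⟨hint⟩
  have h1 := trdeg_add_eq k (MvPolynomial (Fin s) k) (A := A)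
  rw [trdeg_eq_zero (R := MvPolynomial (Fin s) k), add_zero, hd] at h1
  have h2 : s = d := by simpa using h1
  rw [ringKrullDim_eq_of_isIntegral (MvPolynomial (Fin s) k) A,
    MvPolynomial.ringKrullDim_of_isNoetherianRing, ringKrullDim_eq_zero_of_field, h2]
  simp

end Dimension

end RealQAlg

end

noncomputable section

namespace RealQAlg
open MvPolynomial

/-! ### Calculus of rational functions and rational matrix-valued maps -/

section RationalFunctions

variable {τ : Type*} {K : Type} [Field K] [Algebra K ℝ] {S : Set (τ → ℝ)}

/-- On `S`, the function `f` is a quotient of polynomials over `K` with nonvanishing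
denominator. -/
def RatOn (K : Type) [Field K] [Algebra K ℝ] (S : Set (τ → ℝ)) (f : (τ → ℝ) → ℝ) : Prop :=
  ∃ p q : MvPolynomial τ K, ∀ x ∈ S, aeval x q ≠ 0 ∧ f x = aeval x p / aeval x q

namespace RatOn

theorem congr {f g : (τ → ℝ) → ℝ} (hf : RatOn K S f) (h : ∀ x ∈ S, g x = f x) :
    RatOn K S g := by
  obtain ⟨p, q, hpq⟩ := hf
  exact ⟨p, q, fun x hx => ⟨(hpq x hx).1, (h x hx).trans (hpq x hx).2⟩⟩

theorem poly (p : MvPolynomial τ K) : RatOn K S (fun x => aeval x p) :=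
  ⟨p, 1, fun x _ => by simp⟩

theorem coord (i : τ) : RatOn K S (fun x => x i) :=
  (poly (X i)).congr fun x _ => by simp

theorem const (c : K) : RatOn K S (fun _ => algebraMap K ℝ c) :=
  (poly (C c)).congr fun x _ => by simp

theorem zero : RatOn K S (fun _ => 0) := (const 0).congr fun _ _ => by simp

theorem one : RatOn K S (fun _ => 1) := (const 1).congr fun _ _ => by simp

theorem add {f g : (τ → ℝ) → ℝ} (hf : RatOn K S f) (hg : RatOn K S g) :
    RatOn K S (fun x => f x + g x) := by
  obtain ⟨p, q, hpq⟩ := hf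
  obtain ⟨p', q', hpq'⟩ := hg
  refine ⟨p * q' + q * p', q * q', fun x hx => ?_⟩
  obtain ⟨h1, h2⟩ := hpq x hx
  obtain ⟨h1', h2'⟩ := hpq' x hx
  refine ⟨by simp [h1, h1'], ?_⟩
  simp only [h2, h2', map_add, map_mul]
  exact div_add_div _ _ h1 h1'

theorem mul {f g : (τ → ℝ) → ℝ} (hf : RatOn K S f) (hg : RatOn K S g) :
    RatOn K S (fun x => f x * g x) := by
  obtain ⟨p, q, hpq⟩ := hf
  obtain ⟨p', q', hpq'⟩ := hg
  refine ⟨p * p', q * q', fun x hx => ?_⟩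
  obtain ⟨h1, h2⟩ := hpq x hx
  obtain ⟨h1', h2'⟩ := hpq' x hx
  refine ⟨by simp [h1, h1'], ?_⟩
  simp only [h2, h2', map_mul]
  exact div_mul_div_comm _ _ _ _

theorem neg {f : (τ → ℝ) → ℝ} (hf : RatOn K S f) : RatOn K S (fun x => -f x) := by
  obtain ⟨p, q, hpq⟩ := hf
  refine ⟨-p, q, fun x hx => ⟨(hpq x hx).1, ?_⟩⟩
  simp [(hpq x hx).2, neg_div]

theorem sub {f g : (τ → ℝ) → ℝ} (hf : RatOn K S f) (hg : RatOn K S g) :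
    RatOn K S (fun x => f x - g x) :=
  (hf.add hg.neg).congr fun _ _ => sub_eq_add_neg _ _

theorem inv {f : (τ → ℝ) → ℝ} (hf : RatOn K S f) (h0 : ∀ x ∈ S, f x ≠ 0) :
    RatOn K S (fun x => (f x)⁻¹) := by
  obtain ⟨p, q, hpq⟩ := hf
  refine ⟨q, p, fun x hx => ⟨fun h => h0 x hx ?_, ?_⟩⟩
  · rw [(hpq x hx).2, h, zero_div]
  · simp only [(hpq x hx).2, inv_div]

theorem sum {α : Type*} (s : Finset α) {f : α → (τ → ℝ) → ℝ} (hf : ∀ a ∈ s, RatOn K S (f a)) :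
    RatOn K S (fun x => ∑ a ∈ s, f a x) := by
  classical
  induction s using Finset.induction_on with
  | empty => simpa using zero
  | insert a s ha ih =>
    simp only [Finset.sum_insert ha]
    exact (hf a (by simp)).add (ih fun b hb => hf b (by simp [hb]))

theorem prod {α : Type*} (s : Finset α) {f : α → (τ → ℝ) → ℝ} (hf : ∀ a ∈ s, RatOn K S (f a)) :
    RatOn K S (fun x => ∏ a ∈ s, f a x) := by
  classical
  induction s using Finset.induction_on with
  | empty => simpa using one
  | insert a s ha ih =>
    simp only [Finset.prod_insert ha]
    exact (hf a (by simp)).mul (ih fun b hb => hf b (by simp [hb]))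

theorem comp {ι : Type*} (f : MvPolynomial ι K) {g : (τ → ℝ) → ι → ℝ}
    (hg : ∀ i, RatOn K S (fun x => g x i)) : RatOn K S (fun x => aeval (g x) f) := by
  induction f using MvPolynomial.induction_on with
  | C a => simpa using const a
  | add p q hp hq => simpa using hp.add hq
  | mul_X p i hp => simpa using hp.mul (hg i)

theorem toReal {f : (τ → ℝ) → ℝ} (hf : RatOn K S f) : RatOn ℝ S f := by
  obtain ⟨p, q, hpq⟩ := hf
  refine ⟨map (algebraMap K ℝ) p, map (algebraMap K ℝ) q, fun x hx => ?_⟩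
  simpa [aeval_map_algebraMap] using hpq x hx

end RatOn

theorem isRegularMapOn_iff {κ : Type*} {f : (τ → ℝ) → (κ → ℝ)} :
    IsRegularMapOn S f ↔ ∀ j, RatOn ℝ S (fun x => f x j) := by
  simp only [IsRegularMapOn, RatOn]; rfl

/-- A matrix-valued map all of whose entries satisfy `RatOn`. -/
def MatRatOn {m n : Type*} (K : Type) [Field K] [Algebra K ℝ] (S : Set (τ → ℝ))
    (F : (τ → ℝ) → Matrix m n ℝ) : Prop :=
  ∀ i j, RatOn K S (fun x => F x i j)

namespace MatRatOn

variable {l m n : Type*}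

theorem const_zero_one (A : Matrix m n ℝ) (h : ∀ i j, A i j = 0 ∨ A i j = 1) :
    MatRatOn K S (fun _ => A) := fun i j => by
  rcases h i j with h | h
  · exact RatOn.zero.congr fun _ _ => h
  · exact RatOn.one.congr fun _ _ => h

theorem const (A : Matrix m n ℝ) : MatRatOn ℝ S (fun _ => A) := fun i j => RatOn.const (A i j)

theorem one [DecidableEq m] : MatRatOn K S (fun _ => (1 : Matrix m m ℝ)) :=
  const_zero_one _ fun i j => by by_cases h : i = j <;> simp [Matrix.one_apply, h]

theorem diagonal [DecidableEq m] (p : m → Prop) [DecidablePred p] :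
    MatRatOn K S (fun _ => (Matrix.diagonal fun i => if p i then 1 else 0 : Matrix m m ℝ)) :=
  const_zero_one _ fun i j => by
    by_cases h : i = j
    · subst h; by_cases hp : p i <;> simp [hp]
    · simp [h]

theorem add {F G : (τ → ℝ) → Matrix m n ℝ} (hF : MatRatOn K S F) (hG : MatRatOn K S G) :
    MatRatOn K S (fun x => F x + G x) := fun i j => (hF i j).add (hG i j)

theorem sub {F G : (τ → ℝ) → Matrix m n ℝ} (hF : MatRatOn K S F) (hG : MatRatOn K S G) :
    MatRatOn K S (fun x => F x - G x) := fun i j => (hF i j).sub (hG i j)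

theorem smul {f : (τ → ℝ) → ℝ} {F : (τ → ℝ) → Matrix m n ℝ} (hf : RatOn K S f)
    (hF : MatRatOn K S F) : MatRatOn K S (fun x => f x • F x) := fun i j => hf.mul (hF i j)

theorem mul [Fintype m] {F : (τ → ℝ) → Matrix l m ℝ} {G : (τ → ℝ) → Matrix m n ℝ}
    (hF : MatRatOn K S F) (hG : MatRatOn K S G) : MatRatOn K S (fun x => F x * G x) :=
  fun i j => RatOn.sum _ fun k _ => (hF i k).mul (hG k j)

theorem sum {α : Type*} (s : Finset α) {F : α → (τ → ℝ) → Matrix m n ℝ}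
    (hF : ∀ a ∈ s, MatRatOn K S (F a)) : MatRatOn K S (fun x => ∑ a ∈ s, F a x) := fun i j => by
  simp only [Matrix.sum_apply]
  exact RatOn.sum s fun a ha => hF a ha i j

theorem pow [Fintype m] [DecidableEq m] {F : (τ → ℝ) → Matrix m m ℝ} (hF : MatRatOn K S F)
    (k : ℕ) : MatRatOn K S (fun x => F x ^ k) := by
  induction k with
  | zero => simpa using one
  | succ k ih => simpa only [pow_succ] using ih.mul hF

theorem transpose {F : (τ → ℝ) → Matrix m n ℝ} (hF : MatRatOn K S F) :
    MatRatOn K S (fun x => (F x).transpose) := fun i j => hF j i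

theorem det [Fintype m] [DecidableEq m] {F : (τ → ℝ) → Matrix m m ℝ} (hF : MatRatOn K S F) :
    RatOn K S (fun x => (F x).det) := by
  simp only [Matrix.det_apply']
  refine RatOn.sum _ fun σ _ => ?_
  refine RatOn.mul ((RatOn.const ((Equiv.Perm.sign σ : ℤ) : K)).congr fun _ _ => by simp) ?_
  exact RatOn.prod _ fun i _ => hF _ _

theorem inv [Fintype m] [DecidableEq m] {F : (τ → ℝ) → Matrix m m ℝ} (hF : MatRatOn K S F)
    (h0 : ∀ x ∈ S, (F x).det ≠ 0) : MatRatOn K S (fun x => (F x)⁻¹) := by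
  simp only [Matrix.inv_def, Ring.inverse_eq_inv']
  refine smul (hF.det.inv h0) fun i j => ?_
  simp only [Matrix.adjugate_apply]
  refine det fun a b => ?_
  by_cases h : a = j
  · subst h
    by_cases h' : b = i
    · subst h'; exact RatOn.one.congr fun _ _ => by simp
    · exact RatOn.zero.congr fun _ _ => by simp [h']
  · exact (hF a b).congr fun _ _ => by simp [h]

end MatRatOn

end RationalFunctions

end RealQAlg

end

noncomputable section

namespace RealQAlg
open MvPolynomial

/-! ### Local rings of affine space -/

section PointIdeals

/-- Induction on the variables: adding one variable, the ideal of the point is a maximal ideal of a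
polynomial ring in that variable lying over the ideal of the projected point, so the height grows by
one. -/
theorem height_ker_aeval (τ : Type) [Finite τ] (b : τ → ℝ) :
    (RingHom.ker (aeval b : MvPolynomial τ ℝ →ₐ[ℝ] ℝ)).height = Nat.card τ := by
  induction τ using Finite.induction_empty_option with
  | @of_equiv α β e ih =>
    rw [← Nat.card_congr e, ← ih (b ∘ e), ← (renameEquiv ℝ e).toRingEquiv.height_comap]
    congr 1
    ext f
    simp [RingHom.mem_ker, aeval_rename]
  | h_empty =>
    have : RingHom.ker (aeval b : MvPolynomial PEmpty ℝ →ₐ[ℝ] ℝ) = ⊥ := by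
      rw [← RingHom.injective_iff_ker_eq_bot]
      intro f g hfg
      obtain ⟨c, rfl⟩ := C_surjective PEmpty f
      obtain ⟨d, rfl⟩ := C_surjective PEmpty g
      simpa using hfg
    rw [this]
    simp
  | @h_option σ _ ih =>
    let e := (optionEquivLeft ℝ σ).symm.toRingEquiv
    let g : Polynomial (MvPolynomial σ ℝ) →+* ℝ :=
      (aeval b : MvPolynomial (Option σ) ℝ →ₐ[ℝ] ℝ).toRingHom.comp e.toRingHom
    have hg : Function.Surjective g := fun c => ⟨Polynomial.C (C c), by simp [g, e]⟩
    have hC : ∀ f, g (Polynomial.C f) = aeval (b ∘ some) f := by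
      intro f
      induction f using MvPolynomial.induction_on with
      | C a => simp [g, e]
      | add p q hp hq => simp only [map_add, hp, hq]
      | mul_X p i hp => simp only [map_mul, hp]; simp [g, e]
    have h1 : (RingHom.ker (aeval b : MvPolynomial (Option σ) ℝ →ₐ[ℝ] ℝ)).comap e
        = RingHom.ker g := rfl
    have : (RingHom.ker g).IsMaximal := RingHom.ker_isMaximal_of_surjective g hg
    have : (RingHom.ker g).LiesOver
        (RingHom.ker (aeval (b ∘ some) : MvPolynomial σ ℝ →ₐ[ℝ] ℝ)) := ⟨by
      ext f
      simp only [RingHom.mem_ker, Ideal.under_def, Ideal.mem_comap, Polynomial.algebraMap_eq, hC]⟩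
    rw [← e.height_comap, h1, Polynomial.height_eq_height_add_one
      (RingHom.ker (aeval (b ∘ some) : MvPolynomial σ ℝ →ₐ[ℝ] ℝ)), ih, Finite.card_option]
    simp

theorem ringKrullDim_localPolyRing {τ : Type} [Finite τ] (b : τ → ℝ) :
    ringKrullDim (LocalPolyRing b) = Nat.card τ := by
  rw [IsLocalization.AtPrime.ringKrullDim_eq_height (vanishingIdeal ℝ ({b} : Set (τ → ℝ)))]
  have : vanishingIdeal ℝ ({b} : Set (τ → ℝ))
      = RingHom.ker (aeval b : MvPolynomial τ ℝ →ₐ[ℝ] ℝ) := by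
    ext; simp [RingHom.mem_ker]
  rw [this, height_ker_aeval]
  rfl

instance isRegularLocalRing_localPolyRing {τ : Type} [Finite τ] (b : τ → ℝ) :
    IsRegularLocalRing (LocalPolyRing b) := inferInstance

end PointIdeals

/-! ### Images of rational parametrizations: prime ideals and rational generators -/

section Parametrized

variable {ι τ : Type}

theorem eq_zero_of_aeval_eq_zero {K : Type} [Field K] [Algebra K ℝ] [Infinite K]
    {p s : MvPolynomial τ K} (hs : s ≠ 0)
    (h : ∀ t : τ → K, eval t s ≠ 0 → eval t p = 0) : p = 0 := by
  have : p * s = 0 := by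
    apply MvPolynomial.funext
    intro t
    by_cases ht : eval t s = 0
    · simp [ht]
    · simp [h t ht]
  exact (mul_eq_zero.mp this).resolve_right hs

/-- A polynomial vanishes on the image exactly when the numerator of its pullback vanishes off the
zeros of `s`, that is, when this numerator is the zero polynomial. Primality is thus inherited from
the domain `ℝ[τ]`. -/
theorem isPrime_vanishingIdeal_image {s : MvPolynomial τ ℝ} (hs : s ≠ 0)
    {Φ : (τ → ℝ) → ι → ℝ} (hΦ : ∀ i, RatOn ℝ {t | eval t s ≠ 0} (fun t => Φ t i)) :
    (vanishingIdeal ℝ (Φ '' {t | eval t s ≠ 0})).IsPrime := by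
  have key : ∀ f : MvPolynomial ι ℝ, ∃ p : MvPolynomial τ ℝ,
      ∀ t, eval t s ≠ 0 → (aeval (Φ t) f = 0 ↔ eval t p = 0) := by
    intro f
    obtain ⟨p, q, hpq⟩ := RatOn.comp f hΦ
    refine ⟨p, fun t ht => ?_⟩
    obtain ⟨h1, h2⟩ := hpq t ht
    dsimp only at h2
    rw [h2, div_eq_zero_iff, or_iff_left h1]
    rfl
  have hmem : ∀ f : MvPolynomial ι ℝ, f ∈ vanishingIdeal ℝ (Φ '' {t | eval t s ≠ 0}) ↔
      ∀ t, eval t s ≠ 0 → aeval (Φ t) f = 0 := by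
    intro f
    simp
  refine ⟨fun h => ?_, fun {f g} hfg => ?_⟩
  · obtain ⟨t, ht⟩ : ∃ t, eval t s ≠ 0 := by
      by_contra! h
      exact hs (MvPolynomial.funext fun t => by simpa using h t)
    have := (hmem 1).mp (by rw [h]; trivial) t ht
    simp at this
  · obtain ⟨p, hp⟩ := key f
    obtain ⟨q, hq⟩ := key g
    have : p * q = 0 := by
      refine eq_zero_of_aeval_eq_zero hs fun t ht => ?_
      have := (hmem _).mp hfg t ht
      rw [map_mul, mul_eq_zero, hp t ht, hq t ht] at this
      rw [map_mul, mul_eq_zero]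
      exact this
    rcases mul_eq_zero.mp this with h | h
    · exact Or.inl ((hmem f).mpr fun t ht => (hp t ht).mpr (by simp [h]))
    · exact Or.inr ((hmem g).mpr fun t ht => (hq t ht).mpr (by simp [h]))

/-- The scalars `b` form a `ℚ`-basis of the span of the coefficients of `f`. -/
theorem exists_rational_decomposition (f : MvPolynomial ι ℝ) :
    ∃ (n : ℕ) (b : Fin n → ℝ) (g : Fin n → MvPolynomial ι ℚ), LinearIndependent ℚ b ∧
      f = ∑ e, C (b e) * map (algebraMap ℚ ℝ) (g e) := by
  classical
  let W : Submodule ℚ ℝ := Submodule.span ℚ (f.support.image fun u => coeff u f : Finset ℝ)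
  have : FiniteDimensional ℚ W := FiniteDimensional.span_finset ℚ _
  let b := Module.finBasis ℚ W
  have hc : ∀ u ∈ f.support, coeff u f ∈ W := fun u hu =>
    Submodule.subset_span (by simpa using ⟨u, by simpa using hu, rfl⟩)
  let c : (ι →₀ ℕ) → W := fun u => if h : u ∈ f.support then ⟨coeff u f, hc u h⟩ else 0
  refine ⟨_, fun e => (b e : ℝ), fun e => ∑ u ∈ f.support, monomial u (b.repr (c u) e), ?_, ?_⟩
  · exact b.linearIndependent.map' W.subtype (Submodule.ker_subtype W)
  · conv_lhs => rw [f.as_sum]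
    simp only [map_sum, map_monomial, Finset.mul_sum, C_mul_monomial]
    rw [Finset.sum_comm]
    refine Finset.sum_congr rfl fun u hu => ?_
    rw [← map_sum]
    congr 1
    have h1 := congrArg (Subtype.val) (b.sum_repr (c u))
    simp only [c, dif_pos hu, Submodule.coe_sum, Submodule.coe_smul] at h1
    rw [← h1]
    refine Finset.sum_congr rfl fun e _ => ?_
    rw [Algebra.smul_def, mul_comm, show c u = ⟨coeff u f, hc u hu⟩ from dif_pos hu]

/-- Write a real polynomial vanishing on the image as `∑ b e • g e`, with `g e` rational and `b`
independent over `ℚ`. Rational parameters give rational points, where the values of the `g e` are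
rational, so independence makes each of them vanish. The numerator of the pullback of `g e` then
vanishes at all rational parameters off `s = 0`, hence identically. -/
theorem vanishingIdeal_real_eq_map {s : MvPolynomial τ ℚ} (hs : s ≠ 0)
    {Φ : (τ → ℝ) → ι → ℝ} (hΦ : ∀ i, RatOn ℚ {t | aeval t s ≠ 0} (fun t => Φ t i)) :
    (vanishingIdeal ℚ (Φ '' {t | aeval t s ≠ 0})).map (map (algebraMap ℚ ℝ)) =
      vanishingIdeal ℝ (Φ '' {t | aeval t s ≠ 0}) := by
  apply le_antisymm
  · rw [Ideal.map_le_iff_le_comap]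
    intro f hf x hx
    rw [aeval_map_algebraMap]
    exact hf x hx
  · intro f hf
    obtain ⟨n, b, g, hb, rfl⟩ := exists_rational_decomposition f
    refine Ideal.sum_mem _ fun e _ => Ideal.mul_mem_left _ _ (Ideal.mem_map_of_mem _ ?_)
    have hcast : ∀ (t : τ → ℚ) (p : MvPolynomial τ ℚ),
        aeval (fun i => (t i : ℝ)) p = ((eval t p : ℚ) : ℝ) := by
      intro t p
      have := aeval_algebraMap_apply ℝ t p
      exact this
    have hrat : ∀ t : τ → ℚ, eval t s ≠ 0 → ∃ x : ι → ℚ, Φ (fun i => (t i : ℝ)) =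
        fun i => (x i : ℝ) := by
      intro t ht
      choose p q hpq using hΦ
      refine ⟨fun i => eval t (p i) / eval t (q i), funext fun i => ?_⟩
      have h := (hpq i (fun i => (t i : ℝ)) (by
        rw [Set.mem_ofPred_eq, hcast]; exact_mod_cast ht)).2
      simpa [hcast] using h
    obtain ⟨p, q, hpq⟩ := RatOn.comp (g e) hΦ
    have hp : p = 0 := by
      refine eq_zero_of_aeval_eq_zero hs fun t ht => ?_
      have ht' : (fun i => (t i : ℝ)) ∈ {t | aeval t s ≠ 0} := by
        rw [Set.mem_ofPred_eq, hcast]; exact_mod_cast ht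
      obtain ⟨x, hx⟩ := hrat t ht
      have h0 := hf (Φ fun i => (t i : ℝ)) ⟨_, ht', rfl⟩
      have hx' : ∀ h : MvPolynomial ι ℚ, aeval (fun i => (x i : ℝ)) h = ((eval x h : ℚ) : ℝ) := by
        intro h
        exact aeval_algebraMap_apply ℝ x h
      have h1 : ∀ e, eval x (g e) = 0 := by
        refine Fintype.linearIndependent_iff.mp hb (fun e => eval x (g e)) ?_
        rw [← h0, map_sum]
        refine Finset.sum_congr rfl fun e _ => ?_
        rw [map_mul, hx, aeval_map_algebraMap, hx', Algebra.smul_def, mul_comm]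
        simp
      obtain ⟨h2, h3⟩ := hpq _ ht'
      simp only [hx, hx', h1, Rat.cast_zero] at h3
      rw [eq_comm, div_eq_zero_iff, or_iff_left h2, hcast] at h3
      exact_mod_cast h3
    rintro _ ⟨t, ht, rfl⟩
    simpa [hp] using (hpq t ht).2

theorem regPoints_rat_eq {V : Set (ι → ℝ)}
    (h : (vanishingIdeal ℚ V).map (map (algebraMap ℚ ℝ)) = vanishingIdeal ℝ V) :
    regPoints ℚ V = regPoints ℝ V := by
  have h' : (vanishingIdeal ℚ V).map (map (algebraMap ℚ ℝ)) =
      (vanishingIdeal ℝ V).map (map (algebraMap ℝ ℝ)) := by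
    rw [h]
    have : (map (algebraMap ℝ ℝ) : MvPolynomial ι ℝ →+* MvPolynomial ι ℝ) = RingHom.id _ :=
      RingHom.ext fun p => map_id p
    rw [this, Ideal.map_id]
  ext a
  simp only [regPoints, RelLocalRing]
  rw [h']

/-- If `f` vanishes where `h ≠ 0`, then `f * h` lies in the prime ideal of `V`, while `h` does not.
-/
theorem isZariskiOpenDenseIn_of_isPrime {V : Set (ι → ℝ)} (hV : (vanishingIdeal ℝ V).IsPrime)
    {h : MvPolynomial ι ℝ} (hh : ∃ x ∈ V, aeval x h ≠ 0) :
    IsZariskiOpenDenseIn {x ∈ V | aeval x h ≠ 0} V := by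
  refine ⟨⟨{x | aeval x h = 0}, ⟨{h}, by simp⟩, by ext; simp⟩, ?_⟩
  rintro C ⟨F, rfl⟩ hU x hx f hf
  have : f * h ∈ vanishingIdeal ℝ V := by
    intro y hy
    by_cases hy' : aeval y h = 0
    · rw [map_mul, hy', mul_zero]
    · rw [map_mul, hU ⟨hy, hy'⟩ f hf, zero_mul]
  rcases hV.mem_or_mem this with h1 | h1
  · exact h1 x hx
  · obtain ⟨y, hy, hy'⟩ := hh
    exact absurd (h1 y hy) hy'

end Parametrized

end RealQAlg

end

noncomputable section

namespace RealQAlg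
open MvPolynomial

/-! ### Rational charts and regular local rings -/

section Charts

variable {ι τ : Type}

theorem isUnit_localPolyRing_iff {a : ι → ℝ} (f : MvPolynomial ι ℝ) :
    IsUnit (algebraMap (MvPolynomial ι ℝ) (LocalPolyRing a) f) ↔ aeval a f ≠ 0 := by
  rw [IsLocalization.AtPrime.isUnit_to_map_iff (LocalPolyRing a)
    (vanishingIdeal ℝ ({a} : Set (ι → ℝ)))]
  simp [Ideal.primeCompl]

theorem algebraMap_localPolyRing_injective (a : ι → ℝ) :
    Function.Injective (algebraMap (MvPolynomial ι ℝ) (LocalPolyRing a)) :=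
  IsLocalization.injective _
    (Ideal.primeCompl_le_nonZeroDivisors (vanishingIdeal ℝ ({a} : Set (ι → ℝ))))

instance isDomain_localPolyRing (a : ι → ℝ) : IsDomain (LocalPolyRing a) :=
  IsLocalization.isDomain_of_le_nonZeroDivisors (R := MvPolynomial ι ℝ) (LocalPolyRing a)
    (Ideal.primeCompl_le_nonZeroDivisors (vanishingIdeal ℝ ({a} : Set (ι → ℝ))))

/-- A rational map which is regular on the whole affine space induces a homomorphism from
polynomials to the local ring at any point. -/
theorem exists_pullback {ψ : (τ → ℝ) → ι → ℝ}
    (hψ : ∀ i, RatOn ℝ Set.univ (fun t => ψ t i)) (b : τ → ℝ) :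
    ∃ α : MvPolynomial ι ℝ →ₐ[ℝ] LocalPolyRing b, ∀ f, ∃ p q : MvPolynomial τ ℝ,
      (∀ t, aeval t q ≠ 0 ∧ aeval (ψ t) f = aeval t p / aeval t q) ∧
      α f * algebraMap _ _ q = algebraMap _ _ p := by
  choose P Q hPQ using hψ
  have hQ : ∀ i, IsUnit (algebraMap (MvPolynomial τ ℝ) (LocalPolyRing b) (Q i)) := fun i =>
    (isUnit_localPolyRing_iff _).mpr (hPQ i b trivial).1
  let α : MvPolynomial ι ℝ →ₐ[ℝ] LocalPolyRing b :=
    aeval fun i => algebraMap _ _ (P i) * ((hQ i).unit⁻¹ : (LocalPolyRing b)ˣ)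
  refine ⟨α, fun f => ?_⟩
  induction f using MvPolynomial.induction_on with
  | C c =>
    refine ⟨C c, 1, fun t => by simp, ?_⟩
    rw [map_one, mul_one, ← algebraMap_eq, ← algebraMap_eq, AlgHom.commutes,
      ← IsScalarTower.algebraMap_apply]
  | add f g hf hg =>
    obtain ⟨p, q, h, h'⟩ := hf
    obtain ⟨p2, q2, h2, h2'⟩ := hg
    refine ⟨p * q2 + q * p2, q * q2, fun t => ⟨?_, ?_⟩, ?_⟩
    · rw [map_mul]; exact mul_ne_zero (h t).1 (h2 t).1
    · simp only [map_add, map_mul, (h t).2, (h2 t).2]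
      exact div_add_div _ _ (h t).1 (h2 t).1
    · simp only [map_add, map_mul, ← h', ← h2']; ring
  | mul_X f i hf =>
    obtain ⟨p, q, h, h'⟩ := hf
    refine ⟨p * P i, q * Q i, fun t => ⟨?_, ?_⟩, ?_⟩
    · rw [map_mul]; exact mul_ne_zero (h t).1 (hPQ i t trivial).1
    · simp only [map_mul, (h t).2, aeval_X]
      rw [show ψ t i = _ from (hPQ i t trivial).2]
      exact div_mul_div_comm _ _ _ _
    · have : α (X i) * algebraMap _ _ (Q i) = algebraMap _ _ (P i) := by
        simp only [α, aeval_X]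
        rw [mul_assoc, IsUnit.val_inv_mul, mul_one]
      simp only [map_mul, ← h', ← this]; ring

/-- If the set `V` is irreducible and has a birational parametrization near `a` by affine space,
regular with regular inverse, then `a` is a nonsingular point of `V`. -/
theorem regular_of_chart [Finite ι] [Finite τ] {V : Set (ι → ℝ)}
    (hV : (vanishingIdeal ℝ V).IsPrime) {a : ι → ℝ} (ha : a ∈ V)
    {ψ : (τ → ℝ) → ι → ℝ} (hψ : ∀ i, RatOn ℝ Set.univ (fun t => ψ t i)) (hψV : ∀ t, ψ t ∈ V)
    {b : τ → ℝ} (hb : ψ b = a) {r : MvPolynomial ι ℝ} (hr : aeval a r ≠ 0)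
    {φ : (ι → ℝ) → τ → ℝ} (hφ : ∀ j, RatOn ℝ {x | aeval x r ≠ 0} (fun x => φ x j))
    (h1 : ∀ t, aeval (ψ t) r ≠ 0 → φ (ψ t) = t) (h2 : ∀ z ∈ V, aeval z r ≠ 0 → ψ (φ z) = z) :
    a ∈ regPoints ℝ V ∧ algDim V = Nat.card τ := by
  obtain ⟨α, hα⟩ := exists_pullback hψ b
  -- Plan: the pullback `α` along `ψ` extends to a map `β` of local rings from `a` to `b`. Its
  -- kernel is generated by the ideal of `V`, and the coordinates of `φ` make it surjective, so the
  -- local ring of `V` at `a` is the regular ring `LocalPolyRing b`.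
  have hunit : ∀ f, IsUnit (α f) ↔ aeval a f ≠ 0 := by
    intro f
    obtain ⟨p, q, hpq, h⟩ := hα f
    have hq : IsUnit (algebraMap _ (LocalPolyRing b) q) :=
      (isUnit_localPolyRing_iff q).mpr (hpq b).1
    rw [← hb, (hpq b).2, div_ne_zero_iff, and_iff_left (hpq b).1, ← isUnit_localPolyRing_iff, ← h,
      IsUnit.mul_iff, and_iff_left hq]
  have hzero : ∀ f, α f = 0 ↔ ∀ t, aeval (ψ t) f = 0 := by
    intro f
    obtain ⟨p, q, hpq, h⟩ := hα f
    have hq : IsUnit (algebraMap _ (LocalPolyRing b) q) :=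
      (isUnit_localPolyRing_iff q).mpr (hpq b).1
    rw [← hq.mul_left_eq_zero, h, map_eq_zero_iff _ (algebraMap_localPolyRing_injective b)]
    constructor
    · rintro rfl t
      simpa using (hpq t).2
    · intro h0
      refine MvPolynomial.funext fun t => ?_
      have := (hpq t).2
      rw [h0 t, eq_comm, div_eq_zero_iff, or_iff_left (hpq t).1] at this
      simpa using this
  have hker : ∀ f, α f = 0 ↔ f ∈ vanishingIdeal ℝ V := by
    intro f
    rw [hzero]
    refine ⟨fun h => ?_, fun h t => h _ (hψV t)⟩
    -- The chart covers only the part `r ≠ 0` of `V`; irreducibility removes the factor `r`.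
    have : f * r ∈ vanishingIdeal ℝ V := by
      intro z hz
      by_cases hz' : aeval z r = 0
      · rw [map_mul, hz', mul_zero]
      · rw [map_mul, ← h2 z hz hz', h, zero_mul]
    exact (hV.mem_or_mem this).resolve_right fun h => hr (h a ha)
  have hX : ∀ j, ∃ f g : MvPolynomial ι ℝ, aeval a g ≠ 0 ∧
      α f = algebraMap (MvPolynomial τ ℝ) _ (X j) * α g := by
    intro j
    obtain ⟨f, g, hfg⟩ := hφ j
    refine ⟨f, g, (hfg a hr).1, ?_⟩
    obtain ⟨p1, q1, hpq1, e1⟩ := hα f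
    obtain ⟨p2, q2, hpq2, e2⟩ := hα g
    obtain ⟨p3, q3, hpq3, e3⟩ := hα r
    have hp3 : p3 ≠ 0 := by
      rintro rfl
      apply hr
      rw [← hb, (hpq3 b).2]
      simp
    have hu1 : IsUnit (algebraMap _ (LocalPolyRing b) q1) :=
      (isUnit_localPolyRing_iff q1).mpr (hpq1 b).1
    have hu2 : IsUnit (algebraMap _ (LocalPolyRing b) q2) :=
      (isUnit_localPolyRing_iff q2).mpr (hpq2 b).1
    -- The identity `φ (ψ t) j = t j` with denominators cleared. It is known only where `r ∘ ψ` is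
    -- nonzero, which suffices because the numerator `p3` of `r ∘ ψ` is a nonzero polynomial.
    have hpoly : p1 * q2 - X j * p2 * q1 = 0 := by
      refine eq_zero_of_aeval_eq_zero hp3 fun t ht => ?_
      have hrt : aeval (ψ t) r ≠ 0 := by
        rw [(hpq3 t).2]
        exact div_ne_zero ht (hpq3 t).1
      obtain ⟨h3, h4⟩ := hfg (ψ t) hrt
      simp only [h1 t hrt] at h4
      rw [eq_div_iff h3, (hpq1 t).2, (hpq2 t).2] at h4
      have ha1 := (hpq1 t).1
      have ha2 := (hpq2 t).1
      field_simp at h4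
      simp only [map_sub, map_mul, eval_X]
      simp only [aeval_eq_eval] at h4
      linear_combination -h4
    apply hu1.mul_left_injective
    apply hu2.mul_left_injective
    dsimp only
    rw [e1, ← map_mul, sub_eq_zero.mp hpoly, map_mul, map_mul, ← e2]
    ring
  let β : LocalPolyRing a →+* LocalPolyRing b :=
    IsLocalization.lift (M := (vanishingIdeal ℝ ({a} : Set (ι → ℝ))).primeCompl)
      (g := (α : MvPolynomial ι ℝ →+* LocalPolyRing b)) fun y => (hunit y).mpr (by
        have := y.2
        simpa [Ideal.primeCompl] using this)
  have hβ : ∀ f, β (algebraMap _ _ f) = α f := fun f => IsLocalization.lift_eq _ f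
  have hrepr : ∀ y : LocalPolyRing a, ∃ f g : MvPolynomial ι ℝ, aeval a g ≠ 0 ∧
      y * algebraMap _ _ g = algebraMap _ _ f := by
    intro y
    obtain ⟨⟨f, g⟩, hfg⟩ := IsLocalization.surj
      (vanishingIdeal ℝ ({a} : Set (ι → ℝ))).primeCompl y
    exact ⟨f, g, by have := g.2; simpa [Ideal.primeCompl] using this, hfg⟩
  have hreprb : ∀ y : LocalPolyRing b, ∃ f g : MvPolynomial τ ℝ, aeval b g ≠ 0 ∧
      y * algebraMap _ _ g = algebraMap _ _ f := by
    intro y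
    obtain ⟨⟨f, g⟩, hfg⟩ := IsLocalization.surj
      (vanishingIdeal ℝ ({b} : Set (τ → ℝ))).primeCompl y
    exact ⟨f, g, by have := g.2; simpa [Ideal.primeCompl] using this, hfg⟩
  have hsurjX : ∀ f : MvPolynomial τ ℝ, ∃ y, β y = algebraMap _ _ f := by
    intro f
    induction f using MvPolynomial.induction_on with
    | C c =>
      refine ⟨algebraMap (MvPolynomial ι ℝ) _ (C c), ?_⟩
      rw [hβ, ← algebraMap_eq, ← algebraMap_eq, AlgHom.commutes, ← IsScalarTower.algebraMap_apply]
    | add p q hp hq =>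
      obtain ⟨y, hy⟩ := hp
      obtain ⟨z, hz⟩ := hq
      exact ⟨y + z, by rw [map_add, hy, hz, map_add]⟩
    | mul_X p j hp =>
      obtain ⟨y, hy⟩ := hp
      obtain ⟨f, g, hg, hfg⟩ := hX j
      have hu := (isUnit_localPolyRing_iff g).mpr hg
      refine ⟨y * (algebraMap _ _ f * (hu.unit⁻¹ : (LocalPolyRing a)ˣ)), ?_⟩
      rw [map_mul, hy, map_mul]
      apply ((hunit g).mpr hg).mul_left_injective
      dsimp only
      rw [map_mul, hβ, ← hβ g, mul_assoc, mul_assoc, ← map_mul β, IsUnit.val_inv_mul, map_one,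
        mul_one, hfg, hβ, mul_assoc]
  have hβunit : ∀ y, IsUnit (β y) → IsUnit y := by
    intro y hy
    obtain ⟨f, g, hg, hfg⟩ := hrepr y
    have hf : IsUnit (α f) := by
      rw [← hβ, ← hfg, map_mul, hβ]
      exact hy.mul ((hunit g).mpr hg)
    rw [hunit, ← isUnit_localPolyRing_iff, ← hfg] at hf
    exact isUnit_of_mul_isUnit_left hf
  have hsurj : Function.Surjective β := by
    intro y
    obtain ⟨f, g, hg, hfg⟩ := hreprb y
    obtain ⟨y1, hy1⟩ := hsurjX f
    obtain ⟨y2, hy2⟩ := hsurjX g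
    have hgu := (isUnit_localPolyRing_iff g).mpr hg
    have hu : IsUnit y2 := hβunit _ (by rw [hy2]; exact hgu)
    refine ⟨y1 * (hu.unit⁻¹ : (LocalPolyRing a)ˣ), ?_⟩
    apply hgu.mul_left_injective
    dsimp only
    rw [hfg, ← hy2, ← map_mul, mul_assoc, IsUnit.val_inv_mul, mul_one, hy1]
  have hkerβ : ((vanishingIdeal ℝ V).map (map (algebraMap ℝ ℝ))).map
      (algebraMap (MvPolynomial ι ℝ) (LocalPolyRing a)) = RingHom.ker β := by
    have hid : (map (algebraMap ℝ ℝ) : MvPolynomial ι ℝ →+* MvPolynomial ι ℝ) = RingHom.id _ :=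
      RingHom.ext fun p => map_id p
    rw [hid, Ideal.map_id]
    apply le_antisymm
    · rw [Ideal.map_le_iff_le_comap]
      intro f hf
      rw [Ideal.mem_comap, RingHom.mem_ker, hβ]
      exact (hker f).mpr hf
    · intro y hy
      obtain ⟨f, g, hg, hfg⟩ := hrepr y
      have hf : α f = 0 := by
        rw [← hβ, ← hfg, map_mul, RingHom.mem_ker.mp hy, zero_mul]
      have hu := (isUnit_localPolyRing_iff g).mpr hg
      rw [← Ideal.mul_unit_mem_iff_mem _ hu, hfg]
      exact Ideal.mem_map_of_mem _ ((hker f).mp hf)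
  let e : RelLocalRing ℝ V a ≃+* LocalPolyRing b :=
    (Ideal.quotEquivOfEq hkerβ).trans (RingHom.quotientKerEquivOfSurjective hsurj)
  -- The coordinate ring of `V` and the polynomial ring in `τ` both embed in `LocalPolyRing b`,
  -- whose elements are fractions of elements of either one; their transcendence degrees agree.
  have hdim : algDim V = Nat.card τ := by
    have := Ideal.Quotient.isDomain (vanishingIdeal ℝ V)
    let γ : (MvPolynomial ι ℝ ⧸ vanishingIdeal ℝ V) →ₐ[ℝ] LocalPolyRing b :=
      Ideal.Quotient.liftₐ _ α fun f hf => (hker f).mpr hf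
    have hγ : ∀ f, γ (Ideal.Quotient.mk _ f) = α f := fun f => rfl
    have hγinj : Function.Injective γ := by
      rw [injective_iff_map_eq_zero]
      intro y hy
      obtain ⟨f, rfl⟩ := Ideal.Quotient.mk_surjective y
      rw [hγ, hker] at hy
      exact Ideal.Quotient.eq_zero_iff_mem.mpr hy
    have t1 : Algebra.trdeg ℝ (MvPolynomial ι ℝ ⧸ vanishingIdeal ℝ V) =
        Algebra.trdeg ℝ (LocalPolyRing b) := by
      refine trdeg_eq_of_fractions γ hγinj fun y => ?_
      obtain ⟨x, rfl⟩ := hsurj y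
      obtain ⟨f, g, hg, hfg⟩ := hrepr x
      refine ⟨Ideal.Quotient.mk _ f, Ideal.Quotient.mk _ g, ?_, ?_⟩
      · rw [hγ]; exact ((hunit g).mpr hg).ne_zero
      · rw [hγ, hγ, ← hβ, ← hβ, ← map_mul, mul_comm, hfg]
    have t2 : Algebra.trdeg ℝ (MvPolynomial τ ℝ) = Algebra.trdeg ℝ (LocalPolyRing b) := by
      refine trdeg_eq_of_fractions (Algebra.algHom ℝ (MvPolynomial τ ℝ) (LocalPolyRing b))
        (algebraMap_localPolyRing_injective b) fun y => ?_
      obtain ⟨f, g, hg, hfg⟩ := hreprb y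
      exact ⟨f, g, ((isUnit_localPolyRing_iff g).mpr hg).ne_zero, by
        rw [mul_comm]; exact hfg⟩
    refine ringKrullDim_eq_of_trdeg_eq (k := ℝ) ?_
    rw [t1, ← t2, MvPolynomial.trdeg_of_isDomain, Cardinal.lift_id]
    exact (Nat.cast_card (α := τ)).symm
  refine ⟨⟨ha, IsRegularLocalRing.of_ringEquiv e.symm, ?_⟩, hdim⟩
  rw [ringKrullDim_eq_of_ringEquiv e, ringKrullDim_localPolyRing, hdim]

end Charts

end RealQAlg

end

noncomputable section

namespace RealQAlg
open MvPolynomial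

/-! ### Invariance of dimension under birational projections -/

section Birational

variable {ι κ : Type}

theorem nonempty_of_isPrime {V : Set (ι → ℝ)} (hV : (vanishingIdeal ℝ V).IsPrime) :
    V.Nonempty := by
  rw [Set.nonempty_iff_ne_empty]
  rintro rfl
  exact hV.ne_top vanishingIdeal_empty

theorem IsZariskiOpenDenseIn.nonempty {U V : Set (ι → ℝ)} (h : IsZariskiOpenDenseIn U V)
    (hV : V.Nonempty) : U.Nonempty := by
  rw [Set.nonempty_iff_ne_empty]
  rintro rfl
  exact hV.not_subset_empty (h.2 ∅ ⟨{1}, by simp⟩ le_rfl)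

theorem IsZariskiOpenDenseIn.mem_vanishingIdeal {U V : Set (ι → ℝ)}
    (h : IsZariskiOpenDenseIn U V) {f : MvPolynomial ι ℝ} (hf : ∀ x ∈ U, aeval x f = 0) :
    f ∈ vanishingIdeal ℝ V :=
  fun _ hx => h.2 {x | aeval x f = 0} ⟨{f}, by simp⟩ hf hx

theorem aeval_projFst (z : ι ⊕ κ → ℝ) (f : MvPolynomial ι ℝ) :
    aeval z (rename Sum.inl f) = aeval (projFst z) f := by
  rw [aeval_rename]; rfl

/-- Pullback embeds the coordinate ring of `V` in that of `V'`, since `U` is dense in `V`. Composing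
with the inverse `g` writes each function on `V'` as a fraction of functions on `V`, an identity
checked on the dense set `U'`. -/
theorem algDim_eq_of_isBirationalMap [Finite ι] [Finite κ] {V : Set (ι → ℝ)}
    {V' : Set (ι ⊕ κ → ℝ)} (hV : (vanishingIdeal ℝ V).IsPrime)
    (hV' : (vanishingIdeal ℝ V').IsPrime) (h : IsBirationalMap V' V projFst) :
    algDim V' = algDim V := by
  obtain ⟨hmaps, -, U', U, g, hU', hU, hfU, hgU, hinv, hg⟩ := h
  have := Ideal.Quotient.isDomain (vanishingIdeal ℝ V)
  have := Ideal.Quotient.isDomain (vanishingIdeal ℝ V')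
  have hsub' : U' ⊆ V' := by
    obtain ⟨⟨C, -, rfl⟩, -⟩ := hU'
    exact Set.sdiff_subset
  have hsub : U ⊆ V := by
    obtain ⟨⟨C, -, rfl⟩, -⟩ := hU
    exact Set.sdiff_subset
  let γ : (MvPolynomial ι ℝ ⧸ vanishingIdeal ℝ V) →ₐ[ℝ]
      (MvPolynomial (ι ⊕ κ) ℝ ⧸ vanishingIdeal ℝ V') :=
    Ideal.Quotient.liftₐ _ ((Ideal.Quotient.mkₐ ℝ _).comp (rename Sum.inl)) fun f hf => by
      refine Ideal.Quotient.eq_zero_iff_mem.mpr fun z hz => ?_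
      rw [RingHom.coe_coe, aeval_projFst]
      exact hf _ (hmaps hz)
  have hγ : ∀ f, γ (Ideal.Quotient.mk _ f) = Ideal.Quotient.mk _ (rename Sum.inl f) :=
    fun f => rfl
  have hγ0 : ∀ f, γ (Ideal.Quotient.mk _ f) = 0 → f ∈ vanishingIdeal ℝ V := by
    intro f hf
    rw [hγ, Ideal.Quotient.eq_zero_iff_mem] at hf
    refine hU.mem_vanishingIdeal fun x hx => ?_
    rw [← hinv.2 hx, ← aeval_projFst]
    exact hf _ (hsub' (hgU hx))
  have hγinj : Function.Injective γ := by
    rw [injective_iff_map_eq_zero]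
    intro y hy
    obtain ⟨f, rfl⟩ := Ideal.Quotient.mk_surjective y
    exact Ideal.Quotient.eq_zero_iff_mem.mpr (hγ0 f hy)
  have ht : Algebra.trdeg ℝ (MvPolynomial ι ℝ ⧸ vanishingIdeal ℝ V) =
      Algebra.trdeg ℝ (MvPolynomial (ι ⊕ κ) ℝ ⧸ vanishingIdeal ℝ V') := by
    refine trdeg_eq_of_fractions γ hγinj fun y => ?_
    obtain ⟨F, rfl⟩ := Ideal.Quotient.mk_surjective y
    obtain ⟨p, q, hpq⟩ := RatOn.comp F (isRegularMapOn_iff.mp hg)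
    refine ⟨Ideal.Quotient.mk _ p, Ideal.Quotient.mk _ q, fun h0 => ?_, ?_⟩
    · obtain ⟨x, hx⟩ := hU.nonempty (nonempty_of_isPrime hV)
      exact (hpq x hx).1 (hγ0 q h0 x (hsub hx))
    · rw [hγ, hγ, ← map_mul, Ideal.Quotient.eq]
      refine hU'.mem_vanishingIdeal fun z hz => ?_
      have h1 := (hpq _ (hfU hz)).2
      simp only [hinv.1 hz] at h1
      rw [eq_div_iff (hpq _ (hfU hz)).1] at h1
      rw [map_sub, map_mul, aeval_projFst, aeval_projFst, ← h1]
      ring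
  obtain ⟨d, hd⟩ := Cardinal.lt_aleph0.mp
    (trdeg_lt_aleph0_of_finiteType (R := ℝ) (S := MvPolynomial ι ℝ ⧸ vanishingIdeal ℝ V))
  rw [algDim, algDim, ringKrullDim_eq_of_trdeg_eq hd, ringKrullDim_eq_of_trdeg_eq (ht ▸ hd)]

end Birational

/-! ### Overt polynomials from quadratic equations -/

section Overt

variable {ι : Type}

theorem isOvert_of_homogeneousComponent {p : MvPolynomial ι ℚ} {d : ℕ} (hp : p.totalDegree ≤ d)
    (h : ∀ x : ι → ℝ, aeval x (homogeneousComponent d p) = 0 → x = 0) : IsOvert p := by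
  rcases hp.eq_or_lt with rfl | hlt
  · exact Set.subset_singleton_iff_eq.mp h
  -- If the degree is less than `d`, the component in degree `d` is zero, so `h` says that the whole
  -- space is the origin.
  · rw [homogeneousComponent_eq_zero _ _ hlt] at h
    exact Set.subset_singleton_iff_eq.mp fun x _ => h x (map_zero _)

/-- The polynomial is `∑ (q i + l i)²`. Its part of degree four is `∑ (q i)²`, the other terms
having degree at most three, and over `ℝ` a sum of squares vanishes only where all terms do. -/
theorem isProjectivelyQClosed_of_quadratic {α : Type*} [Finite α] {V : Set (ι → ℝ)}
    (q l : α → MvPolynomial ι ℚ) (hq : ∀ i, (q i).IsHomogeneous 2)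
    (hl : ∀ i, (l i).totalDegree ≤ 1) (hV : V = {x | ∀ i, aeval x (q i + l i) = 0})
    (h0 : ∀ x : ι → ℝ, (∀ i, aeval x (q i) = 0) → x = 0) : IsProjectivelyQClosed V := by
  have := Fintype.ofFinite α
  have hsum : ∀ (x : ι → ℝ) (f : α → MvPolynomial ι ℚ), aeval x (∑ i, f i ^ 2) = 0 →
      ∀ i, aeval x (f i) = 0 := by
    intro x f hx i
    simp only [map_sum, map_pow] at hx
    rw [Finset.sum_eq_zero_iff_of_nonneg fun i _ => sq_nonneg _] at hx
    exact pow_eq_zero_iff two_ne_zero |>.mp (hx i (Finset.mem_univ i))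
  have hq' : ∀ i, (q i).totalDegree ≤ 2 := fun i => (hq i).totalDegree_le
  have hcross : ∀ i, (2 * q i * l i + l i ^ 2).totalDegree ≤ 3 := by
    intro i
    refine (totalDegree_add _ _).trans (max_le ?_ ?_)
    · rw [mul_assoc, show (2 : MvPolynomial ι ℚ) = C 2 from (map_ofNat C 2).symm]
      refine (totalDegree_mul _ _).trans ?_
      rw [totalDegree_C, zero_add]
      exact (totalDegree_mul _ _).trans (add_le_add (hq' i) (hl i))
    · exact (totalDegree_pow _ _).trans (by have := hl i; lia)
  have hexp : ∀ i, (q i + l i) ^ 2 = q i ^ 2 + (2 * q i * l i + l i ^ 2) := fun i => by ring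
  refine ⟨∑ i, (q i + l i) ^ 2, isOvert_of_homogeneousComponent (d := 4) ?_ ?_, ?_⟩
  · refine (totalDegree_finsetSum_le fun i _ => ?_)
    refine (totalDegree_pow _ _).trans ?_
    have := (totalDegree_add (q i) (l i)).trans (max_le (hq' i) ((hl i).trans one_le_two))
    lia
  · intro x hx
    refine h0 x (hsum x q ?_)
    rw [← hx, map_sum (homogeneousComponent 4)]
    congr 1
    refine Finset.sum_congr rfl fun i _ => ?_
    rw [hexp, map_add, homogeneousComponent_eq_self (by simpa using (hq i).pow 2),
      homogeneousComponent_eq_zero _ _ (by have := hcross i; lia), add_zero]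
  · rw [hV]
    ext x
    refine ⟨fun h => ?_, hsum x _⟩
    rw [Set.mem_ofPred_eq, map_sum]
    exact Finset.sum_eq_zero fun i _ => by rw [map_pow, h i, zero_pow two_ne_zero]

end Overt

end RealQAlg

end

noncomputable section

namespace RealQAlg
open Matrix

/-! ### Orthogonal projections and spans of columns -/

section Projections

variable {N m : ℕ}

/-- The squared Frobenius norm of `Y - P` is `tr Y - tr P`. This serves throughout as the principle
that nested subspaces of equal dimension coincide. -/
theorem eq_of_mul_eq_of_trace_eq {Y P : Matrix (Fin N) (Fin N) ℝ} {r s : ℕ}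
    (hY : Y ∈ grassmannian N r) (hP : P ∈ grassmannian N s) (h : Y * P = P) (hrs : r = s) :
    Y = P := by
  obtain ⟨hY1, hY2, hY3⟩ := hY
  obtain ⟨hP1, hP2, hP3⟩ := hP
  have h' : P * Y = P := by
    have := congrArg transpose h
    rwa [transpose_mul, hY1, hP1] at this
  have h0 : ((Y - P)ᴴ * (Y - P)).trace = 0 := by
    rw [conjTranspose_eq_transpose_of_trivial, transpose_sub, hY1, hP1, sub_mul, mul_sub, mul_sub,
      hY2, hP2, h, h', sub_self, sub_zero, trace_sub, hY3, hP3, hrs, sub_self]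
  exact sub_eq_zero.mp (trace_conjTranspose_mul_self_eq_zero_iff.mp h0)

theorem finrank_range_of_mem_grassmannian {Y : Matrix (Fin N) (Fin N) ℝ} {r : ℕ}
    (hY : Y ∈ grassmannian N r) : Module.finrank ℝ (LinearMap.range Y.mulVecLin) = r := by
  have h : IsIdempotentElem Y.mulVecLin := by
    rw [IsIdempotentElem, Module.End.mul_eq_comp, ← mulVecLin_mul, hY.2.1]
  have h1 := (LinearMap.IsIdempotentElem.isProj_range _ h).trace
  have h2 : LinearMap.trace ℝ _ Y.mulVecLin = Y.trace := trace_toLin'_eq Y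
  rw [h2, hY.2.2] at h1
  exact_mod_cast h1.symm

theorem mem_range_iff_of_mem_grassmannian {Y : Matrix (Fin N) (Fin N) ℝ} {r : ℕ}
    (hY : Y ∈ grassmannian N r) {v : Fin N → ℝ} :
    v ∈ LinearMap.range Y.mulVecLin ↔ Y *ᵥ v = v := by
  constructor
  · rintro ⟨w, rfl⟩
    rw [mulVecLin_apply, mulVec_mulVec, hY.2.1]
  · intro h
    exact ⟨v, h⟩

theorem flagProj_transpose (N r : ℕ) : (flagProj N r)ᵀ = flagProj N r := diagonal_transpose _

theorem flagProj_mul (N r s : ℕ) : flagProj N r * flagProj N s = flagProj N (min r s) := by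
  rw [flagProj, flagProj, diagonal_mul_diagonal, flagProj]
  congr 1
  ext i
  simp only [mul_ite, mul_one, mul_zero, lt_min_iff]
  split_ifs <;> simp_all

theorem flagProj_mul_self (N r : ℕ) : flagProj N r * flagProj N r = flagProj N r := by
  rw [flagProj_mul, min_self]

theorem flagProj_eq_one {N r : ℕ} (h : N ≤ r) : flagProj N r = 1 := by
  rw [flagProj, ← diagonal_one]
  congr 1
  ext i
  rw [if_pos (i.2.trans_le h)]

theorem trace_flagProj {N r : ℕ} (h : r ≤ N) : (flagProj N r).trace = r := by
  rw [flagProj, trace_diagonal, Finset.sum_boole]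
  have : (Finset.univ.filter fun i : Fin N => i.val < r).card = r := by
    rw [Fin.card_filter_val_lt, min_eq_right h]
  rw [this]

theorem flagProj_mem_grassmannian {N r : ℕ} (h : r ≤ N) : flagProj N r ∈ grassmannian N r :=
  ⟨flagProj_transpose N r, flagProj_mul_self N r, trace_flagProj h⟩

theorem mul_flagProj_apply (M : Matrix (Fin N) (Fin m) ℝ) (r : ℕ) (i : Fin N) (j : Fin m) :
    (M * flagProj m r) i j = if j.val < r then M i j else 0 := by
  rw [flagProj, mul_diagonal]
  simp

theorem mulVec_eq_zero_of_det_ne_zero {A : Matrix (Fin m) (Fin m) ℝ} (hA : A.det ≠ 0)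
    {v : Fin m → ℝ} (hv : A *ᵥ v = 0) : v = 0 := by
  by_contra h
  exact hA (exists_mulVec_eq_zero_iff.mp ⟨v, h, hv⟩)

theorem mulVec_eq_zero_of_transpose_mul_self {A : Matrix (Fin N) (Fin m) ℝ} {v : Fin m → ℝ}
    (hv : (Aᵀ * A) *ᵥ v = 0) : A *ᵥ v = 0 := by
  have : (A *ᵥ v) ⬝ᵥ (A *ᵥ v) = 0 := by
    rw [dotProduct_mulVec, vecMul_mulVec, ← dotProduct_mulVec, hv, dotProduct_zero]
  exact dotProduct_self_eq_zero.mp this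

/-- The Gram matrix of the first `r` columns of `M`, completed by an identity block. -/
def gramBlock (r : ℕ) (M : Matrix (Fin N) (Fin m) ℝ) : Matrix (Fin m) (Fin m) ℝ :=
  flagProj m r * (Mᵀ * M) * flagProj m r + (1 - flagProj m r)

theorem flagProj_mul_gramBlock (r : ℕ) (M : Matrix (Fin N) (Fin m) ℝ) :
    flagProj m r * gramBlock r M = flagProj m r * (Mᵀ * M) * flagProj m r := by
  rw [gramBlock, mul_add, mul_sub, mul_one, flagProj_mul_self, sub_self, add_zero,
    ← Matrix.mul_assoc, ← Matrix.mul_assoc, flagProj_mul_self]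

theorem gramBlock_mul_flagProj (r : ℕ) (M : Matrix (Fin N) (Fin m) ℝ) :
    gramBlock r M * flagProj m r = flagProj m r * (Mᵀ * M) * flagProj m r := by
  rw [gramBlock, add_mul, sub_mul, one_mul, flagProj_mul_self, sub_self, add_zero, Matrix.mul_assoc,
    flagProj_mul_self]

theorem gramBlock_transpose (r : ℕ) (M : Matrix (Fin N) (Fin m) ℝ) :
    (gramBlock r M)ᵀ = gramBlock r M := by
  simp [gramBlock, transpose_mul, flagProj_transpose, Matrix.mul_assoc]

/-- With `D = flagProj m r`, a kernel vector `v` satisfies `M D v = 0` by positivity of the Gram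
form, so `D v = 0` by independence of the columns; the identity block then gives `v - D v = 0`. -/
theorem det_gramBlock_ne_zero (r : ℕ) {M : Matrix (Fin N) (Fin m) ℝ} (hM : (Mᵀ * M).det ≠ 0) :
    (gramBlock r M).det ≠ 0 := by
  intro h
  obtain ⟨v, hv, hv0⟩ := exists_mulVec_eq_zero_iff.mpr h
  apply hv
  have h1 : (M * flagProj m r) *ᵥ v = 0 := by
    apply mulVec_eq_zero_of_transpose_mul_self
    rw [transpose_mul, flagProj_transpose,
      show flagProj m r * Mᵀ * (M * flagProj m r) = flagProj m r * gramBlock r M by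
        rw [flagProj_mul_gramBlock]; simp only [Matrix.mul_assoc],
      ← mulVec_mulVec, hv0, mulVec_zero]
  have h2 : flagProj m r *ᵥ v = 0 := by
    apply mulVec_eq_zero_of_det_ne_zero hM
    rw [mulVec_mulVec, Matrix.mul_assoc, ← mulVec_mulVec, h1, mulVec_zero]
  have h3 : (1 - flagProj m r) *ᵥ v = 0 := by
    have : gramBlock r M *ᵥ v = flagProj m r *ᵥ (Mᵀ *ᵥ ((M * flagProj m r) *ᵥ v)) +
        (1 - flagProj m r) *ᵥ v := by
      rw [gramBlock, add_mulVec, mulVec_mulVec, mulVec_mulVec]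
      simp only [Matrix.mul_assoc]
    rw [this, h1, mulVec_zero, mulVec_zero, zero_add] at hv0
    exact hv0
  rw [sub_mulVec, h2, sub_zero, one_mulVec] at h3
  exact h3

/-- The orthogonal projection onto the span of the first `r` columns of `M`. -/
def spanProj (r : ℕ) (M : Matrix (Fin N) (Fin m) ℝ) : Matrix (Fin N) (Fin N) ℝ :=
  M * flagProj m r * (gramBlock r M)⁻¹ * (flagProj m r * Mᵀ)

theorem spanProj_mul {r : ℕ} {M : Matrix (Fin N) (Fin m) ℝ} (hM : (Mᵀ * M).det ≠ 0) :
    spanProj r M * (M * flagProj m r) = M * flagProj m r := by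
  have h := (isUnit_iff_ne_zero.mpr (det_gramBlock_ne_zero r hM))
  rw [spanProj, Matrix.mul_assoc, Matrix.mul_assoc (flagProj m r),
      ← Matrix.mul_assoc Mᵀ,
    ← Matrix.mul_assoc (flagProj m r), ← gramBlock_mul_flagProj, ← Matrix.mul_assoc,
    Matrix.mul_assoc (M * _), nonsing_inv_mul _ h,
    Matrix.mul_one, Matrix.mul_assoc, flagProj_mul_self]

theorem mul_spanProj {r : ℕ} {M : Matrix (Fin N) (Fin m) ℝ} {A : Matrix (Fin N) (Fin N) ℝ}
    (h : A * (M * flagProj m r) = M * flagProj m r) : A * spanProj r M = spanProj r M := by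
  rw [spanProj, Matrix.mul_assoc (M * _), ← Matrix.mul_assoc A, h]

theorem spanProj_mem_grassmannian {r : ℕ} (hr : r ≤ m) {M : Matrix (Fin N) (Fin m) ℝ}
    (hM : (Mᵀ * M).det ≠ 0) : spanProj r M ∈ grassmannian N r := by
  refine ⟨?_, mul_spanProj (spanProj_mul hM), ?_⟩
  · simp only [spanProj, transpose_mul, transpose_nonsing_inv, gramBlock_transpose,
      flagProj_transpose, transpose_transpose, Matrix.mul_assoc]
  · have h := (isUnit_iff_ne_zero.mpr (det_gramBlock_ne_zero r hM))
    rw [spanProj, Matrix.mul_assoc, trace_mul_comm, Matrix.mul_assoc,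
      Matrix.mul_assoc (flagProj m r),
      ← Matrix.mul_assoc Mᵀ,
      ← Matrix.mul_assoc (flagProj m r), ← flagProj_mul_gramBlock, trace_mul_comm, Matrix.mul_assoc,
      mul_nonsing_inv _ h, Matrix.mul_one, trace_flagProj hr]

theorem eq_spanProj {r : ℕ} (hr : r ≤ m) {M : Matrix (Fin N) (Fin m) ℝ}
    (hM : (Mᵀ * M).det ≠ 0) {Y : Matrix (Fin N) (Fin N) ℝ} (hY : Y ∈ grassmannian N r)
    (h : Y * (M * flagProj m r) = M * flagProj m r) : Y = spanProj r M :=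
  eq_of_mul_eq_of_trace_eq hY (spanProj_mem_grassmannian hr hM) (mul_spanProj h) rfl

theorem spanProj_mul_spanProj {r s : ℕ} (hrs : r ≤ s) {M : Matrix (Fin N) (Fin m) ℝ}
    (hM : (Mᵀ * M).det ≠ 0) : spanProj s M * spanProj r M = spanProj r M := by
  apply mul_spanProj
  have : M * flagProj m r = M * flagProj m s * flagProj m r := by
    rw [Matrix.mul_assoc, flagProj_mul, min_eq_right hrs]
  rw [this, ← Matrix.mul_assoc, spanProj_mul hM]

theorem spanProj_mul_flagProj {r d : ℕ} {M : Matrix (Fin N) (Fin m) ℝ}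
    (hM : ∀ i j, j.val < r → d ≤ i.val → M i j = 0) (hdet : (Mᵀ * M).det ≠ 0) (hr : r ≤ m) :
    spanProj r M * flagProj N d = spanProj r M := by
  have h : flagProj N d * spanProj r M = spanProj r M := by
    apply mul_spanProj
    ext i j
    rw [flagProj, diagonal_mul, mul_flagProj_apply]
    by_cases hi : i.val < d
    · simp [hi]
    · by_cases hj : j.val < r
      · simp [hi, hj, hM i j hj (not_lt.mp hi)]
      · simp [hj]
  have := congrArg transpose h
  rwa [transpose_mul, (spanProj_mem_grassmannian hr hdet).1, flagProj_transpose] at this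

/-- Orthonormal frames with the `j`-th vector in a prescribed subspace of dimension greater
than `j`. -/
theorem exists_orthonormal_frame : ∀ {m : ℕ} (V : Fin m → Submodule ℝ (Fin N → ℝ)),
    (∀ j, j.val + 1 ≤ Module.finrank ℝ (V j)) →
    ∃ M : Matrix (Fin N) (Fin m) ℝ, Mᵀ * M = 1 ∧ ∀ j, (fun i => M i j) ∈ V j
  | 0, _, _ => ⟨0, by ext i; exact i.elim0, fun j => j.elim0⟩
  | m + 1, V, h => by
    obtain ⟨M, hM, hV⟩ := exists_orthonormal_frame (fun j : Fin m => V j.castSucc)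
      fun j => h j.castSucc
    -- The last subspace has dimension at least `m + 1`, so it contains a nonzero vector orthogonal
    -- to the `m` vectors already chosen.
    have hker : LinearMap.ker (Mᵀ.mulVecLin.comp (V (Fin.last m)).subtype) ≠ ⊥ := by
      apply LinearMap.ker_ne_bot_of_finrank_lt
      rw [Module.finrank_fin_fun]
      exact h (Fin.last m)
    obtain ⟨⟨u, huV⟩, hu, hu0⟩ := Submodule.exists_mem_ne_zero_of_ne_bot hker
    replace hu : Mᵀ *ᵥ u = 0 := hu
    have hu0' : u ≠ 0 := fun h => hu0 (by simpa using h)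
    have hpos : 0 < u ⬝ᵥ u := by
      rcases (dotProduct_self_star_nonneg u).lt_or_eq with h | h
      · simpa using h
      · exact absurd (dotProduct_self_eq_zero.mp (by simpa using h.symm)) hu0'
    let v := (Real.sqrt (u ⬝ᵥ u))⁻¹ • u
    have hv : Mᵀ *ᵥ v = 0 := by simp only [v, mulVec_smul, hu, smul_zero]
    have hvv : v ⬝ᵥ v = 1 := by
      simp only [v, smul_dotProduct, dotProduct_smul, smul_eq_mul, ← mul_assoc, ← mul_inv]
      rw [Real.mul_self_sqrt hpos.le, inv_mul_cancel₀ hpos.ne']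
    refine ⟨of fun i j => Fin.lastCases (motive := fun _ => ℝ) (v i) (fun k => M i k) j, ?_, ?_⟩
    · ext i j
      rw [mul_apply]
      simp only [transpose_apply, of_apply]
      induction i using Fin.lastCases with
      | last =>
        induction j using Fin.lastCases with
        | last => simpa [dotProduct] using hvv
        | cast j =>
          simp only [Fin.lastCases_last, Fin.lastCases_castSucc]
          rw [one_apply_ne (Fin.castSucc_lt_last j).ne']
          have := congrFun hv j
          simp only [mulVec, dotProduct, transpose_apply] at this
          rw [← show _ = (0 : ℝ) from this]
          exact Finset.sum_congr rfl fun _ _ => mul_comm _ _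
      | cast i =>
        induction j using Fin.lastCases with
        | last =>
          simp only [Fin.lastCases_last, Fin.lastCases_castSucc]
          rw [one_apply_ne (Fin.castSucc_lt_last i).ne]
          exact congrFun hv i
        | cast j =>
          simp only [Fin.lastCases_castSucc]
          have := congrFun (congrFun hM i) j
          simp only [mul_apply, transpose_apply] at this
          refine Eq.trans this ?_
          simp [one_apply, Fin.castSucc_inj]
    · intro j
      induction j using Fin.lastCases with
      | last => simpa using (V (Fin.last m)).smul_mem _ huV
      | cast j => simpa using hV j

end Projections

/-! ### The kernel of a symmetric matrix through its characteristic polynomial -/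

section KernelProjection

variable {N : ℕ}

/-- A real symmetric matrix is diagonalizable, so the multiplicity of the root zero is the nullity.
-/
theorem exists_charpoly_factorization {A : Matrix (Fin N) (Fin N) ℝ} (hA : Aᵀ = A) :
    ∃ q : Polynomial ℝ, q.coeff 0 ≠ 0 ∧
      A.charpoly = Polynomial.X ^ Module.finrank ℝ (LinearMap.ker A.mulVecLin) * q := by
  have hH : A.IsHermitian := by
    rw [IsHermitian, conjTranspose_eq_transpose_of_trivial, hA]
  have hcard : Module.finrank ℝ (LinearMap.ker A.mulVecLin) =
      (Finset.univ.filter fun i => hH.eigenvalues i = 0).card := by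
    have h1 := LinearMap.finrank_range_add_finrank_ker A.mulVecLin
    have h2 : Module.finrank ℝ (LinearMap.range A.mulVecLin) = _ := hH.rank_eq_card_non_zero_eigs
    have h3 := Finset.card_filter_add_card_filter_not (s := Finset.univ)
      (fun i => hH.eigenvalues i = 0)
    rw [Fintype.card_subtype] at h2
    rw [Module.finrank_fin_fun, h2] at h1
    rw [Finset.card_univ, Fintype.card_fin] at h3
    simp only [ne_eq] at h1
    lia
  refine ⟨∏ i ∈ Finset.univ.filter (fun i => ¬ hH.eigenvalues i = 0),
    (Polynomial.X - Polynomial.C (hH.eigenvalues i)), ?_, ?_⟩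
  · rw [Polynomial.coeff_zero_eq_eval_zero, Polynomial.eval_prod, Finset.prod_ne_zero_iff]
    intro i hi
    simpa using (Finset.mem_filter.mp hi).2
  · rw [hH.charpoly_eq, hcard, ← Finset.prod_const,
      ← Finset.prod_filter_mul_prod_filter_not _ (fun i => hH.eigenvalues i = 0)]
    congr 1
    refine Finset.prod_congr rfl fun i hi => ?_
    simp [(Finset.mem_filter.mp hi).2]

/-- This turns lower bounds on a nullity into polynomial equations in the entries, with rational
coefficients. -/
theorem charpoly_coeff_eq_zero_iff {A : Matrix (Fin N) (Fin N) ℝ} (hA : Aᵀ = A) (s : ℕ) :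
    (∀ i < s, A.charpoly.coeff i = 0) ↔ s ≤ Module.finrank ℝ (LinearMap.ker A.mulVecLin) := by
  obtain ⟨q, hq, h⟩ := exists_charpoly_factorization hA
  constructor
  · intro h0
    by_contra! hlt
    have := h0 _ hlt
    rw [h, Polynomial.coeff_X_pow_mul', if_pos le_rfl, Nat.sub_self] at this
    exact hq this
  · intro hs i hi
    rw [h, Polynomial.coeff_X_pow_mul', if_neg (by lia)]

theorem mul_eq_zero_of_pow_mul_eq_zero {A B : Matrix (Fin N) (Fin N) ℝ} (hA : Aᵀ = A) :
    ∀ k, A ^ k * B = 0 → A * B = 0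
  | 0, h => by rw [pow_zero, one_mul] at h; rw [h, mul_zero]
  | 1, h => by rwa [pow_one] at h
  | k + 2, h => by
    refine mul_eq_zero_of_pow_mul_eq_zero hA (k + 1) ?_
    -- The Gram matrix of `A ^ (k + 1) * B` is `Bᵀ * A ^ k * (A ^ (k + 2) * B)`, which vanishes.
    rw [← trace_conjTranspose_mul_self_eq_zero_iff, conjTranspose_eq_transpose_of_trivial,
      transpose_mul, transpose_pow, hA, mul_assoc, ← mul_assoc (A ^ (k + 1)), ← pow_add,
      show k + 1 + (k + 1) = k + (k + 2) by ring, pow_add, mul_assoc, h]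
    simp

/-- The nonzero coefficient forces the nullity to be exactly `r`, so `P` projects onto the kernel
and the characteristic polynomial is `X ^ r * q`. Cayley–Hamilton and symmetry give `A * q(A) = 0`,
hence `P * q(A) = q(A)`; on the other side `P * A = 0` gives `P * q(A) = q(0) • P`. -/
theorem smul_kernelProj_eq {A P : Matrix (Fin N) (Fin N) ℝ} (hA : Aᵀ = A) {r : ℕ}
    (hP : P ∈ grassmannian N r) (hAP : A * P = 0) (hr : A.charpoly.coeff r ≠ 0) :
    A.charpoly.coeff r • P = ∑ i ∈ Finset.range (N + 1), A.charpoly.coeff (i + r) • A ^ i := by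
  obtain ⟨q, hq, h⟩ := exists_charpoly_factorization hA
  have hle : LinearMap.range P.mulVecLin ≤ LinearMap.ker A.mulVecLin := by
    rintro _ ⟨w, rfl⟩
    rw [LinearMap.mem_ker, mulVecLin_apply, mulVecLin_apply, mulVec_mulVec, hAP, zero_mulVec]
  have hrank := finrank_range_of_mem_grassmannian hP
  have hr1 : r ≤ Module.finrank ℝ (LinearMap.ker A.mulVecLin) :=
    hrank ▸ Submodule.finrank_mono hle
  have hr2 : Module.finrank ℝ (LinearMap.ker A.mulVecLin) ≤ r := by
    by_contra! hlt
    exact hr ((charpoly_coeff_eq_zero_iff hA (r + 1)).mpr hlt r (Nat.lt_succ_self r))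
  have hr3 := le_antisymm hr2 hr1
  have hker : LinearMap.range P.mulVecLin = LinearMap.ker A.mulVecLin :=
    Submodule.eq_of_le_of_finrank_eq hle (by rw [hrank, hr3])
  rw [hr3] at h
  have hcoeff : ∀ i, A.charpoly.coeff (i + r) = q.coeff i := by
    intro i
    rw [h, Polynomial.coeff_X_pow_mul]
  have hdeg : q.natDegree < N + 1 := by
    have h1 : A.charpoly.natDegree = N := by simp
    have hq0 : q ≠ 0 := by rintro rfl; simp at hq
    rw [h, Polynomial.natDegree_mul (by simp) hq0, Polynomial.natDegree_X_pow] at h1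
    lia
  have hsum : ∑ i ∈ Finset.range (N + 1), A.charpoly.coeff (i + r) • A ^ i =
      Polynomial.aeval A q := by
    rw [Polynomial.aeval_eq_sum_range' hdeg]
    simp only [hcoeff]
  have hCH : A * Polynomial.aeval A q = 0 := by
    apply mul_eq_zero_of_pow_mul_eq_zero hA r
    have := aeval_self_charpoly A
    rwa [h, map_mul, map_pow, Polynomial.aeval_X] at this
  have h1 : P * Polynomial.aeval A q = Polynomial.aeval A q := by
    ext i j
    have hmem : (fun i => Polynomial.aeval A q i j) ∈ LinearMap.range P.mulVecLin := by
      rw [hker, LinearMap.mem_ker]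
      ext k
      exact congrFun (congrFun hCH k) j
    exact congrFun ((mem_range_iff_of_mem_grassmannian hP).mp hmem) i
  have hPA : P * A = 0 := by
    have := congrArg transpose hAP
    rwa [transpose_mul, hP.1, hA, transpose_zero] at this
  have h2 : P * Polynomial.aeval A q = q.coeff 0 • P := by
    conv_lhs => rw [← Polynomial.X_mul_divX_add q]
    rw [map_add, map_mul, Polynomial.aeval_X, Polynomial.aeval_C, mul_add, ← mul_assoc, hPA,
      zero_mul, zero_add, Algebra.algebraMap_eq_smul_one, mul_smul_comm, mul_one]
  rw [hsum, ← h1, h2, ← hcoeff, zero_add]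

end KernelProjection

end RealQAlg

end

noncomputable section

namespace RealQAlg
open Matrix

/-! ### Flags of nested projections and adapted frames -/

section FlagTuples

/-- Nested dimensions `md 1 ≤ ⋯ ≤ md c = m` and `dd 1 ≤ ⋯ ≤ dd c = N`. -/
structure IsFlagType (N m c : ℕ) (md dd : ℕ → ℕ) : Prop where
  one_le : 1 ≤ c
  md_mono : Monotone md
  dd_mono : Monotone dd
  md_last : md c = m
  dd_last : dd c = N

/-- Nested subspaces, as orthogonal projections `Y 1, …, Y c`, with the image of `Y k` of dimension
`md k` and contained in `ℝ^(dd k)`. -/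
def IsFlagTuple {N : ℕ} (c : ℕ) (md dd : ℕ → ℕ) (Y : ℕ → Matrix (Fin N) (Fin N) ℝ) : Prop :=
  (∀ k ∈ Finset.Icc 1 c, Y k ∈ grassmannian N (md k)) ∧
    (∀ k ∈ Finset.Icc 1 c, Y k * flagProj N (dd k) = Y k) ∧
    ∀ k ∈ Finset.Ico 1 c, Y (k + 1) * Y k = Y k

/-- The first `md k` columns of `M` lie in `ℝ^(dd k)`. -/
def Adapted {N m : ℕ} (c : ℕ) (md dd : ℕ → ℕ) (M : Matrix (Fin N) (Fin m) ℝ) : Prop :=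
  ∀ k ∈ Finset.Icc 1 c, ∀ i j, j.val < md k → dd k ≤ i.val → M i j = 0

open Classical in
/-- The first `k ≥ 1` with `j < md k`. -/
def level (md : ℕ → ℕ) (j : ℕ) : ℕ :=
  if h : ∃ k, 1 ≤ k ∧ j < md k then Nat.find h else 0

theorem level_le {md : ℕ → ℕ} {j k : ℕ} (hk : 1 ≤ k) (h : j < md k) : level md j ≤ k := by
  rw [level, dif_pos ⟨k, hk, h⟩]
  exact Nat.find_min' _ ⟨hk, h⟩

theorem level_spec {md : ℕ → ℕ} {j k : ℕ} (hk : 1 ≤ k) (h : j < md k) :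
    1 ≤ level md j ∧ j < md (level md j) := by
  rw [level, dif_pos ⟨k, hk, h⟩]
  exact Nat.find_spec (p := fun k => 1 ≤ k ∧ j < md k) ⟨k, hk, h⟩

theorem md_le_of_lt_level {md : ℕ → ℕ} {j k : ℕ} (hk : 1 ≤ k) (h : k < level md j) :
    md k ≤ j := by
  by_contra! hlt
  exact absurd (level_le hk hlt) (not_le.mpr h)

variable {N m c : ℕ} {md dd : ℕ → ℕ}

theorem IsFlagType.level_mem (hF : IsFlagType N m c md dd) (j : Fin m) :
    level md j ∈ Finset.Icc 1 c := by
  have hj : j.val < md c := hF.md_last.symm ▸ j.2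
  exact Finset.mem_Icc.mpr ⟨(level_spec hF.one_le hj).1, level_le hF.one_le hj⟩

theorem IsFlagType.lt_md_level (hF : IsFlagType N m c md dd) (j : Fin m) :
    j.val < md (level md j) :=
  (level_spec hF.one_le (hF.md_last.symm ▸ j.2 : j.val < md c)).2

theorem IsFlagType.md_le (hF : IsFlagType N m c md dd) {k : ℕ} (hk : k ∈ Finset.Icc 1 c) :
    md k ≤ m :=
  hF.md_last ▸ hF.md_mono (Finset.mem_Icc.mp hk).2

theorem IsFlagType.dd_le (hF : IsFlagType N m c md dd) {k : ℕ} (hk : k ∈ Finset.Icc 1 c) :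
    dd k ≤ N :=
  hF.dd_last ▸ hF.dd_mono (Finset.mem_Icc.mp hk).2

theorem IsFlagType.last_mem (hF : IsFlagType N m c md dd) : c ∈ Finset.Icc 1 c :=
  Finset.mem_Icc.mpr ⟨hF.one_le, le_rfl⟩

theorem IsFlagTuple.mul_eq {Y : ℕ → Matrix (Fin N) (Fin N) ℝ} (hY : IsFlagTuple c md dd Y)
    {k l : ℕ} (hk : 1 ≤ k) (hkl : k ≤ l) (hl : l ≤ c) : Y l * Y k = Y k := by
  induction l, hkl using Nat.le_induction with
  | base => exact (hY.1 k (Finset.mem_Icc.mpr ⟨hk, hl⟩)).2.1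
  | succ l hkl ih =>
    rw [← ih (by lia), ← Matrix.mul_assoc, hY.2.2 l (Finset.mem_Ico.mpr ⟨by lia, by lia⟩)]

theorem IsFlagTuple.apply_eq_zero {Y : ℕ → Matrix (Fin N) (Fin N) ℝ}
    (hY : IsFlagTuple c md dd Y) {k : ℕ} (hk : k ∈ Finset.Icc 1 c) {i : Fin N}
    (hi : dd k ≤ i.val) (j : Fin N) : Y k i j = 0 := by
  have h := congrFun (congrFun (congrArg transpose (hY.2.1 k hk)) i) j
  rw [transpose_mul, (hY.1 k hk).1, flagProj_transpose, flagProj, diagonal_mul,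
    if_neg (not_lt.mpr hi), zero_mul] at h
  exact h.symm

theorem isFlagTuple_spanProj (hF : IsFlagType N m c md dd) {M : Matrix (Fin N) (Fin m) ℝ}
    (hM : Adapted c md dd M) (hdet : (Mᵀ * M).det ≠ 0) :
    IsFlagTuple c md dd (fun k => spanProj (md k) M) :=
  ⟨fun _ hk => spanProj_mem_grassmannian (hF.md_le hk) hdet,
    fun k hk => spanProj_mul_flagProj (hM k hk) hdet (hF.md_le hk),
    fun k _ => spanProj_mul_spanProj (hF.md_mono k.le_succ) hdet⟩

theorem mul_mul_flagProj_eq {A : Matrix (Fin N) (Fin N) ℝ} {M : Matrix (Fin N) (Fin m) ℝ} {r : ℕ}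
    (h : ∀ j : Fin m, j.val < r → A *ᵥ (fun i => M i j) = fun i => M i j) :
    A * (M * flagProj m r) = M * flagProj m r := by
  rw [← Matrix.mul_assoc]
  ext i j
  rw [mul_flagProj_apply, mul_flagProj_apply]
  split_ifs with hj
  · exact congrFun (h j hj) i
  · rfl

/-- The `j`-th column is chosen in the image of `Y (level md j)`, of dimension greater than `j`. The
first `md k` columns then lie in the image of `Y k` and span it by dimension. -/
theorem IsFlagTuple.exists_frame (hF : IsFlagType N m c md dd)
    {Y : ℕ → Matrix (Fin N) (Fin N) ℝ} (hY : IsFlagTuple c md dd Y) :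
    ∃ M : Matrix (Fin N) (Fin m) ℝ, Mᵀ * M = 1 ∧ Adapted c md dd M ∧
      ∀ k ∈ Finset.Icc 1 c, Y k = spanProj (md k) M := by
  obtain ⟨M, hM, hV⟩ := exists_orthonormal_frame
    (fun j : Fin m => LinearMap.range (Y (level md j)).mulVecLin) (fun j => by
      rw [finrank_range_of_mem_grassmannian (hY.1 _ (hF.level_mem j))]
      exact hF.lt_md_level j)
  have hV' : ∀ j : Fin m, Y (level md j) *ᵥ (fun i => M i j) = fun i => M i j := fun j =>
    (mem_range_iff_of_mem_grassmannian (hY.1 _ (hF.level_mem j))).mp (hV j)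
  refine ⟨M, hM, fun k hk i j hj hi => ?_, fun k hk => ?_⟩
  · rw [← congrFun (hV' j) i, mulVec, dotProduct]
    refine Finset.sum_eq_zero fun l _ => ?_
    rw [hY.apply_eq_zero (hF.level_mem j)
      ((hF.dd_mono (level_le (Finset.mem_Icc.mp hk).1 hj)).trans hi), zero_mul]
  · refine eq_spanProj (hF.md_le hk) (by rw [hM, det_one]; exact one_ne_zero) (hY.1 k hk) ?_
    refine mul_mul_flagProj_eq fun j hj => ?_
    rw [← hV' j, mulVec_mulVec, hY.mul_eq (Finset.mem_Icc.mp (hF.level_mem j)).1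
      (level_le (Finset.mem_Icc.mp hk).1 hj) (Finset.mem_Icc.mp hk).2]

end FlagTuples

/-! ### Linear slices of frames -/

section Slices

variable {N m : ℕ}

/-- The compression of `Y` to the image of the projection `P`, completed by an identity block. -/
def compression (P Y : Matrix (Fin N) (Fin N) ℝ) : Matrix (Fin N) (Fin N) ℝ :=
  P * Y * P + (1 - P)

theorem compression_self {P : Matrix (Fin N) (Fin N) ℝ} {r : ℕ} (hP : P ∈ grassmannian N r) :
    compression P P = 1 := by
  rw [compression, hP.2.1, hP.2.1, add_sub_cancel]

theorem compression_mul {P Y : Matrix (Fin N) (Fin N) ℝ} {r : ℕ} (hP : P ∈ grassmannian N r) :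
    compression P Y * P = P * Y * P := by
  rw [compression, add_mul, sub_mul, one_mul, hP.2.1, sub_self, add_zero, mul_assoc, hP.2.1]

theorem mul_compression {P Y : Matrix (Fin N) (Fin N) ℝ} {r : ℕ} (hP : P ∈ grassmannian N r) :
    P * compression P Y = P * Y * P := by
  rw [compression, mul_add, mul_sub, mul_one, hP.2.1, sub_self, add_zero, ← mul_assoc, ← mul_assoc,
    hP.2.1]

theorem compression_inv_mul {P Y : Matrix (Fin N) (Fin N) ℝ} {r : ℕ} (hP : P ∈ grassmannian N r)
    (h : (compression P Y).det ≠ 0) : (compression P Y)⁻¹ * P = P * (compression P Y)⁻¹ := by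
  have hu := isUnit_iff_ne_zero.mpr h
  have h1 : P * compression P Y = compression P Y * P := by
    rw [mul_compression hP, compression_mul hP]
  calc (compression P Y)⁻¹ * P
      = (compression P Y)⁻¹ * (P * compression P Y) * (compression P Y)⁻¹ := by
        rw [mul_assoc, mul_assoc, mul_nonsing_inv _ hu, mul_one]
    _ = P * (compression P Y)⁻¹ := by
        rw [h1, ← mul_assoc, nonsing_inv_mul _ hu, one_mul]

/-- The right side is an orthogonal projection of trace `r` whose image lies in that of `Y`. Read on
a vector `w` fixed by `Y`, it recovers `w` from its projection `P w`, that is, it inverts `P` on the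
image of `Y`. -/
theorem eq_mul_compression_inv {P Y : Matrix (Fin N) (Fin N) ℝ} {r : ℕ}
    (hP : P ∈ grassmannian N r) (hY : Y ∈ grassmannian N r)
    (h : (compression P Y).det ≠ 0) : Y = Y * (compression P Y)⁻¹ * P * Y := by
  have hu := isUnit_iff_ne_zero.mpr h
  have hK : (compression P Y)ᵀ = compression P Y := by
    rw [compression, transpose_add, transpose_sub, transpose_one, transpose_mul, transpose_mul,
      hP.1, hY.1, mul_assoc]
  have hQ : Y * (compression P Y)⁻¹ * P * Y ∈ grassmannian N r := by
    refine ⟨?_, ?_, ?_⟩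
    · rw [transpose_mul, transpose_mul, transpose_mul, transpose_nonsing_inv, hK, hP.1, hY.1,
        mul_assoc Y, compression_inv_mul hP h]
      simp only [mul_assoc]
    · calc Y * (compression P Y)⁻¹ * P * Y * (Y * (compression P Y)⁻¹ * P * Y)
          = Y * (compression P Y)⁻¹ * P * (Y * Y) * ((compression P Y)⁻¹ * P) * Y := by
            simp only [mul_assoc]
        _ = Y * (compression P Y)⁻¹ * (P * Y * P) * (compression P Y)⁻¹ * Y := by
            rw [hY.2.1, compression_inv_mul hP h]; simp only [mul_assoc]
        _ = Y * (((compression P Y)⁻¹ * compression P Y) * (P * (compression P Y)⁻¹)) * Y := by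
            rw [← compression_mul hP]; simp only [mul_assoc]
        _ = Y * (compression P Y)⁻¹ * P * Y := by
            rw [nonsing_inv_mul _ hu, one_mul, ← compression_inv_mul hP h]; simp only [mul_assoc]
    · calc (Y * (compression P Y)⁻¹ * P * Y).trace
          = (Y * ((compression P Y)⁻¹ * P * Y)).trace := by simp only [mul_assoc]
        _ = ((compression P Y)⁻¹ * P * (Y * Y)).trace := by
            rw [trace_mul_comm]; simp only [mul_assoc]
        _ = ((compression P Y)⁻¹ * (P * P) * Y).trace := by rw [hY.2.1, hP.2.1]
        _ = ((compression P Y)⁻¹ * P * (P * Y)).trace := by simp only [mul_assoc]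
        _ = (P * ((compression P Y)⁻¹ * (P * Y))).trace := by
            rw [compression_inv_mul hP h]; simp only [mul_assoc]
        _ = ((compression P Y)⁻¹ * (P * Y * P)).trace := by
            rw [trace_mul_comm]; simp only [mul_assoc]
        _ = r := by
            rw [← compression_mul hP, ← mul_assoc, nonsing_inv_mul _ hu, one_mul, hP.2.2]
  refine eq_of_mul_eq_of_trace_eq hY hQ ?_ rfl
  simp only [← mul_assoc]
  rw [hY.2.1]

theorem det_transpose_mul_self_ne_zero_of_det {A M : Matrix (Fin N) (Fin m) ℝ}
    (h : (Aᵀ * M).det ≠ 0) : (Mᵀ * M).det ≠ 0 := by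
  intro h0
  obtain ⟨v, hv, hv0⟩ := exists_mulVec_eq_zero_iff.mpr h0
  refine hv (mulVec_eq_zero_of_det_ne_zero h ?_)
  rw [← mulVec_mulVec, mulVec_eq_zero_of_transpose_mul_self hv0, mulVec_zero]

/-- The matrices `T` adapted to the flag whose columns of level `k` are orthogonal to the first
`md k` columns of `M₀`. -/
def slice (c : ℕ) (md dd : ℕ → ℕ) (M₀ : Matrix (Fin N) (Fin m) ℝ) :
    Submodule ℝ (Matrix (Fin N) (Fin m) ℝ) where
  carrier := {T | Adapted c md dd T ∧
    ∀ i j : Fin m, i.val < md (level md j) → (M₀ᵀ * T) i j = 0}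
  zero_mem' := ⟨fun _ _ _ _ _ _ => rfl, fun i j _ => by simp⟩
  add_mem' {S T} hS hT := by
    refine ⟨fun k hk i j hj hi => ?_, fun i j h => ?_⟩
    · rw [Matrix.add_apply, hS.1 k hk i j hj hi, hT.1 k hk i j hj hi, add_zero]
    · rw [Matrix.mul_add, Matrix.add_apply, hS.2 i j h, hT.2 i j h, add_zero]
  smul_mem' a T hT := by
    refine ⟨fun k hk i j hj hi => ?_, fun i j h => ?_⟩
    · rw [Matrix.smul_apply, hT.1 k hk i j hj hi, smul_zero]
    · rw [Matrix.mul_smul, Matrix.smul_apply, hT.2 i j h, smul_zero]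

variable {c : ℕ} {md dd : ℕ → ℕ} {M₀ : Matrix (Fin N) (Fin m) ℝ}

theorem spanProj_of_orthonormal (hM₀ : M₀ᵀ * M₀ = 1) (r : ℕ) :
    spanProj r M₀ = M₀ * flagProj m r * M₀ᵀ := by
  have : gramBlock r M₀ = 1 := by
    rw [gramBlock, hM₀, Matrix.mul_one, flagProj_mul_self, add_sub_cancel]
  rw [spanProj, this, inv_one, Matrix.mul_one, ← Matrix.mul_assoc, Matrix.mul_assoc M₀,
    flagProj_mul_self]

/-- The matrix `M₀ᵀ (M₀ + T)` is lower unitriangular, because `i ≤ j` implies `i < md (level md j)`.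
No open condition on `T` is needed: the chart is defined on the entire slice. -/
theorem det_ne_zero_of_mem_slice (hF : IsFlagType N m c md dd) (hM₀ : M₀ᵀ * M₀ = 1)
    {T : Matrix (Fin N) (Fin m) ℝ} (hT : T ∈ slice c md dd M₀) :
    ((M₀ + T)ᵀ * (M₀ + T)).det ≠ 0 := by
  apply det_transpose_mul_self_ne_zero_of_det (A := M₀)
  have hzero : ∀ i j : Fin m, i ≤ j → (M₀ᵀ * T) i j = 0 := fun i j hij =>
    hT.2 i j (lt_of_le_of_lt hij (hF.lt_md_level j))
  rw [Matrix.mul_add, hM₀, det_of_isLowerTriangular]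
  · rw [Finset.prod_eq_one]
    · exact one_ne_zero
    · intro i _
      rw [Matrix.add_apply, one_apply_eq, hzero i i le_rfl, add_zero]
  · intro i j hij
    have hij' : i < j := hij
    rw [Matrix.add_apply, one_apply_ne hij'.ne, hzero i j hij'.le, add_zero]

theorem spanProj_mulVec_col {M : Matrix (Fin N) (Fin m) ℝ} (hM : (Mᵀ * M).det ≠ 0) {r : ℕ}
    {j : Fin m} (hj : j.val < r) : spanProj r M *ᵥ (fun i => M i j) = fun i => M i j := by
  ext i
  have := congrFun (congrFun (spanProj_mul (r := r) hM) i) j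
  rw [← Matrix.mul_assoc, mul_flagProj_apply, mul_flagProj_apply, if_pos hj, if_pos hj] at this
  exact this

theorem mulVec_flagProj_col {A : Matrix (Fin N) (Fin m) ℝ} {r : ℕ} {v : Fin m → ℝ}
    (hv : ∀ i : Fin m, i.val < r → v i = 0) : (A * flagProj m r) *ᵥ v = 0 := by
  have : flagProj m r *ᵥ v = 0 := by
    ext i
    rw [flagProj, mulVec_diagonal]
    split_ifs with h
    · rw [hv i h]; simp
    · simp
  rw [← mulVec_mulVec, this, mulVec_zero]

/-- The slice coordinates are recovered from the flag tuple. -/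
theorem mulVec_compression_inv_of_mem_slice (hF : IsFlagType N m c md dd) (hM₀ : M₀ᵀ * M₀ = 1)
    {T : Matrix (Fin N) (Fin m) ℝ} (hT : T ∈ slice c md dd M₀) (j : Fin m)
    (hdet : (compression (spanProj (md (level md j)) M₀)
      (spanProj (md (level md j)) (M₀ + T))).det ≠ 0) :
    (spanProj (md (level md j)) (M₀ + T) * (compression (spanProj (md (level md j)) M₀)
      (spanProj (md (level md j)) (M₀ + T)))⁻¹) *ᵥ (fun i => M₀ i j) =
      fun i => (M₀ + T) i j := by
  have hj := hF.lt_md_level j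
  have hk := hF.md_le (hF.level_mem j)
  have hd := det_ne_zero_of_mem_slice hF hM₀ hT
  have hd0 : (M₀ᵀ * M₀).det ≠ 0 := by rw [hM₀, det_one]; exact one_ne_zero
  have hP := spanProj_mem_grassmannian hk hd0
  have hY := spanProj_mem_grassmannian hk hd
  have hcol : (fun i => (M₀ + T) i j) = (fun i => M₀ i j) + fun i => T i j := rfl
  -- The `j`-th column of `T` is orthogonal to the span onto which this matrix projects.
  have h1 : spanProj (md (level md j)) M₀ *ᵥ (fun i => (M₀ + T) i j) = fun i => M₀ i j := by
    rw [hcol, mulVec_add, spanProj_mulVec_col hd0 hj, spanProj_of_orthonormal hM₀, ← mulVec_mulVec,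
      mulVec_flagProj_col, add_zero]
    exact fun i hi => hT.2 i j hi
  have h2 := congrArg (fun A => A *ᵥ (fun i => (M₀ + T) i j)) (eq_mul_compression_inv hP hY hdet)
  beta_reduce at h2
  rw [spanProj_mulVec_col hd hj, ← mulVec_mulVec, spanProj_mulVec_col hd hj, ← mulVec_mulVec,
    h1] at h2
  exact h2.symm

/-- The frame in the slice through `M₀` of a flag tuple `Y` close to that of `M₀`. -/
def sliceFrame (md : ℕ → ℕ) (M₀ : Matrix (Fin N) (Fin m) ℝ) (Y : ℕ → Matrix (Fin N) (Fin N) ℝ) :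
    Matrix (Fin N) (Fin m) ℝ :=
  of fun i j => ((Y (level md j) * (compression (spanProj (md (level md j)) M₀)
    (Y (level md j)))⁻¹) *ᵥ (fun i => M₀ i j)) i

/-- For a column `u` of `M₀` of level `k`, with `P = spanProj (md k) M₀` and `K` the compression of
`Y k`, the vector `Y k K⁻¹ u` lies in the image of `Y k`, and `P` sends it to `P (Y k) P K⁻¹ u = u`.
Its difference from `u` is therefore orthogonal to the image of `P`, which is the slice condition.
-/
theorem sliceFrame_spec (hF : IsFlagType N m c md dd) (hM₀ : M₀ᵀ * M₀ = 1)
    (hA : Adapted c md dd M₀) {Y : ℕ → Matrix (Fin N) (Fin N) ℝ} (hY : IsFlagTuple c md dd Y)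
    (hdet : ∀ k ∈ Finset.Icc 1 c, (compression (spanProj (md k) M₀) (Y k)).det ≠ 0) :
    sliceFrame md M₀ Y - M₀ ∈ slice c md dd M₀ ∧
      ∀ k ∈ Finset.Icc 1 c, Y k = spanProj (md k) (sliceFrame md M₀ Y) := by
  have hd0 : (M₀ᵀ * M₀).det ≠ 0 := by rw [hM₀, det_one]; exact one_ne_zero
  have hcol : ∀ j, (fun i => sliceFrame md M₀ Y i j) =
      (Y (level md j) * (compression (spanProj (md (level md j)) M₀)
        (Y (level md j)))⁻¹) *ᵥ (fun i => M₀ i j) := fun j => rfl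
  have hmem : sliceFrame md M₀ Y - M₀ ∈ slice c md dd M₀ := by
    refine ⟨fun k hk i j hj hi => ?_, fun i j hij => ?_⟩
    · rw [Matrix.sub_apply, hA k hk i j hj hi, sub_zero, congrFun (hcol j) i,
        ← mulVec_mulVec, mulVec, dotProduct]
      refine Finset.sum_eq_zero fun l _ => ?_
      rw [hY.apply_eq_zero (hF.level_mem j)
        ((hF.dd_mono (level_le (Finset.mem_Icc.mp hk).1 hj)).trans hi), zero_mul]
    · have hP := spanProj_mem_grassmannian (hF.md_le (hF.level_mem j)) hd0
      have hu := isUnit_iff_ne_zero.mpr (hdet _ (hF.level_mem j))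
      have h1 : spanProj (md (level md j)) M₀ *ᵥ (fun i => sliceFrame md M₀ Y i j) =
          fun i => M₀ i j := by
        rw [hcol, mulVec_mulVec]
        nth_rw 1 [← spanProj_mulVec_col hd0 (hF.lt_md_level j)]
        rw [mulVec_mulVec, mul_assoc, mul_assoc, compression_inv_mul hP (hdet _ (hF.level_mem j)),
          ← mul_assoc, ← mul_assoc, ← compression_mul hP, mul_assoc, ← compression_inv_mul hP
          (hdet _ (hF.level_mem j)), ← mul_assoc, mul_nonsing_inv _ hu, one_mul,
          spanProj_mulVec_col hd0 (hF.lt_md_level j)]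
      have h2 : spanProj (md (level md j)) M₀ *ᵥ (fun i => (sliceFrame md M₀ Y - M₀) i j) = 0 := by
        rw [show (fun i => (sliceFrame md M₀ Y - M₀) i j) = (fun i => sliceFrame md M₀ Y i j) -
          fun i => M₀ i j from rfl, mulVec_sub, h1, spanProj_mulVec_col hd0 (hF.lt_md_level j),
          sub_self]
      have h3 : M₀ᵀ *ᵥ (spanProj (md (level md j)) M₀ *ᵥ
          (fun i => (sliceFrame md M₀ Y - M₀) i j)) = 0 := by rw [h2, mulVec_zero]
      rw [spanProj_of_orthonormal hM₀, mulVec_mulVec, ← Matrix.mul_assoc, ← Matrix.mul_assoc, hM₀,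
        Matrix.one_mul, ← mulVec_mulVec, flagProj] at h3
      have h4 := congrFun h3 i
      rw [mulVec_diagonal, if_pos hij, one_mul] at h4
      exact h4
  refine ⟨hmem, fun k hk => ?_⟩
  have hd := det_ne_zero_of_mem_slice hF hM₀ hmem
  rw [add_sub_cancel] at hd
  refine eq_spanProj (hF.md_le hk) hd (hY.1 k hk) (mul_mul_flagProj_eq fun j hj => ?_)
  rw [hcol, mulVec_mulVec, ← mul_assoc, hY.mul_eq (Finset.mem_Icc.mp (hF.level_mem j)).1
      (level_le (Finset.mem_Icc.mp hk).1 hj) (Finset.mem_Icc.mp hk).2]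

end Slices

end RealQAlg

end

noncomputable section

namespace RealQAlg
open MvPolynomial

/-! ### Rationality of the matrix constructions -/

section RationalMatrices

variable {τ : Type*} {K : Type} [Field K] [Algebra K ℝ] {S : Set (τ → ℝ)} {N m : ℕ}

theorem RatOn.exists_poly {f : (τ → ℝ) → ℝ} (hf : RatOn K Set.univ f) :
    ∃ p : MvPolynomial τ K, ∀ x, aeval x p = 0 ↔ f x = 0 := by
  obtain ⟨p, q, hpq⟩ := hf
  refine ⟨p, fun x => ?_⟩
  rw [(hpq x trivial).2, div_eq_zero_iff, or_iff_left (hpq x trivial).1]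

theorem isAlgebraicOver_of_ratOn {α : Type*} {V : Set (τ → ℝ)} {f : α → (τ → ℝ) → ℝ}
    (hf : ∀ a, RatOn K Set.univ (f a)) (hV : ∀ x, x ∈ V ↔ ∀ a, f a x = 0) :
    IsAlgebraicOver K V := by
  choose p hp using fun a => (hf a).exists_poly
  refine ⟨Set.range p, ?_⟩
  ext x
  simp [hV, hp]

theorem matRatOn_flagProj (N r : ℕ) : MatRatOn K S (fun _ => flagProj N r) :=
  MatRatOn.diagonal _

theorem MatRatOn.gramBlock {F : (τ → ℝ) → Matrix (Fin N) (Fin m) ℝ} (hF : MatRatOn K S F)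
    (r : ℕ) : MatRatOn K S (fun x => gramBlock r (F x)) :=
  (((matRatOn_flagProj m r).mul (hF.transpose.mul hF)).mul (matRatOn_flagProj m r)).add
    (MatRatOn.one.sub (matRatOn_flagProj m r))

theorem MatRatOn.spanProj {F : (τ → ℝ) → Matrix (Fin N) (Fin m) ℝ} (hF : MatRatOn K S F)
    (r : ℕ) (h : ∀ x ∈ S, ((F x).transpose * F x).det ≠ 0) :
    MatRatOn K S (fun x => spanProj r (F x)) :=
  ((hF.mul (matRatOn_flagProj m r)).mul
    ((hF.gramBlock r).inv fun x hx => det_gramBlock_ne_zero r (h x hx))).mul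
    ((matRatOn_flagProj m r).mul hF.transpose)

theorem MatRatOn.compression {F : (τ → ℝ) → Matrix (Fin N) (Fin N) ℝ} (hF : MatRatOn ℝ S F)
    (P : Matrix (Fin N) (Fin N) ℝ) : MatRatOn ℝ S (fun x => compression P (F x)) :=
  (((MatRatOn.const P).mul hF).mul (MatRatOn.const P)).add (MatRatOn.one.sub (MatRatOn.const P))

theorem MatRatOn.linear {F : (τ → ℝ) → Matrix (Fin N) (Fin m) ℝ} (hF : MatRatOn ℝ S F)
    (l : Matrix (Fin N) (Fin m) ℝ →ₗ[ℝ] ℝ) : RatOn ℝ S (fun x => l (F x)) := by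
  have : ∀ A : Matrix (Fin N) (Fin m) ℝ,
      l A = ∑ i, ∑ j, A i j * l (Matrix.single i j 1) := by
    intro A
    conv_lhs => rw [Matrix.matrix_eq_sum_single A]
    simp only [map_sum]
    refine Finset.sum_congr rfl fun i _ => Finset.sum_congr rfl fun j _ => ?_
    rw [← smul_eq_mul, ← map_smul, Matrix.smul_single, smul_eq_mul, mul_one]
  refine RatOn.congr ?_ fun x _ => this (F x)
  exact RatOn.sum _ fun i _ => RatOn.sum _ fun j _ => (hF i j).mul (RatOn.const (K := ℝ) _)

end RationalMatrices

/-! ### The flag variety: irreducibility and nonsingularity -/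

section FlagVariety

variable {N m c : ℕ} {md dd : ℕ → ℕ}

/-- The matrices `Y 1, …, Y c` among the coordinates, where `Y c` is the first factor. -/
def blk (z : (Fin N × Fin N) ⊕ (Fin (c - 1) × (Fin N × Fin N)) → ℝ) (k : ℕ) :
    Matrix (Fin N) (Fin N) ℝ :=
  if h : k - 1 < c - 1 then matY z ⟨k - 1, h⟩ else toMat (projFst z)

/-- The point with coordinates `Y 1, …, Y c`. -/
def ofTuple (c : ℕ) (Y : ℕ → Matrix (Fin N) (Fin N) ℝ) :
    (Fin N × Fin N) ⊕ (Fin (c - 1) × (Fin N × Fin N)) → ℝ :=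
  Sum.elim (fun p => Y c p.1 p.2) fun q => Y (q.1 + 1) q.2.1 q.2.2

theorem blk_ofTuple {Y : ℕ → Matrix (Fin N) (Fin N) ℝ} {k : ℕ} (hk : k ∈ Finset.Icc 1 c) :
    blk (ofTuple c Y) k = Y k := by
  rw [Finset.mem_Icc] at hk
  rw [blk]
  split_ifs with h
  · ext i j
    change Y (k - 1 + 1) i j = Y k i j
    rw [Nat.sub_add_cancel hk.1]
  · have : k = c := by lia
    subst this
    rfl

theorem blk_last (z : (Fin N × Fin N) ⊕ (Fin (c - 1) × (Fin N × Fin N)) → ℝ) :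
    blk z c = toMat (projFst z) := by
  rw [blk, dif_neg (lt_irrefl _)]

theorem ofTuple_blk (z : (Fin N × Fin N) ⊕ (Fin (c - 1) × (Fin N × Fin N)) → ℝ) :
    ofTuple c (blk z) = z := by
  ext x
  rcases x with p | ⟨i, p⟩
  · change blk z c p.1 p.2 = _
    rw [blk_last]; rfl
  · change blk z (i + 1) p.1 p.2 = _
    rw [blk, dif_pos (by simp)]; rfl

theorem ofTuple_congr (hc : 1 ≤ c) {Y Y' : ℕ → Matrix (Fin N) (Fin N) ℝ}
    (h : ∀ k ∈ Finset.Icc 1 c, Y k = Y' k) : ofTuple c Y = ofTuple c Y' := by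
  ext x
  rcases x with p | ⟨i, p⟩
  · change Y c p.1 p.2 = Y' c p.1 p.2
    rw [h c (Finset.mem_Icc.mpr ⟨hc, le_rfl⟩)]
  · change Y (i + 1) p.1 p.2 = Y' (i + 1) p.1 p.2
    rw [h _ (Finset.mem_Icc.mpr ⟨by lia, by lia⟩)]

theorem matRatOn_blk {K : Type} [Field K] [Algebra K ℝ]
    {S : Set ((Fin N × Fin N) ⊕ (Fin (c - 1) × (Fin N × Fin N)) → ℝ)} (k : ℕ) :
    MatRatOn K S (fun z => blk z k) := by
  by_cases h : k - 1 < c - 1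
  · simp only [blk, dif_pos h]
    exact fun i j => RatOn.coord _
  · simp only [blk, dif_neg h]
    exact fun i j => RatOn.coord _

theorem ratOn_ofTuple {τ : Type*} {K : Type} [Field K] [Algebra K ℝ] {S : Set (τ → ℝ)}
    {Y : (τ → ℝ) → ℕ → Matrix (Fin N) (Fin N) ℝ} (hc : 1 ≤ c)
    (hY : ∀ k ∈ Finset.Icc 1 c, MatRatOn K S (fun t => Y t k)) :
    ∀ x, RatOn K S (fun t => ofTuple c (Y t) x) := by
  intro x
  rcases x with p | ⟨i, p⟩
  · exact hY c (Finset.mem_Icc.mpr ⟨hc, le_rfl⟩) p.1 p.2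
  · exact hY (i + 1) (Finset.mem_Icc.mpr ⟨by lia, by lia⟩) p.1 p.2

/-- The variety of nested subspaces of dimensions `md k` contained in `ℝ^(dd k)`. -/
def flagVariety (N c : ℕ) (md dd : ℕ → ℕ) :
    Set ((Fin N × Fin N) ⊕ (Fin (c - 1) × (Fin N × Fin N)) → ℝ) :=
  {z | IsFlagTuple c md dd (blk z)}

theorem IsFlagTuple.congr {Y Y' : ℕ → Matrix (Fin N) (Fin N) ℝ} (hY : IsFlagTuple c md dd Y)
    (h : ∀ k ∈ Finset.Icc 1 c, Y' k = Y k) : IsFlagTuple c md dd Y' := by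
  refine ⟨fun k hk => ?_, fun k hk => ?_, fun k hk => ?_⟩
  · rw [h k hk]; exact hY.1 k hk
  · rw [h k hk]; exact hY.2.1 k hk
  · have hk' := Finset.mem_Ico.mp hk
    rw [h k (Finset.mem_Icc.mpr ⟨hk'.1, hk'.2.le⟩),
      h (k + 1) (Finset.mem_Icc.mpr ⟨by lia, by lia⟩)]
    exact hY.2.2 k hk

theorem ofTuple_mem_flagVariety {Y : ℕ → Matrix (Fin N) (Fin N) ℝ}
    (hY : IsFlagTuple c md dd Y) : ofTuple c Y ∈ flagVariety N c md dd :=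
  hY.congr fun _ hk => blk_ofTuple hk

theorem exists_frame_of_mem_flagVariety (hF : IsFlagType N m c md dd)
    {z : (Fin N × Fin N) ⊕ (Fin (c - 1) × (Fin N × Fin N)) → ℝ}
    (hz : z ∈ flagVariety N c md dd) :
    ∃ M : Matrix (Fin N) (Fin m) ℝ, M.transpose * M = 1 ∧ Adapted c md dd M ∧
      z = ofTuple c fun k => spanProj (md k) M := by
  obtain ⟨M, hM, hA, h⟩ := IsFlagTuple.exists_frame hF hz
  exact ⟨M, hM, hA, by rw [← ofTuple_blk z]; exact ofTuple_congr hF.one_le h⟩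

open Classical in
/-- The adapted matrix obtained by erasing entries. -/
def maskMat (c : ℕ) (md dd : ℕ → ℕ) (t : Fin N × Fin m → ℝ) : Matrix (Fin N) (Fin m) ℝ :=
  Matrix.of fun i j => if ∃ k ∈ Finset.Icc 1 c, j.val < md k ∧ dd k ≤ i.val then 0 else t (i, j)

theorem adapted_maskMat (t : Fin N × Fin m → ℝ) : Adapted c md dd (maskMat c md dd t) :=
  fun k hk _ _ hj hi => if_pos ⟨k, hk, hj, hi⟩

theorem maskMat_of_adapted {M : Matrix (Fin N) (Fin m) ℝ} (hM : Adapted c md dd M) :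
    maskMat c md dd (fun p => M p.1 p.2) = M := by
  ext i j
  rw [maskMat, Matrix.of_apply]
  split_ifs with h
  · obtain ⟨k, hk, hj, hi⟩ := h
    exact (hM k hk i j hj hi).symm
  · rfl

theorem matRatOn_maskMat {K : Type} [Field K] [Algebra K ℝ] {S : Set (Fin N × Fin m → ℝ)} :
    MatRatOn K S (maskMat c md dd) := fun i j => by
  simp only [maskMat, Matrix.of_apply]
  split_ifs
  · exact RatOn.zero
  · exact RatOn.coord _

/-- The parametrization of the flag variety by adapted matrices. -/
def flagParam (c : ℕ) (md dd : ℕ → ℕ) (t : Fin N × Fin m → ℝ) :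
    (Fin N × Fin N) ⊕ (Fin (c - 1) × (Fin N × Fin N)) → ℝ :=
  ofTuple c fun k => spanProj (md k) (maskMat c md dd t)

/-- Here `s` has the same zeros as the Gram determinant of the masked matrix. Every flag has an
orthonormal adapted frame, so nothing is missed; nonemptiness rules out `s = 0`. -/
theorem exists_flagParam_image (hF : IsFlagType N m c md dd)
    (hne : (flagVariety N c md dd).Nonempty) :
    ∃ s : MvPolynomial (Fin N × Fin m) ℚ, s ≠ 0 ∧
      flagVariety N c md dd = flagParam c md dd '' {t | aeval t s ≠ 0} ∧
      ∀ x, RatOn ℚ {t | aeval t s ≠ 0}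
        (fun t : Fin N × Fin m → ℝ => flagParam c md dd t x) := by
  obtain ⟨s, hs⟩ := (MatRatOn.det ((matRatOn_maskMat (K := ℚ) (S := Set.univ) (N := N) (m := m)
    (c := c) (md := md) (dd := dd)).transpose.mul matRatOn_maskMat)).exists_poly
  have himage : flagVariety N c md dd = flagParam c md dd '' {t | aeval t s ≠ 0} := by
    ext z
    constructor
    · intro hz
      obtain ⟨M, hM, hA, rfl⟩ := exists_frame_of_mem_flagVariety hF hz
      refine ⟨fun p => M p.1 p.2, ?_, ?_⟩
      · rw [Set.mem_ofPred_eq, Ne, hs, maskMat_of_adapted hA, hM, Matrix.det_one]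
        exact one_ne_zero
      · rw [flagParam, maskMat_of_adapted hA]
    · rintro ⟨t, ht, rfl⟩
      rw [Set.mem_ofPred_eq, Ne, hs] at ht
      exact ofTuple_mem_flagVariety (isFlagTuple_spanProj hF (adapted_maskMat t) ht)
  refine ⟨s, ?_, himage, ?_⟩
  · rintro rfl
    rw [himage] at hne
    obtain ⟨_, t, ht, -⟩ := hne
    exact ht (map_zero _)
  · refine ratOn_ofTuple hF.one_le fun k _ => MatRatOn.spanProj matRatOn_maskMat _ fun t ht => ?_
    rwa [Set.mem_ofPred_eq, Ne, hs] at ht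

theorem isPrime_and_map_of_rat_param {ι τ : Type} {s : MvPolynomial τ ℚ} (hs : s ≠ 0)
    {Φ : (τ → ℝ) → ι → ℝ} (hΦ : ∀ i, RatOn ℚ {t | aeval t s ≠ 0} (fun t => Φ t i)) :
    (vanishingIdeal ℝ (Φ '' {t | aeval t s ≠ 0})).IsPrime ∧
      (vanishingIdeal ℚ (Φ '' {t | aeval t s ≠ 0})).map (map (algebraMap ℚ ℝ)) =
        vanishingIdeal ℝ (Φ '' {t | aeval t s ≠ 0}) := by
  refine ⟨?_, vanishingIdeal_real_eq_map hs hΦ⟩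
  have hset : {t : τ → ℝ | aeval t s ≠ 0} = {t | eval t (map (algebraMap ℚ ℝ) s) ≠ 0} := by
    ext t
    rw [Set.mem_ofPred_eq, Set.mem_ofPred_eq, eval_map, aeval_def]
  rw [hset] at hΦ ⊢
  refine isPrime_vanishingIdeal_image ?_ fun i => (hΦ i).toReal
  exact fun h => hs (map_injective _ (algebraMap ℚ ℝ).injective (by rw [h, map_zero]))

theorem isPrime_flagVariety (hF : IsFlagType N m c md dd)
    (hne : (flagVariety N c md dd).Nonempty) :
    (vanishingIdeal ℝ (flagVariety N c md dd)).IsPrime ∧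
      (vanishingIdeal ℚ (flagVariety N c md dd)).map (map (algebraMap ℚ ℝ)) =
        vanishingIdeal ℝ (flagVariety N c md dd) := by
  obtain ⟨s, hs, himage, hrat⟩ := exists_flagParam_image hF hne
  rw [himage]
  exact isPrime_and_map_of_rat_param hs hrat

theorem isPrime_projFst_flagVariety (hF : IsFlagType N m c md dd)
    (hne : (flagVariety N c md dd).Nonempty) :
    (vanishingIdeal ℝ (projFst '' flagVariety N c md dd)).IsPrime := by
  obtain ⟨s, hs, himage, hrat⟩ := exists_flagParam_image hF hne
  rw [himage, Set.image_image]
  exact (isPrime_and_map_of_rat_param hs fun i => hrat (Sum.inl i)).1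

/-- The chart `ψ` sends slice coordinates to the flag of `M₀ + T`, and `φ` returns the coordinates
of `sliceFrame`, regular where all compressions are invertible. -/
theorem mem_regPoints_flagVariety (hF : IsFlagType N m c md dd)
    {z : (Fin N × Fin N) ⊕ (Fin (c - 1) × (Fin N × Fin N)) → ℝ}
    (hz : z ∈ flagVariety N c md dd) : z ∈ regPoints ℝ (flagVariety N c md dd) := by
  obtain ⟨M₀, hM₀, hA, rfl⟩ := exists_frame_of_mem_flagVariety hF hz
  have hd0 : (M₀.transpose * M₀).det ≠ 0 := by rw [hM₀, Matrix.det_one]; exact one_ne_zero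
  let W := slice c md dd M₀
  let b := Module.finBasis ℝ W
  let T : (Fin (Module.finrank ℝ W) → ℝ) →ₗ[ℝ] Matrix (Fin N) (Fin m) ℝ :=
    W.subtype.comp b.equivFun.symm.toLinearMap
  have hT : ∀ t, T t ∈ slice c md dd M₀ := fun t => (b.equivFun.symm t).2
  -- The coordinate map of the slice is extended linearly to all matrices, so that `φ` is defined by
  -- one formula off the variety as well.
  obtain ⟨l, hl⟩ := LinearMap.exists_leftInverse_of_injective T (LinearMap.ker_eq_bot.mpr
    (W.injective_subtype.comp b.equivFun.symm.injective))
  have hlT : ∀ t, l (T t) = t := fun t => congrArg (fun f => f t) hl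
  have hTl : ∀ A ∈ slice c md dd M₀, T (l A) = A := by
    intro A hA'
    have : A = T (b.equivFun ⟨A, hA'⟩) := by simp [T]
    rw [this, hlT]
  have hTrat : MatRatOn ℝ Set.univ (fun t => M₀ + T t) := by
    refine (MatRatOn.const M₀).add fun i j => ?_
    have : ∀ t, T t i j = ∑ k, t k * (b k : Matrix (Fin N) (Fin m) ℝ) i j := by
      intro t
      simp [T, Module.Basis.equivFun_symm_apply, Matrix.sum_apply]
    simp only [this]
    exact RatOn.sum _ fun k _ => (RatOn.coord k).mul (RatOn.const (K := ℝ) _)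
  let comp : ℕ → ((Fin N × Fin N) ⊕ (Fin (c - 1) × (Fin N × Fin N)) → ℝ) →
      Matrix (Fin N) (Fin N) ℝ := fun k z => compression (spanProj (md k) M₀) (blk z k)
  obtain ⟨r, hr⟩ := (RatOn.prod (K := ℝ) (S := Set.univ) (Finset.Icc 1 c)
    (f := fun k z => (comp k z).det)
    (fun k _ => ((matRatOn_blk k).compression (spanProj (md k) M₀)).det)).exists_poly
  have hr' : ∀ z, aeval z r ≠ 0 ↔ ∀ k ∈ Finset.Icc 1 c, (comp k z).det ≠ 0 := by
    intro z
    rw [Ne, hr, Finset.prod_eq_zero_iff]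
    push Not
    rfl
  let ψ : (Fin (Module.finrank ℝ W) → ℝ) →
      ((Fin N × Fin N) ⊕ (Fin (c - 1) × (Fin N × Fin N)) → ℝ) :=
    fun t => ofTuple c fun k => spanProj (md k) (M₀ + T t)
  let φ : ((Fin N × Fin N) ⊕ (Fin (c - 1) × (Fin N × Fin N)) → ℝ) →
      (Fin (Module.finrank ℝ W) → ℝ) := fun z => l (sliceFrame md M₀ (blk z) - M₀)
  have hAdapt : ∀ t, Adapted c md dd (M₀ + T t) := fun t k hk i j hj hi => by
    rw [Matrix.add_apply, hA k hk i j hj hi, (hT t).1 k hk i j hj hi, add_zero]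
  refine (regular_of_chart (isPrime_flagVariety hF ⟨_, hz⟩).1 hz (ψ := ψ) ?_ ?_ (b := 0) ?_
    (r := r) ?_ (φ := φ) ?_ ?_ ?_).1
  · exact ratOn_ofTuple hF.one_le fun k _ => hTrat.spanProj _ fun t _ =>
      det_ne_zero_of_mem_slice hF hM₀ (hT t)
  · exact fun t => ofTuple_mem_flagVariety (isFlagTuple_spanProj hF (hAdapt t)
      (det_ne_zero_of_mem_slice hF hM₀ (hT t)))
  · simp only [ψ, map_zero, add_zero]
  · rw [hr']
    intro k hk
    simp only [comp]
    rw [blk_ofTuple hk, compression_self (spanProj_mem_grassmannian (hF.md_le hk) hd0),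
      Matrix.det_one]
    exact one_ne_zero
  · intro q
    refine MatRatOn.linear (F := fun z => sliceFrame md M₀ (blk z) - M₀) ?_
      ((LinearMap.proj q).comp l)
    refine MatRatOn.sub (fun i j => ?_) (MatRatOn.const M₀)
    refine RatOn.congr (f := fun z => (blk z (level md j) * (comp (level md j) z)⁻¹ * M₀) i j) ?_
      fun z _ => ?_
    · refine MatRatOn.mul (MatRatOn.mul (matRatOn_blk _) (MatRatOn.inv
        ((matRatOn_blk _).compression _) fun z hz => ?_)) (MatRatOn.const M₀) i j
      exact (hr' z).mp hz _ (hF.level_mem j)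
    · rfl
  · intro t ht
    rw [hr'] at ht
    have : sliceFrame md M₀ (blk (ψ t)) = M₀ + T t := by
      ext i j
      have hk := hF.level_mem j
      have h1 := ht _ hk
      simp only [comp, ψ, blk_ofTuple hk] at h1
      have h2 := congrFun (mulVec_compression_inv_of_mem_slice hF hM₀ (hT t) j h1) i
      rw [← h2, sliceFrame, Matrix.of_apply, blk_ofTuple hk]
    simp only [φ, this, add_sub_cancel_left, hlT]
  · intro z hz hrz
    rw [hr'] at hrz
    obtain ⟨h1, h2⟩ := sliceFrame_spec hF hM₀ hA hz hrz
    simp only [ψ, φ]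
    rw [hTl _ h1, add_sub_cancel]
    conv_rhs => rw [← ofTuple_blk z]
    exact (ofTuple_congr hF.one_le h2).symm

theorem regPoints_flagVariety (hF : IsFlagType N m c md dd) :
    regPoints ℝ (flagVariety N c md dd) = flagVariety N c md dd ∧
      regPoints ℚ (flagVariety N c md dd) = flagVariety N c md dd := by
  have h : regPoints ℝ (flagVariety N c md dd) = flagVariety N c md dd :=
    Set.Subset.antisymm (fun _ hz => hz.1) fun _ hz => mem_regPoints_flagVariety hF hz
  refine ⟨h, ?_⟩
  rcases (flagVariety N c md dd).eq_empty_or_nonempty with h0 | hne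
  · rw [h0]
    exact Set.subset_empty_iff.mp fun _ hz => hz.1
  · rw [regPoints_rat_eq (isPrime_flagVariety hF hne).2, h]

end FlagVariety

end RealQAlg

end

noncomputable section

namespace RealQAlg
open MvPolynomial

/-! ### The flag variety is projectively closed over the rationals -/

section ProjectivelyClosed

variable {N m c : ℕ} {md dd : ℕ → ℕ}

/-- The index of the `(i, j)` entry of the matrix `Y k` among the coordinates. -/
def blkIdx (c : ℕ) (k : ℕ) (i j : Fin N) :
    (Fin N × Fin N) ⊕ (Fin (c - 1) × (Fin N × Fin N)) :=
  if h : k - 1 < c - 1 then Sum.inr (⟨k - 1, h⟩, (i, j)) else Sum.inl (i, j)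

theorem blk_apply (z : (Fin N × Fin N) ⊕ (Fin (c - 1) × (Fin N × Fin N)) → ℝ) (k : ℕ)
    (i j : Fin N) : blk z k i j = z (blkIdx c k i j) := by
  rw [blk, blkIdx]
  split_ifs <;> rfl

theorem exists_blkIdx (hc : 1 ≤ c) (x : (Fin N × Fin N) ⊕ (Fin (c - 1) × (Fin N × Fin N))) :
    ∃ k ∈ Finset.Icc 1 c, ∃ i j, x = blkIdx c k i j := by
  rcases x with p | ⟨l, p⟩
  · refine ⟨c, Finset.mem_Icc.mpr ⟨hc, le_rfl⟩, p.1, p.2, ?_⟩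
    rw [blkIdx, dif_neg (lt_irrefl _)]
  · refine ⟨l + 1, Finset.mem_Icc.mpr ⟨by lia, by lia⟩, p.1, p.2, ?_⟩
    rw [blkIdx, dif_pos (by simp)]
    rfl

/-- The single equation `YᵀY = Y` encodes symmetry and idempotence. Unlike `Y * Y = Y`, it has a
quadratic part with no nonzero real zero. -/
theorem mem_grassmannian_iff {Y : Matrix (Fin N) (Fin N) ℝ} {r : ℕ} :
    Y ∈ grassmannian N r ↔ Y.transpose * Y = Y ∧ Y.trace = r := by
  constructor
  · rintro ⟨h1, h2, h3⟩
    exact ⟨by rw [h1, h2], h3⟩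
  · rintro ⟨h1, h3⟩
    have h2 : Y.transpose = Y := by
      have := congrArg Matrix.transpose h1
      rw [Matrix.transpose_mul, Matrix.transpose_transpose, h1] at this
      exact this.symm
    exact ⟨h2, by rwa [h2] at h1, h3⟩

theorem isProjectivelyQClosed_flagVariety (hc : 1 ≤ c) :
    IsProjectivelyQClosed (flagVariety N c md dd) := by
  let J := {k // k ∈ Finset.Icc 1 c}
  -- The four families are `YᵀY = Y`, the traces, the inclusions in `ℝ^(dd k)` and the nesting. The
  -- traces and the inclusions have zero quadratic part; the nesting equation at `k = c` is filled
  -- with zero.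
  let q : ((J × Fin N × Fin N) ⊕ J) ⊕ ((J × Fin N × Fin N) ⊕ (J × Fin N × Fin N)) →
      MvPolynomial ((Fin N × Fin N) ⊕ (Fin (c - 1) × (Fin N × Fin N))) ℚ :=
    Sum.elim
      (Sum.elim (fun e => ∑ l, X (blkIdx c e.1 l e.2.1) * X (blkIdx c e.1 l e.2.2)) fun _ => 0)
      (Sum.elim (fun _ => 0) fun e => if e.1.1 < c then
        ∑ l, X (blkIdx c (e.1 + 1) e.2.1 l) * X (blkIdx c e.1 l e.2.2) else 0)
  let l : ((J × Fin N × Fin N) ⊕ J) ⊕ ((J × Fin N × Fin N) ⊕ (J × Fin N × Fin N)) →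
      MvPolynomial ((Fin N × Fin N) ⊕ (Fin (c - 1) × (Fin N × Fin N))) ℚ :=
    Sum.elim
      (Sum.elim (fun e => -X (blkIdx c e.1 e.2.1 e.2.2)) fun k =>
        ∑ i, X (blkIdx c k i i) - C (md k : ℚ))
      (Sum.elim (fun e => if e.2.2.val < dd e.1 then 0 else X (blkIdx c e.1 e.2.1 e.2.2))
        fun e => if e.1.1 < c then -X (blkIdx c e.1 e.2.1 e.2.2) else 0)
  have : Finite J := Finite.of_fintype (Finset.Icc 1 c)
  refine isProjectivelyQClosed_of_quadratic q l ?_ ?_ ?_ ?_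
  · rintro ((e | k) | (e | e))
    · simp only [q, Sum.elim_inl]
      exact IsHomogeneous.sum _ _ _ fun _ _ => (isHomogeneous_X _ _).mul (isHomogeneous_X _ _)
    · exact isHomogeneous_zero _ _ _
    · exact isHomogeneous_zero _ _ _
    · simp only [q, Sum.elim_inr]
      split_ifs
      · exact IsHomogeneous.sum _ _ _ fun _ _ => (isHomogeneous_X _ _).mul (isHomogeneous_X _ _)
      · exact isHomogeneous_zero _ _ _
  · rintro ((e | k) | (e | e)) <;> simp only [l, Sum.elim_inr, Sum.elim_inl]
    · rw [totalDegree_neg, totalDegree_X]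
    · refine (totalDegree_sub _ _).trans (max_le (totalDegree_finsetSum_le fun i _ => ?_) ?_)
      · rw [totalDegree_X]
      · rw [totalDegree_C]; exact zero_le_one
    · split_ifs <;> simp
    · split_ifs <;> simp
  · ext z
    have e1 : ∀ (k : J) (i j : Fin N), aeval z (q (.inl (.inl (k, i, j))) +
        l (.inl (.inl (k, i, j)))) = ((blk z k).transpose * blk z k) i j - blk z k i j := by
      intro k i j
      simp [q, l, Matrix.mul_apply, blk_apply, sub_eq_add_neg]
    have e2 : ∀ k : J, aeval z (q (.inl (.inr k)) + l (.inl (.inr k))) =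
        (blk z k).trace - md k := by
      intro k
      simp [q, l, Matrix.trace, blk_apply]
    have e3 : ∀ (k : J) (i j : Fin N), aeval z (q (.inr (.inl (k, i, j))) +
        l (.inr (.inl (k, i, j)))) = blk z k i j - (blk z k * flagProj N (dd k)) i j := by
      intro k i j
      rw [mul_flagProj_apply]
      simp only [q, l, Sum.elim_inr, Sum.elim_inl, zero_add]
      split_ifs <;> simp [blk_apply]
    have e4 : ∀ (k : J) (i j : Fin N), k.1 < c → aeval z (q (.inr (.inr (k, i, j))) +
        l (.inr (.inr (k, i, j)))) = (blk z (k + 1) * blk z k) i j - blk z k i j := by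
      intro k i j hk
      simp [q, l, if_pos hk, Matrix.mul_apply, blk_apply, sub_eq_add_neg]
    have e4' : ∀ (k : J) (i j : Fin N), ¬ k.1 < c → aeval z (q (.inr (.inr (k, i, j))) +
        l (.inr (.inr (k, i, j)))) = 0 := by
      intro k i j hk
      simp [q, l, if_neg hk]
    constructor
    · intro hz
      rintro ((⟨k, i, j⟩ | k) | (⟨k, i, j⟩ | ⟨k, i, j⟩))
      · rw [e1, (mem_grassmannian_iff.mp (hz.1 k k.2)).1, sub_self]
      · rw [e2, (hz.1 k k.2).2.2, sub_self]
      · rw [e3, hz.2.1 k k.2, sub_self]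
      · by_cases hk : k.1 < c
        · rw [e4 k i j hk, hz.2.2 k (Finset.mem_Ico.mpr ⟨(Finset.mem_Icc.mp k.2).1, hk⟩), sub_self]
        · exact e4' k i j hk
    · intro hz
      refine ⟨fun k hk => mem_grassmannian_iff.mpr ⟨?_, ?_⟩, fun k hk => ?_, fun k hk => ?_⟩
      · ext i j
        exact sub_eq_zero.mp ((e1 ⟨k, hk⟩ i j).symm.trans (hz _))
      · exact sub_eq_zero.mp ((e2 ⟨k, hk⟩).symm.trans (hz _))
      · ext i j
        exact (sub_eq_zero.mp ((e3 ⟨k, hk⟩ i j).symm.trans (hz _))).symm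
      · have hk' := Finset.mem_Ico.mp hk
        ext i j
        exact sub_eq_zero.mp ((e4 ⟨k, Finset.mem_Icc.mpr ⟨hk'.1, hk'.2.le⟩⟩ i j hk'.2).symm.trans
          (hz _))
  · intro z hz
    ext x
    obtain ⟨k, hk, i, j, rfl⟩ := exists_blkIdx hc x
    -- A diagonal entry of `YᵀY` is the sum of the squares of a column.
    have := hz (.inl (.inl (⟨k, hk⟩, j, j)))
    simp only [q, Sum.elim_inl, map_sum, map_mul, aeval_X] at this
    rw [Finset.sum_eq_zero_iff_of_nonneg fun i _ => mul_self_nonneg _] at this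
    exact mul_self_eq_zero.mp (this i (Finset.mem_univ i))

theorem IsProjectivelyQClosed.isAlgebraicOver {ι : Type} {V : Set (ι → ℝ)}
    (h : IsProjectivelyQClosed V) : IsAlgebraicOver ℚ V ∧ IsAlgebraicOver ℝ V := by
  obtain ⟨p, -, rfl⟩ := h
  exact ⟨⟨{p}, by simp⟩, ⟨{map (algebraMap ℚ ℝ) p}, Set.ext fun x => by
    rw [Set.mem_ofPred_eq, Set.mem_ofPred_eq]
    simp only [Set.mem_singleton_iff, forall_eq, aeval_map_algebraMap]⟩⟩

end ProjectivelyClosed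

end RealQAlg

end

noncomputable section

namespace RealQAlg
open MvPolynomial

/-! ### Incidence with the canonical flag as a kernel -/

section Incidence

variable {N : ℕ}

theorem mem_canonicalFlag_iff {ℓ : ℕ} {v : Fin N → ℝ} :
    v ∈ canonicalFlag N ℓ ↔ ∀ i : Fin N, ℓ ≤ i.val → v i = 0 := by
  constructor
  · intro hv
    induction hv using Submodule.span_induction with
    | mem x hx =>
      obtain ⟨i, hi, rfl⟩ := hx
      intro j hj
      rw [Pi.single_eq_of_ne]
      rintro rfl
      exact absurd hi (not_lt.mpr hj)
    | zero => exact fun _ _ => rfl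
    | add x y _ _ hx hy => intro i hi; rw [Pi.add_apply, hx i hi, hy i hi, add_zero]
    | smul a x _ hx => intro i hi; rw [Pi.smul_apply, hx i hi, smul_zero]
  · intro h
    rw [pi_eq_sum_univ' v]
    refine Submodule.sum_mem _ fun i _ => ?_
    by_cases hi : i.val < ℓ
    · refine Submodule.smul_mem _ _ (Submodule.subset_span ⟨i, hi, ?_⟩)
      ext j
      simp [Pi.single_apply, eq_comm]
    · rw [h i (not_lt.mp hi), zero_smul]
      exact zero_mem _

theorem flagProj_mulVec_apply (ℓ : ℕ) (v : Fin N → ℝ) (i : Fin N) :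
    (flagProj N ℓ).mulVec v i = if i.val < ℓ then v i else 0 := by
  rw [flagProj, Matrix.mulVec_diagonal]
  simp

theorem mem_canonicalFlag_iff_mulVec {ℓ : ℕ} {v : Fin N → ℝ} :
    v ∈ canonicalFlag N ℓ ↔ (flagProj N ℓ).mulVec v = v := by
  rw [mem_canonicalFlag_iff, funext_iff]
  refine forall_congr' fun i => ?_
  rw [flagProj_mulVec_apply]
  split_ifs with h
  · simp [not_le.mpr h]
  · simp [not_lt.mp h, eq_comm]

theorem canonicalFlag_eq_range {ℓ : ℕ} (h : ℓ ≤ N) :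
    canonicalFlag N ℓ = LinearMap.range (flagProj N ℓ).mulVecLin := by
  ext v
  rw [mem_canonicalFlag_iff_mulVec, mem_range_iff_of_mem_grassmannian (flagProj_mem_grassmannian h)]

theorem finrank_canonicalFlag {ℓ : ℕ} (h : ℓ ≤ N) :
    Module.finrank ℝ (canonicalFlag N ℓ) = ℓ := by
  rw [canonicalFlag_eq_range h, finrank_range_of_mem_grassmannian (flagProj_mem_grassmannian h)]

theorem canonicalFlag_mono {ℓ ℓ' : ℕ} (h : ℓ ≤ ℓ') : canonicalFlag N ℓ ≤ canonicalFlag N ℓ' :=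
  fun _ hv => mem_canonicalFlag_iff.mpr fun i hi => mem_canonicalFlag_iff.mp hv i (h.trans hi)

/-- A matrix whose kernel is the intersection of the image of the projection `X` with `ℝ^ℓ`. -/
def incidence (X : Matrix (Fin N) (Fin N) ℝ) (ℓ : ℕ) : Matrix (Fin N) (Fin N) ℝ :=
  (1 - X) + (1 - flagProj N ℓ)

theorem incidence_transpose {X : Matrix (Fin N) (Fin N) ℝ} (hX : X.transpose = X) (ℓ : ℕ) :
    (incidence X ℓ).transpose = incidence X ℓ := by
  simp [incidence, hX, flagProj_transpose]

theorem dotProduct_one_sub_mulVec {P : Matrix (Fin N) (Fin N) ℝ} (h1 : P.transpose = P)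
    (h2 : P * P = P) (v : Fin N → ℝ) :
    v ⬝ᵥ (1 - P).mulVec v = (1 - P).mulVec v ⬝ᵥ (1 - P).mulVec v := by
  have h3 : (1 - P).transpose = 1 - P := by
    rw [Matrix.transpose_sub, Matrix.transpose_one, h1]
  have h4 : (1 - P) * (1 - P) = 1 - P := by
    rw [Matrix.mul_sub, Matrix.mul_one, Matrix.sub_mul, Matrix.one_mul, h2, sub_self, sub_zero]
  rw [Matrix.dotProduct_mulVec ((1 - P).mulVec v), ← Matrix.mulVec_transpose, h3,
    Matrix.mulVec_mulVec, h4, dotProduct_comm]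

/-- The matrix is a sum of two orthogonal projections, so pairing `incidence X ℓ` applied to `v`
with `v` gives the sum of the squared norms of the components of `v` orthogonal to the two
subspaces. -/
theorem ker_incidence {X : Matrix (Fin N) (Fin N) ℝ} {r : ℕ} (hX : X ∈ grassmannian N r)
    (ℓ : ℕ) : LinearMap.ker (incidence X ℓ).mulVecLin =
      LinearMap.range X.mulVecLin ⊓ canonicalFlag N ℓ := by
  ext v
  rw [LinearMap.mem_ker, Matrix.mulVecLin_apply, Submodule.mem_inf,
    mem_range_iff_of_mem_grassmannian hX, mem_canonicalFlag_iff_mulVec, incidence,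
    Matrix.add_mulVec]
  constructor
  · intro h
    have h0 := congrArg (v ⬝ᵥ ·) h
    simp only [dotProduct_add, dotProduct_zero] at h0
    rw [dotProduct_one_sub_mulVec hX.1 hX.2.1,
      dotProduct_one_sub_mulVec (flagProj_transpose N ℓ) (flagProj_mul_self N ℓ)] at h0
    have hn : ∀ w : Fin N → ℝ, 0 ≤ w ⬝ᵥ w := fun w =>
      Finset.sum_nonneg fun i _ => mul_self_nonneg _
    obtain ⟨h1, h2⟩ := (add_eq_zero_iff_of_nonneg (hn _) (hn _)).mp h0
    rw [dotProduct_self_eq_zero, Matrix.sub_mulVec, Matrix.one_mulVec, sub_eq_zero] at h1 h2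
    exact ⟨h1.symm, h2.symm⟩
  · rintro ⟨h1, h2⟩
    rw [Matrix.sub_mulVec, Matrix.sub_mulVec, h1, h2, Matrix.one_mulVec, sub_self, add_zero]

theorem incidence_mul_eq_zero {X P : Matrix (Fin N) (Fin N) ℝ} {ℓ : ℕ} (h1 : X * P = P)
    (h2 : flagProj N ℓ * P = P) : incidence X ℓ * P = 0 := by
  rw [incidence, add_mul, sub_mul, sub_mul, h1, h2, one_mul, sub_self, add_zero]

variable {τ : Type*} {K : Type} [Field K] [Algebra K ℝ] {S : Set (τ → ℝ)}

theorem MatRatOn.incidence {F : (τ → ℝ) → Matrix (Fin N) (Fin N) ℝ} (hF : MatRatOn K S F)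
    (ℓ : ℕ) : MatRatOn K S (fun x => incidence (F x) ℓ) :=
  (MatRatOn.one.sub hF).add (MatRatOn.one.sub (matRatOn_flagProj N ℓ))

theorem MatRatOn.charpoly_coeff {F : (τ → ℝ) → Matrix (Fin N) (Fin N) ℝ} (hF : MatRatOn K S F)
    (i : ℕ) : RatOn K S (fun x => (F x).charpoly.coeff i) := by
  refine (RatOn.comp ((Matrix.charpoly.univ K (Fin N)).coeff i)
    (g := fun x p => F x p.1 p.2) fun p => hF p.1 p.2).congr fun x _ => ?_
  have h : Matrix.of (Function.curry fun p : Fin N × Fin N => F x p.1 p.2) = F x := rfl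
  rw [aeval_def, ← coe_eval₂Hom, Matrix.charpoly.univ_coeff_eval₂Hom, h]

end Incidence

/-! ### Birationality of the projection -/

section Birational

variable {N m c : ℕ} {md dd : ℕ → ℕ}

/-- The member of the flag recovered from `X`: the projection onto the intersection of the image
of `X` with `ℝ^ℓ`, when that intersection has dimension `r`. -/
def interProj (r ℓ : ℕ) (X : Matrix (Fin N) (Fin N) ℝ) : Matrix (Fin N) (Fin N) ℝ :=
  ((incidence X ℓ).charpoly.coeff r)⁻¹ • ∑ i ∈ Finset.range (N + 1),
    (incidence X ℓ).charpoly.coeff (i + r) • incidence X ℓ ^ i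

theorem interProj_eq {X P : Matrix (Fin N) (Fin N) ℝ} {r ℓ : ℕ} (hX : X.transpose = X)
    (hP : P ∈ grassmannian N r) (h1 : X * P = P) (h2 : P * flagProj N ℓ = P)
    (h : (incidence X ℓ).charpoly.coeff r ≠ 0) : interProj r ℓ X = P := by
  have h2' : flagProj N ℓ * P = P := by
    have := congrArg Matrix.transpose h2
    rwa [Matrix.transpose_mul, hP.1, flagProj_transpose] at this
  rw [interProj, ← smul_kernelProj_eq (incidence_transpose hX ℓ) hP (incidence_mul_eq_zero h1 h2')
    h, smul_smul, inv_mul_cancel₀ h, one_smul]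

theorem matRatOn_toMat {K : Type} [Field K] [Algebra K ℝ] {S : Set (Fin N × Fin N → ℝ)} :
    MatRatOn K S toMat := fun i j => RatOn.coord (i, j)

/-- A flag tuple is generic when its members are cut out by the largest one. -/
def IsGeneric (c : ℕ) (md dd : ℕ → ℕ) (x : Fin N × Fin N → ℝ) : Prop :=
  ∀ k ∈ Finset.Icc 1 c, (incidence (toMat x) (dd k)).charpoly.coeff (md k) ≠ 0

/-- Genericity depends on `X` alone and is the nonvanishing of one polynomial `p`. Where it holds,
`interProj` rebuilds every `Y k` from `X`; the given generic point and irreducibility make both open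
sets dense. -/
theorem isBirationalMap_flagVariety (hF : IsFlagType N m c md dd)
    {z₀ : (Fin N × Fin N) ⊕ (Fin (c - 1) × (Fin N × Fin N)) → ℝ}
    (hz₀ : z₀ ∈ flagVariety N c md dd) (hgen : IsGeneric c md dd (projFst z₀)) :
    IsBirationalMap (flagVariety N c md dd) (projFst '' flagVariety N c md dd) projFst := by
  have hne : (flagVariety N c md dd).Nonempty := ⟨z₀, hz₀⟩
  obtain ⟨p, hp⟩ := (RatOn.prod (K := ℝ) (S := Set.univ) (Finset.Icc 1 c)
    (f := fun k x => (incidence (N := N) (toMat x) (dd k)).charpoly.coeff (md k))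
    (fun k _ => (matRatOn_toMat.incidence (dd k)).charpoly_coeff (md k))).exists_poly
  have hp' : ∀ x, aeval x p ≠ 0 ↔ IsGeneric c md dd x := by
    intro x
    rw [Ne, hp, Finset.prod_eq_zero_iff]
    push Not
    rfl
  have hq : ∀ z : (Fin N × Fin N) ⊕ (Fin (c - 1) × (Fin N × Fin N)) → ℝ,
      aeval z (rename Sum.inl p) ≠ 0 ↔ IsGeneric c md dd (projFst z) := by
    intro z
    rw [aeval_projFst, hp']
  let g : (Fin N × Fin N → ℝ) → ((Fin N × Fin N) ⊕ (Fin (c - 1) × (Fin N × Fin N)) → ℝ) :=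
    fun x => ofTuple c fun k => interProj (md k) (dd k) (toMat x)
  have hg : ∀ z ∈ flagVariety N c md dd, IsGeneric c md dd (projFst z) → g (projFst z) = z := by
    intro z hz hzg
    conv_rhs => rw [← ofTuple_blk z]
    refine ofTuple_congr hF.one_le fun k hk => ?_
    have hk' := Finset.mem_Icc.mp hk
    refine interProj_eq ?_ (hz.1 k hk) ?_ (hz.2.1 k hk) (hzg k hk)
    · rw [← blk_last]
      exact (hz.1 c hF.last_mem).1
    · rw [← blk_last]
      exact hz.mul_eq hk'.1 hk'.2 le_rfl
  refine ⟨Set.mapsTo_image _ _, isRegularMapOn_iff.mpr fun j => RatOn.coord (Sum.inl j),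
    {z ∈ flagVariety N c md dd | aeval z (rename Sum.inl p) ≠ 0},
    {x ∈ projFst '' flagVariety N c md dd | aeval x p ≠ 0}, g,
    isZariskiOpenDenseIn_of_isPrime (isPrime_flagVariety hF hne).1 ⟨z₀, hz₀, (hq _).mpr hgen⟩,
    isZariskiOpenDenseIn_of_isPrime (isPrime_projFst_flagVariety hF hne)
      ⟨_, Set.mem_image_of_mem _ hz₀, (hp' _).mpr hgen⟩, ?_, ?_, ⟨?_, ?_⟩, ?_⟩
  · rintro z ⟨hz, hzg⟩
    exact ⟨Set.mem_image_of_mem _ hz, (hp' _).mpr ((hq z).mp hzg)⟩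
  · rintro _ ⟨⟨z, hz, rfl⟩, hzg⟩
    rw [hp'] at hzg
    rw [hg z hz hzg]
    exact ⟨hz, (hq z).mpr hzg⟩
  · rintro z ⟨hz, hzg⟩
    exact hg z hz ((hq z).mp hzg)
  · rintro _ ⟨⟨z, hz, rfl⟩, hzg⟩
    rw [hg z hz ((hp' _).mp hzg)]
  · refine isRegularMapOn_iff.mpr (ratOn_ofTuple hF.one_le fun k hk => ?_)
    have hA := (matRatOn_toMat (N := N) (K := ℝ)
      (S := {x ∈ projFst '' flagVariety N c md dd | aeval x p ≠ 0})).incidence (dd k)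
    exact MatRatOn.smul ((hA.charpoly_coeff _).inv fun x hx => (hp' x).mp hx.2 k hk)
      (MatRatOn.sum _ fun i _ => MatRatOn.smul (hA.charpoly_coeff _) (hA.pow i))

theorem algDim_flagVariety (hF : IsFlagType N m c md dd)
    {z₀ : (Fin N × Fin N) ⊕ (Fin (c - 1) × (Fin N × Fin N)) → ℝ}
    (hz₀ : z₀ ∈ flagVariety N c md dd) (hgen : IsGeneric c md dd (projFst z₀)) :
    algDim (flagVariety N c md dd) = algDim (projFst '' flagVariety N c md dd) :=
  algDim_eq_of_isBirationalMap (isPrime_projFst_flagVariety hF ⟨z₀, hz₀⟩)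
    (isPrime_flagVariety hF ⟨z₀, hz₀⟩).1 (isBirationalMap_flagVariety hF hz₀ hgen)

theorem isQDesingularization_flagVariety (hF : IsFlagType N m c md dd)
    {z₀ : (Fin N × Fin N) ⊕ (Fin (c - 1) × (Fin N × Fin N)) → ℝ}
    (hz₀ : z₀ ∈ flagVariety N c md dd) (hgen : IsGeneric c md dd (projFst z₀))
    (halg : IsAlgebraicOver ℚ (projFst '' flagVariety N c md dd)) :
    IsQDesingularization (projFst '' flagVariety N c md dd) (flagVariety N c md dd) := by
  have hclosed := isProjectivelyQClosed_flagVariety (N := N) (md := md) (dd := dd) hF.one_le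
  have hreg := regPoints_flagVariety hF
  exact ⟨halg, ⟨⟨hclosed.isAlgebraicOver.2, hreg.1⟩, algDim_flagVariety hF hz₀ hgen,
    isBirationalMap_flagVariety hF hz₀ hgen⟩, ⟨hclosed.isAlgebraicOver.1, hreg⟩, hclosed⟩

end Birational

end RealQAlg

end

noncomputable section

namespace RealQAlg
open Matrix

/-! ### Rank conditions, the image of the projection and a generic point -/

section Schubert

variable {N m c : ℕ} {md dd B : ℕ → ℕ}

/-- The position of the last nonzero entry of the `j`-th vector of a generic adapted frame, when
`dd k = md k + B k`. -/
def pivot (md B : ℕ → ℕ) (j : ℕ) : ℕ := j + B (level md j)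

theorem pivot_lt (hB : Monotone B) (hdd : ∀ k, dd k = md k + B k) {j k : ℕ} (hk : 1 ≤ k)
    (hj : j < md k) : pivot md B j < dd k := by
  rw [pivot, hdd]
  exact Nat.add_lt_add_of_lt_of_le hj (hB (level_le hk hj))

theorem le_pivot (hF : IsFlagType N m c md dd) (hB : Monotone B) (hdd : ∀ k, dd k = md k + B k)
    (j : Fin m) {k : ℕ} (hj : md k ≤ j) : dd k ≤ pivot md B j := by
  rw [pivot, hdd]
  refine Nat.add_le_add hj (hB (le_of_lt ?_))
  by_contra! h
  exact absurd (hF.md_mono h) (not_le.mpr (hj.trans_lt (hF.lt_md_level j)))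

theorem pivot_lt_of_fin (hF : IsFlagType N m c md dd) (hB : Monotone B)
    (hdd : ∀ k, dd k = md k + B k) (j : Fin m) : pivot md B j < N := by
  rw [← hF.dd_last]
  exact pivot_lt hB hdd hF.one_le (hF.md_last.symm ▸ j.2)

theorem pivot_strictMono (hF : IsFlagType N m c md dd) (hB : Monotone B) {i j : Fin m}
    (hij : i < j) : pivot md B i < pivot md B j :=
  Nat.add_lt_add_of_lt_of_le hij (hB (level_le (Finset.mem_Icc.mp (hF.level_mem j)).1
    (lt_trans (Fin.lt_def.mp hij) (hF.lt_md_level j))))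

theorem IsFlagTuple.range_le {Y : ℕ → Matrix (Fin N) (Fin N) ℝ} (hY : IsFlagTuple c md dd Y)
    {k : ℕ} (hk : k ∈ Finset.Icc 1 c) : LinearMap.range (Y k).mulVecLin ≤
      LinearMap.range (Y c).mulVecLin ⊓ canonicalFlag N (dd k) := by
  have hk' := Finset.mem_Icc.mp hk
  rintro _ ⟨w, rfl⟩
  refine Submodule.mem_inf.mpr ⟨⟨Y k *ᵥ w, ?_⟩, mem_canonicalFlag_iff.mpr fun i hi => ?_⟩
  · rw [mulVecLin_apply, mulVecLin_apply, mulVec_mulVec, hY.mul_eq hk'.1 hk'.2 le_rfl]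
  · rw [mulVecLin_apply, mulVec, dotProduct]
    exact Finset.sum_eq_zero fun l _ => by rw [hY.apply_eq_zero hk hi, zero_mul]

/-- Given a flag, let `k = level md j`. Inside `ℝ^(dd k)`, the subspace of dimension `md k` meets
the subspace `ℝ^(pivot j + 1)`, of codimension `md k - (j + 1)`, in dimension at least `j + 1`.
Conversely, take an orthonormal frame of `X` with `j`-th vector in `ℝ^(pivot j + 1)`; it is adapted
because `j < md k` implies `pivot j < dd k`. -/
theorem projFst_image_flagVariety (hF : IsFlagType N m c md dd) (hB : Monotone B)
    (hdd : ∀ k, dd k = md k + B k) :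
    projFst '' flagVariety N c md dd = {x | toMat x ∈ grassmannian N m ∧ ∀ j : Fin m,
      j.val + 1 ≤ Module.finrank ℝ ↥(LinearMap.range (toMat x).mulVecLin ⊓
        canonicalFlag N (pivot md B j + 1))} := by
  ext x
  constructor
  · rintro ⟨z, hz, rfl⟩
    have hX := hz.1 c hF.last_mem
    rw [blk_last, hF.md_last] at hX
    refine ⟨hX, fun j => ?_⟩
    have hl := hF.level_mem j
    have hle := hz.range_le hl
    rw [blk_last] at hle
    have h1 := finrank_range_of_mem_grassmannian (hz.1 _ hl)
    have h2 := finrank_canonicalFlag (N := N) (pivot_lt_of_fin hF hB hdd j)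
    have h3 := Submodule.finrank_sup_add_finrank_inf_eq
      (LinearMap.range (blk z (level md j)).mulVecLin) (canonicalFlag N (pivot md B j + 1))
    have h4 := Submodule.finrank_mono (sup_le (hle.trans inf_le_right)
      (canonicalFlag_mono (N := N) (pivot_lt hB hdd (Finset.mem_Icc.mp hl).1 (hF.lt_md_level j))))
    rw [finrank_canonicalFlag (hF.dd_le hl)] at h4
    have h5 := Submodule.finrank_mono (inf_le_inf_right (canonicalFlag N (pivot md B j + 1))
      (hle.trans inf_le_left))
    have h6 := hdd (level md j)
    rw [Nat.succ_eq_add_one] at h2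
    rw [h1, h2, pivot] at h3
    rw [pivot] at *
    lia
  · rintro ⟨hX, hj⟩
    obtain ⟨M, hM, hV⟩ := exists_orthonormal_frame (fun j : Fin m =>
      LinearMap.range (toMat x).mulVecLin ⊓ canonicalFlag N (pivot md B j + 1)) hj
    have hA : Adapted c md dd M := fun k hk i j hjk hi =>
      mem_canonicalFlag_iff.mp (Submodule.mem_inf.mp (hV j)).2 i
        ((Nat.succ_le_of_lt (pivot_lt hB hdd (Finset.mem_Icc.mp hk).1 hjk)).trans hi)
    have hd : (Mᵀ * M).det ≠ 0 := by rw [hM, det_one]; exact one_ne_zero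
    refine ⟨ofTuple c fun k => spanProj (md k) M,
      ofTuple_mem_flagVariety (isFlagTuple_spanProj hF hA hd), ?_⟩
    have hXM : toMat x = spanProj (md c) M := by
      rw [hF.md_last]
      exact eq_spanProj le_rfl hd hX (mul_mul_flagProj_eq fun j _ =>
        (mem_range_iff_of_mem_grassmannian hX).mp (Submodule.mem_inf.mp (hV j)).1)
    ext p
    change spanProj (md c) M p.1 p.2 = x p
    rw [← hXM]
    rfl

theorem isAlgebraicOver_rankConditions (N m : ℕ) (p : Fin m → ℕ) :
    IsAlgebraicOver ℚ {x : Fin N × Fin N → ℝ | toMat x ∈ grassmannian N m ∧ ∀ j : Fin m,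
      j.val + 1 ≤ Module.finrank ℝ ↥(LinearMap.range (toMat x).mulVecLin ⊓
        canonicalFlag N (p j))} := by
  have hX : MatRatOn ℚ Set.univ (toMat (N := N)) := matRatOn_toMat
  refine isAlgebraicOver_of_ratOn (α := (Fin N × Fin N) ⊕ Option ((j : Fin m) × Fin (j + 1)))
    (f := Sum.elim (fun e x => ((toMat x)ᵀ * toMat x - toMat x) e.1 e.2)
      fun o x => o.elim ((toMat x).trace - m) fun e =>
        (incidence (toMat x) (p e.1)).charpoly.coeff e.2) ?_ fun x => ?_
  · rintro (e | _ | e)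
    · exact (hX.transpose.mul hX).sub hX e.1 e.2
    · refine RatOn.sub (RatOn.sum _ fun i _ => hX i i) ((RatOn.const (m : ℚ)).congr ?_)
      simp
    · exact (hX.incidence _).charpoly_coeff _
  · constructor
    · rintro ⟨h, hj⟩ (e | _ | e)
      · simp only [Sum.elim_inl, (mem_grassmannian_iff.mp h).1, sub_self, Matrix.zero_apply]
      · simp only [Sum.elim_inr, Option.elim_none, (mem_grassmannian_iff.mp h).2, sub_self]
      · have h1 := hj e.1
        rw [← ker_incidence h, ← charpoly_coeff_eq_zero_iff (incidence_transpose h.1 _)] at h1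
        exact h1 e.2 e.2.2
    · intro h
      have hg : toMat x ∈ grassmannian N m := by
        refine mem_grassmannian_iff.mpr ⟨?_, sub_eq_zero.mp (h (.inr none))⟩
        ext i j
        exact sub_eq_zero.mp (h (.inl (i, j)))
      refine ⟨hg, fun j => ?_⟩
      rw [← ker_incidence hg, ← charpoly_coeff_eq_zero_iff (incidence_transpose hg.1 _)]
      exact fun i hi => h (.inr (some ⟨j, i, hi⟩))

/-- The frame consists of the canonical basis vectors at the pivots. Those lying in `ℝ^(dd k)` are
exactly the first `md k`, so the intersection has the least possible dimension and the coefficient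
of index `md k` is nonzero. -/
theorem exists_isGeneric (hF : IsFlagType N m c md dd) (hB : Monotone B)
    (hdd : ∀ k, dd k = md k + B k) :
    ∃ z ∈ flagVariety N c md dd, IsGeneric c md dd (projFst z) := by
  let M : Matrix (Fin N) (Fin m) ℝ := of fun i j => if i.val = pivot md B j then 1 else 0
  have hMv : ∀ (v : Fin N → ℝ) (j : Fin m),
      (Mᵀ *ᵥ v) j = v ⟨pivot md B j, pivot_lt_of_fin hF hB hdd j⟩ := by
    intro v j
    rw [mulVec, dotProduct, Finset.sum_eq_single ⟨pivot md B j, pivot_lt_of_fin hF hB hdd j⟩]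
    · simp [M]
    · intro i _ hi
      have : i.val ≠ pivot md B j := fun h => hi (Fin.ext h)
      simp [M, this]
    · simp
  have hM : Mᵀ * M = 1 := by
    ext i j
    change (Mᵀ *ᵥ fun l => M l j) i = _
    rw [hMv, one_apply]
    refine if_congr ⟨fun h => ?_, fun h => by rw [h]⟩ rfl rfl
    rcases lt_trichotomy i j with h' | h' | h'
    · exact absurd h (pivot_strictMono hF hB h').ne
    · exact h'
    · exact absurd h (pivot_strictMono hF hB h').ne'
  have hA : Adapted c md dd M := fun k hk i j hj hi =>
    if_neg ((pivot_lt hB hdd (Finset.mem_Icc.mp hk).1 hj).trans_le hi).ne'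
  have hd : (Mᵀ * M).det ≠ 0 := by rw [hM, det_one]; exact one_ne_zero
  have hY := isFlagTuple_spanProj hF hA hd
  refine ⟨ofTuple c fun k => spanProj (md k) M, ofTuple_mem_flagVariety hY, fun k hk => ?_⟩
  rw [← blk_last, blk_ofTuple hF.last_mem]
  have hX : spanProj (md c) M ∈ grassmannian N (md c) := hY.1 c hF.last_mem
  have hrange : LinearMap.range (spanProj (md c) M).mulVecLin ⊓ canonicalFlag N (dd k) =
      LinearMap.range (spanProj (md k) M).mulVecLin := by
    refine le_antisymm ?_ (hY.range_le hk)
    intro v hv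
    obtain ⟨h1, h2⟩ := Submodule.mem_inf.mp hv
    rw [mem_range_iff_of_mem_grassmannian hX, spanProj_of_orthonormal hM, hF.md_last,
      flagProj_eq_one le_rfl, Matrix.mul_one, ← mulVec_mulVec] at h1
    have hYk : spanProj (md k) M ∈ grassmannian N (md k) := hY.1 k hk
    rw [mem_range_iff_of_mem_grassmannian hYk, spanProj_of_orthonormal hM,
      ← mulVec_mulVec, ← mulVec_mulVec]
    conv_rhs => rw [← h1]
    congr 1
    ext j
    rw [flagProj_mulVec_apply]
    split_ifs with hj
    · rfl
    · rw [hMv]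
      exact (mem_canonicalFlag_iff.mp h2 _ (le_pivot hF hB hdd j (not_lt.mp hj))).symm
  have hdim : Module.finrank ℝ (LinearMap.ker (incidence (spanProj (md c) M) (dd k)).mulVecLin) =
      md k := by
    rw [ker_incidence hX, hrange, finrank_range_of_mem_grassmannian (hY.1 k hk)]
  obtain ⟨q, hq, h⟩ := exists_charpoly_factorization (incidence_transpose hX.1 (dd k))
  rw [h, hdim, Polynomial.coeff_X_pow_mul', if_pos le_rfl, Nat.sub_self]
  exact hq

theorem isQDesingularization_rankConditions (hF : IsFlagType N m c md dd) (hB : Monotone B)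
    (hdd : ∀ k, dd k = md k + B k) :
    IsQDesingularization (projFst '' flagVariety N c md dd) (flagVariety N c md dd) := by
  obtain ⟨z, hz, hgen⟩ := exists_isGeneric hF hB hdd
  refine isQDesingularization_flagVariety hF hz hgen ?_
  rw [projFst_image_flagVariety hF hB hdd]
  exact isAlgebraicOver_rankConditions N m _

end Schubert

/-! ### Translation to Schubert and Bott–Samelson varieties -/

section Staircase

variable {m n c : ℕ} {lam : Fin m → ℕ} {a b : ℕ → ℕ}

theorem stepDim_mono (a : ℕ → ℕ) : Monotone (stepDim a) := fun _ _ h =>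
  Finset.sum_le_sum_of_subset (Finset.Icc_subset_Icc_right h)

theorem sum_range_mono (b : ℕ → ℕ) : Monotone fun k => ∑ i ∈ Finset.range k, b i := fun _ _ h =>
  Finset.sum_le_sum_of_subset (Finset.range_subset_range.mpr h)

theorem IsStaircase.isFlagType (h : IsStaircase n lam c a b) :
    IsFlagType (m + n) m c (stepDim a) (stepFlag a b) where
  one_le := h.1
  md_mono := stepDim_mono a
  dd_mono := (stepDim_mono a).add (sum_range_mono b)
  md_last := h.2.2.1
  dd_last := by rw [stepFlag, h.2.2.2.1, stepDim, h.2.2.1]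

/-- The level `i` of `j` is its step in the staircase, so `n - lam j` is `b 0 + ⋯ + b (i - 1)`. -/
theorem IsStaircase.pivot_add_one (h : IsStaircase n lam c a b) (j : Fin m) :
    n + (j.val + 1) - lam j = pivot (stepDim a) (fun k => ∑ i ∈ Finset.range k, b i) j + 1 := by
  have hl := Finset.mem_Icc.mp (h.isFlagType.level_mem j)
  have hlam := h.2.2.2.2 _ (h.isFlagType.level_mem j) j (by
    rcases hl.1.eq_or_lt with h1 | h1
    · simp [← h1]
    · rw [← Finset.Icc_sub_one_right_eq_Ico_of_not_isMin (by simp; lia)]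
      exact md_le_of_lt_level (md := stepDim a) (by lia) (by lia)) (h.isFlagType.lt_md_level j)
  have hsum := Finset.sum_range_add_sum_Ico b hl.2
  rw [h.2.2.2.1] at hsum
  rw [hlam, pivot]
  lia

theorem IsStaircase.projFst_image (h : IsStaircase n lam c a b) :
    projFst '' flagVariety (m + n) c (stepDim a) (stepFlag a b) = schubertVariety n lam := by
  rw [projFst_image_flagVariety h.isFlagType (sum_range_mono b) fun _ => rfl]
  ext x
  exact and_congr Iff.rfl (forall_congr' fun j => by rw [h.pivot_add_one])

theorem IsStaircase.bottSamelson_eq (h : IsStaircase n lam c a b) :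
    bottSamelson m n c a b = flagVariety (m + n) c (stepDim a) (stepFlag a b) := by
  have hc := h.1
  have hblk : ∀ (z : (Fin (m + n) × Fin (m + n)) ⊕
      (Fin (c - 1) × (Fin (m + n) × Fin (m + n))) → ℝ) (i : Fin (c - 1)),
      matY z i = blk z (i + 1) := by
    intro z i
    rw [blk, dif_pos (by simp)]
    rfl
  ext z
  constructor
  · rintro ⟨h1, h2, h3, h4, h5⟩
    have hlast : ∀ k ∈ Finset.Icc 1 c, k ≠ c → ∃ i : Fin (c - 1), k = i + 1 := by
      intro k hk hkc
      rw [Finset.mem_Icc] at hk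
      exact ⟨⟨k - 1, by lia⟩, by simp; lia⟩
    refine ⟨fun k hk => ?_, fun k hk => ?_, fun k hk => ?_⟩
    · by_cases hkc : k = c
      · subst hkc
        rw [blk_last, h.isFlagType.md_last]
        exact h1
      · obtain ⟨i, rfl⟩ := hlast k hk hkc
        rw [← hblk]
        exact h2 i
    · by_cases hkc : k = c
      · subst hkc
        -- The flag condition on `X = Y c` is vacuous, since `dd c` is the full dimension.
        rw [h.isFlagType.dd_last, flagProj_eq_one le_rfl, Matrix.mul_one]
      · obtain ⟨i, rfl⟩ := hlast k hk hkc
        rw [← hblk]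
        exact h3 i
    · rw [Finset.mem_Ico] at hk
      obtain ⟨i, rfl⟩ := hlast k (Finset.mem_Icc.mpr ⟨hk.1, hk.2.le⟩) hk.2.ne
      by_cases hkc : i + 1 + 1 = c
      · have := h5 i hkc
        rw [hblk, ← blk_last] at this
        rwa [hkc]
      · have := h4 i ⟨i + 1, by lia⟩ rfl
        rwa [hblk, hblk] at this
  · intro hz
    have hmem : ∀ i : Fin (c - 1), (i + 1 : ℕ) ∈ Finset.Icc 1 c := fun i =>
      Finset.mem_Icc.mpr ⟨by lia, by lia⟩
    refine ⟨?_, fun i => ?_, fun i => ?_, fun i j hij => ?_, fun i hi => ?_⟩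
    · rw [← blk_last]
      have := hz.1 c h.isFlagType.last_mem
      rwa [h.isFlagType.md_last] at this
    · rw [hblk]
      exact hz.1 _ (hmem i)
    · rw [hblk]
      exact hz.2.1 _ (hmem i)
    · rw [hblk, hblk, hij]
      exact hz.2.2 _ (Finset.mem_Ico.mpr ⟨by lia, by lia⟩)
    · have := hz.2.2 (i + 1) (Finset.mem_Ico.mpr ⟨by lia, by lia⟩)
      rw [show (i + 1 + 1 : ℕ) = c by lia, blk_last] at this
      rwa [hblk]

end Staircase

end RealQAlg

end

noncomputable section

namespace RealQAlg

/-! ### Existence of the staircase integers -/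

section StaircaseExistence

theorem isStaircase_empty (n : ℕ) (lam : Fin 0 → ℕ) :
    IsStaircase n lam 1 (fun _ => 0) (fun _ => n) :=
  ⟨le_rfl, by simp, by simp, by simp, fun _ _ j => j.elim0⟩

variable {m n c : ℕ} {a b : ℕ → ℕ}

theorem sum_Icc_update (a : ℕ → ℕ) (i : ℕ) (hi : 1 ≤ i) :
    ∑ l ∈ Finset.Icc 1 i, Function.update a 1 (a 1 + 1) l = ∑ l ∈ Finset.Icc 1 i, a l + 1 := by
  have h1 : 1 ∈ Finset.Icc 1 i := Finset.mem_Icc.mpr ⟨le_rfl, hi⟩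
  rw [Finset.sum_update_of_mem h1, Finset.sdiff_singleton_eq_erase, ← Finset.add_sum_erase _ a h1]
  lia

theorem sum_Ico_update (a : ℕ → ℕ) (i : ℕ) (hi : 1 < i) :
    ∑ l ∈ Finset.Ico 1 i, Function.update a 1 (a 1 + 1) l = ∑ l ∈ Finset.Ico 1 i, a l + 1 := by
  obtain ⟨i, rfl⟩ := Nat.exists_eq_succ_of_ne_zero (show i ≠ 0 by lia)
  rw [Nat.succ_eq_add_one, Finset.Ico_add_one_right_eq_Icc]
  exact sum_Icc_update a i (by lia)

/-- The new first part is at the height `n - b 0` of the first step, which becomes longer by one. -/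
theorem IsStaircase.extend {lam : Fin (m + 1) → ℕ}
    (h : IsStaircase n (fun j : Fin m => lam j.succ) c a b) (h0 : lam 0 + b 0 = n) :
    IsStaircase n lam c (Function.update a 1 (a 1 + 1)) b := by
  obtain ⟨hc, hpos, ha, hb, hlam⟩ := h
  refine ⟨hc, fun i hi => ⟨?_, (hpos i hi).2⟩, ?_, hb, ?_⟩
  · rcases eq_or_ne i 1 with rfl | hne
    · simp
    · rw [Function.update_of_ne hne]
      exact (hpos i hi).1
  · rw [sum_Icc_update a c hc, ha]
  · intro i hi j hj1 hj2
    have hi' := Finset.mem_Icc.mp hi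
    rw [sum_Icc_update a i hi'.1] at hj2
    rcases hi'.1.eq_or_lt with rfl | hi1
    · cases j using Fin.cases with
      | zero =>
        rw [Finset.range_eq_Ico, Finset.sum_eq_sum_Ico_succ_bot hc] at hb
        rw [zero_add] at hb
        lia
      | succ j =>
        rw [Fin.val_succ] at hj2
        exact hlam 1 hi j (by simp) (by lia)
    · rw [sum_Ico_update a i hi1] at hj1
      cases j using Fin.cases with
      | zero => simp at hj1
      | succ j =>
        rw [Fin.val_succ] at hj1 hj2
        exact hlam i hi j (by lia) (by lia)

/-- Insert a value in front of the values at the positive integers. -/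
def insertFirst (x y : ℕ) (a : ℕ → ℕ) : ℕ → ℕ
  | 0 => x
  | 1 => y
  | k + 2 => a (k + 1)

theorem sum_Ico_insertFirst (x y : ℕ) (a : ℕ → ℕ) {i k : ℕ} (hi : 1 ≤ i) :
    ∑ l ∈ Finset.Ico (i + 1) (k + 1), insertFirst x y a l = ∑ l ∈ Finset.Ico i k, a l := by
  rw [← Finset.sum_Ico_add']
  refine Finset.sum_congr rfl fun l hl => ?_
  obtain ⟨l, rfl⟩ := Nat.exists_eq_succ_of_ne_zero
    (show l ≠ 0 by have := (Finset.mem_Ico.mp hl).1; lia)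
  rfl

theorem sum_Ico_one_insertFirst (x y : ℕ) (a : ℕ → ℕ) {k : ℕ} (hk : 1 ≤ k) :
    ∑ l ∈ Finset.Ico 1 (k + 1), insertFirst x y a l = y + ∑ l ∈ Finset.Ico 1 k, a l := by
  rw [Finset.sum_eq_sum_Ico_succ_bot (by lia), sum_Ico_insertFirst x y a le_rfl]
  rfl

theorem sum_Icc_one_insertFirst (x y : ℕ) (a : ℕ → ℕ) (k : ℕ) :
    ∑ l ∈ Finset.Icc 1 (k + 1), insertFirst x y a l = y + ∑ l ∈ Finset.Icc 1 k, a l := by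
  rw [← Finset.Ico_add_one_right_eq_Icc, ← Finset.Ico_add_one_right_eq_Icc,
    sum_Ico_one_insertFirst x y a (by lia)]

/-- The new first part is higher than the first step, so it forms a step of length one, and the old
`b 0` splits into the new `b 0` and `b 1`. The value of `a` at `0` is never used and is set to zero.
-/
theorem IsStaircase.insert {lam : Fin (m + 1) → ℕ}
    (h : IsStaircase n (fun j : Fin m => lam j.succ) c a b) (hn : lam 0 ≤ n)
    (h0 : n < lam 0 + b 0) :
    IsStaircase n lam (c + 1) (insertFirst 0 1 a)
      (insertFirst (n - lam 0) (lam 0 + b 0 - n) b) := by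
  obtain ⟨hc, hpos, ha, hb, hlam⟩ := h
  rw [Finset.range_eq_Ico, Finset.sum_eq_sum_Ico_succ_bot hc, zero_add] at hb
  have hsum := sum_Ico_one_insertFirst (n - lam 0) (lam 0 + b 0 - n) b hc
  refine ⟨by lia, fun i hi => ?_, ?_, ?_, ?_⟩
  · rw [Finset.mem_Ico] at hi
    rcases i with _ | _ | i
    · lia
    · exact ⟨one_pos, Nat.sub_pos_of_lt h0⟩
    · exact hpos (i + 1) (Finset.mem_Ico.mpr ⟨by lia, by lia⟩)
  · rw [sum_Icc_one_insertFirst, ha, add_comm]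
  · rw [Finset.range_eq_Ico, Finset.sum_eq_sum_Ico_succ_bot (by lia), zero_add, hsum,
      insertFirst]
    lia
  · intro i hi j hj1 hj2
    rw [Finset.mem_Icc] at hi
    rcases hi.1.eq_or_lt with rfl | hi1
    · rw [sum_Icc_one_insertFirst _ _ _ 0] at hj2
      have : j = 0 := Fin.ext (by simpa using hj2)
      rw [this, hsum]
      lia
    · obtain ⟨i, rfl⟩ := Nat.exists_eq_succ_of_ne_zero (show i ≠ 0 by lia)
      rw [Nat.succ_eq_add_one] at *
      rw [sum_Ico_one_insertFirst _ _ _ (by lia)] at hj1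
      rw [sum_Icc_one_insertFirst] at hj2
      rw [sum_Ico_insertFirst _ _ _ (by lia)]
      cases j using Fin.cases with
      | zero => simp at hj1
      | succ j =>
        rw [Fin.val_succ] at hj1 hj2
        exact hlam i (Finset.mem_Icc.mpr ⟨by lia, by lia⟩) j (by lia) (by lia)

theorem IsStaircase.le_add {lam : Fin m → ℕ} (h : IsStaircase n lam c a b) {x : ℕ}
    (hx : ∀ j, lam j ≤ x) : n ≤ x + b 0 := by
  obtain ⟨hc, hpos, ha, hb, hlam⟩ := h
  rw [Finset.range_eq_Ico, Finset.sum_eq_sum_Ico_succ_bot hc, zero_add] at hb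
  rcases hc.eq_or_lt with rfl | hc1
  · simp at hb
    lia
  · have h1 := (hpos 1 (Finset.mem_Ico.mpr ⟨le_rfl, hc1⟩)).1
    have hm : a 1 ≤ m := ha ▸ Finset.single_le_sum (f := a) (fun _ _ => Nat.zero_le _)
      (Finset.mem_Icc.mpr ⟨le_rfl, hc⟩)
    have h2 := hlam 1 (Finset.mem_Icc.mpr ⟨le_rfl, hc⟩) ⟨0, by lia⟩ (by simp) (by simpa using h1)
    have h3 := hx ⟨0, by lia⟩
    lia

/-- Induction by removing the largest part; `le_add` says that only the two cases of `extend` and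
`insert` occur when it is put back. -/
theorem exists_isStaircase (n : ℕ) : ∀ {m : ℕ} (lam : Fin m → ℕ), Antitone lam →
    (∀ k, lam k ≤ n) → ∃ (c : ℕ) (a b : ℕ → ℕ), IsStaircase n lam c a b
  | 0, lam, _, _ => ⟨_, _, _, isStaircase_empty n lam⟩
  | m + 1, lam, hlam, hle => by
    obtain ⟨c, a, b, h⟩ := exists_isStaircase n (fun j : Fin m => lam j.succ)
      (fun i j hij => hlam (Fin.succ_le_succ_iff.mpr hij)) fun k => hle _
    rcases (h.le_add fun j => hlam (Fin.zero_le j.succ)).eq_or_lt with h0 | h0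
    · exact ⟨_, _, _, h.extend h0.symm⟩
    · exact ⟨_, _, _, h.insert (hle 0) h0⟩

end StaircaseExistence

end RealQAlg

end

theorem theorem2p5 (m n : ℕ) (lam : Fin m → ℕ) (hlam : Antitone lam) (hlam_le : ∀ k, lam k ≤ n) :
    RealQAlg.AdmitsQDesingularization (RealQAlg.schubertVariety n lam) ∧
    (∃ (c : ℕ) (a b : ℕ → ℕ), RealQAlg.IsStaircase n lam c a b) ∧
    ∀ (c : ℕ) (a b : ℕ → ℕ), RealQAlg.IsStaircase n lam c a b →
      RealQAlg.IsQDesingularization (RealQAlg.schubertVariety n lam)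
        (RealQAlg.bottSamelson m n c a b) ∧
      RealQAlg.projFst '' RealQAlg.bottSamelson m n c a b = RealQAlg.schubertVariety n lam := by
  have key : ∀ (c : ℕ) (a b : ℕ → ℕ), RealQAlg.IsStaircase n lam c a b →
      RealQAlg.IsQDesingularization (RealQAlg.schubertVariety n lam)
        (RealQAlg.bottSamelson m n c a b) ∧
      RealQAlg.projFst '' RealQAlg.bottSamelson m n c a b = RealQAlg.schubertVariety n lam := by
    intro c a b h
    rw [h.bottSamelson_eq, ← h.projFst_image]
    exact ⟨RealQAlg.isQDesingularization_rankConditions h.isFlagType (RealQAlg.sum_range_mono b)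
      fun _ => rfl, rfl⟩
  have hex := RealQAlg.exists_isStaircase n lam hlam hlam_le
  refine ⟨?_, hex, key⟩
  obtain ⟨c, a, b, h⟩ := hex
  exact ⟨_, inferInstance, _, (key c a b h).1⟩
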